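/- **Setting.** Let $\mathbb T=[-\pi,\pi]$ with endpoints identified, $M[u]=\frac1{2\pi}\int_{-\pi}^{\pi}u(x)\,dx$, $\hat u_k=M[u\,e^{-ikx}]$, $\|u\|_{L^2}^2=M[|u|^2]$, $\|u\|_{\dot H^s}^2=\sum_k|k|^{2s}|\hat u_k|^2$, $\|u\|_{H^s}^2=|\hat u_0|^2+\|u\|^2_{\dot H^s}$; let $\vartheta(x-y)$ be the geodesic distance on $\mathbb T$. Functions take values in $\mathbb R^3$, and $H^s$ functions ($s\ge1$) are identified with their continuous representatives. For a closed unit speed curve $\gamma$ the distortion is $\delta_\infty(\gamma)=\sup_{\vartheta(x-y)>0}\vartheta(x-y)/|\gamma(x)-\gamma(y)|$; $\gamma$ is a bi-Lipschitz embedding if $\ell^{-1}\vartheta(x-y)\le|\gamma(x)-\gamma(y)|\le\vartheta(x-y)$ for some $\ell>0$ and all $x,y$. For a mean zero field $u$ let $P[u](x)=\frac1{2\pi}\int_{-\pi}^{\pi}(z-\pi)u(z)\,dz+\int_{-\pi}^xu(z)\,dz$ be its mean zero primitive, and let $\gamma_\tau=P[\tau]$. Let $K(u,v)$ be a kernel that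 is differentiable in $u$ with $K_u$ continuous on $\{0<u\le v\}$ (with a one-sided derivative at $u=v$). Let $$f_\gamma(x)=\lim_{\varepsilon\downarrow0}\int_{\vartheta(x-y)\ge\varepsilon}K_u\big(|\gamma(x)-\gamma(y)|^2,\vartheta^2(x-y)\big)(\gamma(x)-\gamma(y))\,dy ,$$ the limit being taken in $L^2(\mathbb T)$, whenever it exists. Put $F_{\gamma}=P[f_{\gamma}]$, $A_\tau=\mathrm{Id}-M\big[\frac{\tau\otimes\tau}{|\tau|^2}\big]$, and define $\lambda_\tau\in\mathbb R^3$, $\mu_\tau\in L^1(\mathbb T)$ by $$A_\tau\lambda_\tau=M\Big[\frac{\langle F_{\gamma_\tau},\tau\rangle-|\tau_x|^2}{|\tau|^2}\,\tau\Big],\qquad \mu_\tau=\frac{|\tau_x|^2-\langle F_{\gamma_\tau}+\lambda_\tau,\tau\rangle}{|\tau|^2}.$$ With $S(t)$ the heat semigroup on $\mathbb T$, a mild solution on $[0,T]$ of $$\tau_t=\tau_{xx}+F_{\gamma_\tau}+\lambda_\tau+\mu_\tau\tau,\qquad \tau(0)=\tau_0\in H^1(\mathbb T),$$ is a $\tau\in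 C([0,T];H^1(\mathbb T))$ such that $f_{\gamma_{\tau(t)}}$ exists for every $t\in[0,T]$ and $\tau(t)=S(t)\tau_0+\int_0^tS(t-s)\big[F_{\gamma_{\tau}}+\lambda_{\tau}+\mu_{\tau}\tau\big](s)\,ds$ for every $t\in[0,T]$, the integral converging absolutely at each point $x$. **Corollary.** Assume that there are continuous functions $C(n,\cdot,\cdot)$, $n\in\mathbb N=\{0,1,2,\dots\}$, such that, for each $n$ and each bi-Lipschitz embedding $\gamma\in H^{n+2}(\mathbb T)$ with mean zero and unit speed, the nonlocal integral $f_\gamma$ (if it exists) has an $n$-th weak derivative in $L^2(\mathbb T)$ with $$\|f_\gamma^{(n)}\|_{L^2}\le C\big(n,\delta_\infty(\gamma),\|\gamma\|_{\dot H^{n+2}}\big).$$ Then there is a function $D(n,\varepsilon,a,d,h)$, depending only on $K$ and $C$, with the following property. Let $T>0$ and let $\tau\in C([0,T];H^1(\mathbb T))$ be a mild solution such that, for every $t\in[0,T]$, $\tau(t)$ has mean zero, $|\tau(t)|\equiv1$, and $\gamma_{\tau(t)}$ is a bi-Lipschitz embedding. Then every $A_{\tau(t)}$ is invertible and the maxima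 $$A_*=\max_{[0,T]}\|A_{\tau(t)}^{-1}\|_{\rm op},\qquad \delta_*=\max_{[0,T]}\delta_\infty(\gamma_{\tau(t)}),\qquad H_*=\max_{[0,T]}\|\tau(t)\|_{H^1}$$ exist and are finite; $\tau(t)$ is $C^\infty$ in $x$ for every $t\in(0,T]$; and for all $\varepsilon>0$, $n\in\mathbb N$ and $t\in[\varepsilon,T]$, $$\|\tau(t)\|_{H^{n+2}}\le D(n,\varepsilon,A_*,\delta_*,H_*),\qquad \sup_{k\in\mathbb Z}|k|^{n+3}|\hat\tau_k(t)|\le D(n,\varepsilon,A_*,\delta_*,H_*).$$ -/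

import Mathlib

noncomputable section

namespace CurveFlow

open MeasureTheory Set Filter Topology Real
open scoped ENNReal ContDiff

/-- Three dimensional Euclidean space. -/
abbrev R3 : Type := EuclideanSpace ℝ (Fin 3)

/-! Functions on the torus `𝕋 = [-π, π]` (endpoints identified) are `2π`-periodic functions on `ℝ`;
functions that only matter up to null sets are functions on `ℝ` used on `(-π, π]` alone. -/

/-- Lebesgue measure on the fundamental domain `(-π, π]` of the torus. -/
def torusMeasure : Measure ℝ := volume.restrict (Ioc (-π) π)

/-- The mean `⨍ u = (2π)⁻¹ ∫_{-π}^{π} u`. -/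
def mean {V : Type*} [NormedAddCommGroup V] [NormedSpace ℝ V] (u : ℝ → V) : V :=
  (2 * π)⁻¹ • ∫ x in (-π)..π, u x

/-- The normalized `L²` norm `(⨍ |u|²)^{1/2}` (of a square integrable `u`). -/
def l2Norm (u : ℝ → R3) : ℝ := √(mean fun x => ‖u x‖ ^ 2)

/-- Geodesic distance of `z` from `0` on the torus: the `2π`-periodic function that equals
`min {|z|, 2π - |z|}` on `[-π, π]`. -/
def theta (z : ℝ) : ℝ := ‖(z : AddCircle (2 * π))‖

/-! ### Fourier coefficients and Sobolev spaces -/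

/-- The `k`-th Fourier coefficient `⨍ u(x) e^{-ikx} dx ∈ ℂ³`, computed coordinatewise. -/
def fourierVec (u : ℝ → R3) (k : ℤ) : EuclideanSpace ℂ (Fin 3) :=
  WithLp.toLp 2 fun i =>
    fourierCoeffOn (neg_lt_self Real.pi_pos : -π < π) (fun x => ((u x i : ℝ) : ℂ)) k

lemma fourierVec_apply (u : ℝ → R3) (k : ℤ) (i : Fin 3) :
    fourierVec u k i =
      (2 * π : ℂ)⁻¹ * ∫ x in (-π)..π, Complex.exp (-(Complex.I * k * x)) * ((u x i : ℝ) : ℂ) := by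
  have h2 : π - -π = 2 * π := by ring
  have hpi : (π : ℂ) ≠ 0 := by exact_mod_cast Real.pi_ne_zero
  simp only [fourierVec, fourierCoeffOn_eq_integral, fourier_coe_apply, h2]
  rw [Complex.real_smul]
  congr 1
  · push_cast; simp
  · refine intervalIntegral.integral_congr fun x _ => ?_
    simp only [smul_eq_mul]
    congr 2
    push_cast
    field_simp

/-- Membership in `H^s(𝕋)`: square integrable with `∑ₖ |k|^{2s} |û_k|² < ∞`. -/
def MemSobolev (s : ℕ) (u : ℝ → R3) : Prop :=
  MemLp u 2 torusMeasure ∧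
    Summable fun k : ℤ => |(k : ℝ)| ^ (2 * s) * ‖fourierVec u k‖ ^ 2

/-- The homogeneous norm `‖u‖_{Ḣ^s} = (∑ₖ |k|^{2s} |û_k|²)^{1/2}` of `u ∈ H^s(𝕋)`. -/
def homSobolevNorm (s : ℕ) (u : ℝ → R3) : ℝ :=
  √(∑' k : ℤ, |(k : ℝ)| ^ (2 * s) * ‖fourierVec u k‖ ^ 2)

/-- The norm `‖u‖_{H^s} = (|û_0|² + ‖u‖²_{Ḣ^s})^{1/2}` of `u ∈ H^s(𝕋)`. -/
def sobolevNorm (s : ℕ) (u : ℝ → R3) : ℝ :=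
  √(‖fourierVec u 0‖ ^ 2 + homSobolevNorm s u ^ 2)

/-- `g` is the `n`-th weak derivative of `f` on the torus. -/
def IsWeakDeriv (n : ℕ) (f g : ℝ → R3) : Prop :=
  ∀ φ : ℝ → ℝ, ContDiff ℝ ∞ φ → Function.Periodic φ (2 * π) →
    ∫ x in (-π)..π, iteratedDeriv n φ x • f x = (-1 : ℝ) ^ n • ∫ x in (-π)..π, φ x • g x

/-! ### Closed curves -/

/-- `γ ∈ H^s(𝕋)` is a closed curve with mean zero and unit speed. (Unit speed forces `γ` to be
differentiable, so `γ` is the continuous representative of its class.) -/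
structure IsUnitSpeedCurve (s : ℕ) (γ : ℝ → R3) : Prop where
  periodic : Function.Periodic γ (2 * π)
  memSobolev : MemSobolev s γ
  mean_eq_zero : mean γ = 0
  unit_speed : ∀ x, ‖deriv γ x‖ = 1

/-- `γ` is a bi-Lipschitz embedding of the torus. -/
def IsBiLipschitz (γ : ℝ → R3) : Prop :=
  ∃ l : ℝ, 0 < l ∧
    ∀ x y, l⁻¹ * theta (x - y) ≤ ‖γ x - γ y‖ ∧ ‖γ x - γ y‖ ≤ theta (x - y)

/-- Gromov's distortion `sup_{x ≠ y} ϑ(x-y) / |γ(x) - γ(y)| ∈ [0, ∞]`; a self-intersection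
contributes `∞`. -/
def distortion (γ : ℝ → R3) : ℝ≥0∞ :=
  ⨆ (x : ℝ) (y : ℝ) (_ : 0 < theta (x - y)),
    ENNReal.ofReal (theta (x - y)) / ENNReal.ofReal ‖γ x - γ y‖

/-- The primitive `x ↦ ⨍ (z - π) u(z) dz + ∫_{-π}^x u(z) dz`; for `u` of mean zero it is the
`2π`-periodic primitive of mean zero. -/
def primitive (u : ℝ → R3) (x : ℝ) : R3 :=
  mean (fun z => (z - π) • u z) + ∫ z in (-π)..x, u z

/-- The knot `γ_τ` induced by a tangent field `τ`. -/
def knot (τ : ℝ → R3) : ℝ → R3 := primitive τ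

/-! ### The nonlocal forcing -/

/-- The partial derivative `K_u(u, v)`. The kernel is only evaluated where `0 < u ≤ v`
(chord length at most arc length), so the derivative is taken within this range of `u`
(one-sided at `u = v`). -/
def kernelDeriv (K : ℝ → ℝ → ℝ) (u v : ℝ) : ℝ :=
  derivWithin (fun w => K w v) (Ioc 0 v) u

/-- `K(u, v)` is differentiable in `u`, with `K_u` continuous, on `0 < u ≤ v`. -/
structure IsC1Kernel (K : ℝ → ℝ → ℝ) : Prop where
  differentiable : ∀ v, DifferentiableOn ℝ (fun u => K u v) (Ioc 0 v)
  continuous : ContinuousOn (fun q : ℝ × ℝ => kernelDeriv K q.1 q.2) {q | 0 < q.1 ∧ q.1 ≤ q.2}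

/-- The truncated integral
`∫_{ϑ(x-y) ≥ ε} K_u(|γ(x) - γ(y)|², ϑ(x-y)²) (γ(x) - γ(y)) dy`. -/
def truncatedForce (K : ℝ → ℝ → ℝ) (γ : ℝ → R3) (ε : ℝ) (x : ℝ) : R3 :=
  ∫ y in {y | y ∈ Ioc (-π) π ∧ ε ≤ theta (x - y)},
    kernelDeriv K (‖γ x - γ y‖ ^ 2) (theta (x - y) ^ 2) • (γ x - γ y)

/-- `f = f_γ`: the principal value integral, i.e. the limit in `L²(𝕋)` of the truncated integrals
as `ε ↓ 0`, exists and equals `f` (almost everywhere). -/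
def IsNonlocalForce (K : ℝ → ℝ → ℝ) (γ f : ℝ → R3) : Prop :=
  MemLp f 2 torusMeasure ∧
    Tendsto (fun ε => eLpNorm (fun x => truncatedForce K γ ε x - f x) 2 torusMeasure)
      (𝓝[>] 0) (𝓝 0)

/-! ### The flow `τ_t = τ_xx + F + λ + μ τ` -/

/-- The matrix `A_τ = Id - ⨍ τ ⊗ τ / |τ|²`. -/
def constraintMatrix (τ : ℝ → R3) : Matrix (Fin 3) (Fin 3) ℝ :=
  1 - Matrix.of fun i j => mean fun x => τ x i * τ x j / ‖τ x‖ ^ 2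

/-- The operator norm of `A_τ⁻¹` (for invertible `A_τ`) on Euclidean space. -/
def invNorm (τ : ℝ → R3) : ℝ :=
  ‖Matrix.toEuclideanCLM (n := Fin 3) (𝕜 := ℝ) (constraintMatrix τ)⁻¹‖

/-- The multiplier `λ_τ = A_τ⁻¹ ⨍ ((⟨F, τ⟩ - |τ_x|²) / |τ|²) τ`. A function in `H¹(𝕋)` is
differentiable almost everywhere and `deriv τ` is its weak derivative `τ_x`. -/
def lam (F τ : ℝ → R3) : R3 :=
  Matrix.toEuclideanCLM (n := Fin 3) (𝕜 := ℝ) (constraintMatrix τ)⁻¹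
    (mean fun x => ((inner ℝ (F x) (τ x) - ‖deriv τ x‖ ^ 2) / ‖τ x‖ ^ 2) • τ x)

/-- The multiplier `μ_τ = (|τ_x|² - ⟨F, τ⟩ - ⟨λ_τ, τ⟩) / |τ|²`. -/
def mu (F τ : ℝ → R3) (x : ℝ) : ℝ :=
  (‖deriv τ x‖ ^ 2 - inner ℝ (F x) (τ x) - inner ℝ (lam F τ) (τ x)) / ‖τ x‖ ^ 2

/-- The lower order terms `F + λ_τ + μ_τ τ`, where `F` is the mean zero primitive of `f`. -/
def lowerOrder (f τ : ℝ → R3) (x : ℝ) : R3 :=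
  primitive f x + lam (primitive f) τ + mu (primitive f) τ x • τ x

/-- The periodic heat kernel `(2π)⁻¹ ∑ₖ e^{-k² t} e^{ikz}`, `t > 0` (imaginary parts cancel). -/
def heatKernel (z t : ℝ) : ℝ :=
  (2 * π)⁻¹ * ∑' k : ℤ, Real.exp (-(k : ℝ) ^ 2 * t) * Real.cos (k * z)

/-- The heat semigroup `S(t)` on the torus. -/
def heat (t : ℝ) (u : ℝ → R3) (x : ℝ) : R3 :=
  if t = 0 then u x else ∫ y in (-π)..π, heatKernel (x - y) t • u y

/-- `τ ∈ C([0,T]; H¹(𝕋))` is a mild solution on `[0,T]` of the flow, with initial datum `τ 0`.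
Each `τ t` is the continuous representative of its class; that the forcing `f_{γ_τ}` exists and
that the integrand of Duhamel's formula is integrable is part of the notion. -/
structure IsMildSolution (K : ℝ → ℝ → ℝ) (T : ℝ) (τ : ℝ → ℝ → R3) : Prop where
  continuous : ∀ t ∈ Icc 0 T, Continuous (τ t)
  periodic : ∀ t ∈ Icc 0 T, Function.Periodic (τ t) (2 * π)
  memSobolev : ∀ t ∈ Icc 0 T, MemSobolev 1 (τ t)
  continuous_time : ∀ t₀ ∈ Icc 0 T,
    Tendsto (fun t => sobolevNorm 1 (fun x => τ t x - τ t₀ x)) (𝓝[Icc 0 T] t₀) (𝓝 0)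
  duhamel : ∃ f : ℝ → ℝ → R3,
    (∀ t ∈ Icc 0 T, IsNonlocalForce K (knot (τ t)) (f t)) ∧
    ∀ t ∈ Icc 0 T, ∀ x,
      IntervalIntegrable (fun s => heat (t - s) (lowerOrder (f s) (τ s)) x) volume 0 t ∧
      τ t x = heat t (τ 0) x + ∫ s in (0 : ℝ)..t, heat (t - s) (lowerOrder (f s) (τ s)) x

end CurveFlow

end

noncomputable section

namespace CurveFlow

open MeasureTheory Set Filter Topology Real
open scoped ENNReal ContDiff

/-! ### Scalar Fourier coefficients on the torus -/

/-! The proof is a parabolic bootstrap carried out on Fourier coefficients. A mild solution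
satisfies, mode by mode, the scalar formula of `IsDuhamel.fc_eq`, where `G` denotes the lower order
terms. Since the integral of `e^{-k²(t-s)}` over `s` is at most `k⁻²`, the coefficients of `τ(t)`
decay two powers of `|k|` better than those of `G`, up to a contribution of an earlier time that is
damped by the heat factor (`IsDuhamel.decay`).

To begin with, `τ` is only in `H¹`, so `|τ_x|²τ` is only in `L¹`. The coefficients of `G` are then
merely bounded (`lowerOrder_mean_le`), and those of `τ` are `O(|k|⁻²)` at positive times. From there
on, decay is measured by powers of `rho k = (1 + |k|)^{1/2}`. If `τ` has order `p ≥ 4` on this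
scale, then `τ_x` has order `p - 2`, and the cubic terms of `G` have order `p - 3`: convolving two
coefficient sequences requires a summable remainder, and the remainder `(1 + |k|)^{-3/2}` costs one
unit in the worst case `p = 4` (`Decay.mul`, `decay_lowerOrder_aux`). The heat flow gives back four
units, so every round gains one unit, and finitely many rounds reach any order
(`exists_decay_bound`). Each round uses up half of the available time.

The force enters through the assumed bounds: decay of `τ` gives a bound of `γ` in a Sobolev space,
hence of a derivative of `f`, hence decay of the primitive `F` (`decay_primitive_force`). This needs
`f` to have mean zero, which follows from the antisymmetry of the integrand
(`IsNonlocalForce.integral_eq_zero`). All constants depend only on bounds for `A_τ⁻¹`, the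
distortion and the `H¹` norm. These have maxima in time because `A_τ` is invertible
(`isUnit_constraintMatrix`), the distortion is upper semicontinuous, and `H¹` embeds into the
continuous functions (`exists_isGreatest`). -/

instance isFiniteMeasure_torusMeasure : IsFiniteMeasure torusMeasure := by
  unfold torusMeasure; infer_instance

lemma intervalIntegral_eq_torus {V : Type*} [NormedAddCommGroup V] [NormedSpace ℝ V] (u : ℝ → V) :
    ∫ x in (-π)..π, u x = ∫ x, u x ∂torusMeasure :=
  intervalIntegral.integral_of_le (by linarith [Real.pi_pos])

lemma mean_eq_torus {V : Type*} [NormedAddCommGroup V] [NormedSpace ℝ V] (u : ℝ → V) :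
    mean u = (2 * π)⁻¹ • ∫ x, u x ∂torusMeasure := by
  rw [mean, intervalIntegral_eq_torus]

lemma intervalIntegrable_iff_torus {V : Type*} [NormedAddCommGroup V] {u : ℝ → V} :
    IntervalIntegrable u volume (-π) π ↔ Integrable u torusMeasure :=
  intervalIntegrable_iff_integrableOn_Ioc_of_le (by linarith [Real.pi_pos])

lemma torusMeasure_real_univ : torusMeasure.real univ = 2 * π := by
  simp [torusMeasure, Measure.real, Real.volume_Ioc]
  rw [ENNReal.toReal_ofReal (by positivity)]; ring

/-- A continuous function belongs to every `L^p` of the torus. -/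
lemma memLp_of_continuousOn {V : Type*} [NormedAddCommGroup V] {u : ℝ → V} {p : ℝ≥0∞}
    (hu : ContinuousOn u (Icc (-π) π)) : MemLp u p torusMeasure := by
  obtain ⟨c, hc⟩ := isCompact_Icc.exists_bound_of_continuousOn hu
  refine MemLp.of_bound ?_ c ?_
  · exact (hu.mono Ioc_subset_Icc_self).aestronglyMeasurable measurableSet_Ioc
  · exact (ae_restrict_iff' measurableSet_Ioc).2 (ae_of_all _ fun x hx => hc x (Ioc_subset_Icc_self hx))

/-- The character `x ↦ e^{ikx}`. -/
def expI (k : ℤ) (x : ℝ) : ℂ := Complex.exp (Complex.I * k * x)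

lemma continuous_expI (k : ℤ) : Continuous (expI k) := by unfold expI; fun_prop

lemma norm_expI (k : ℤ) (x : ℝ) : ‖expI k x‖ = 1 := by
  have : Complex.I * k * x = ((k * x : ℝ) : ℂ) * Complex.I := by push_cast; ring
  rw [expI, this, Complex.norm_exp_ofReal_mul_I]

lemma expI_add (j k : ℤ) (x : ℝ) : expI (j + k) x = expI j x * expI k x := by
  rw [expI, expI, expI, ← Complex.exp_add]; congr 1; push_cast; ring

lemma expI_zero (x : ℝ) : expI 0 x = 1 := by simp [expI]

lemma expI_add_right (k : ℤ) (x y : ℝ) : expI k (x + y) = expI k x * expI k y := by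
  rw [expI, expI, expI, ← Complex.exp_add]; congr 1; push_cast; ring

lemma conj_expI (k : ℤ) (x : ℝ) : (starRingEnd ℂ) (expI k x) = expI (-k) x := by
  rw [expI, expI, ← Complex.exp_conj]; simp

lemma expI_periodic (k : ℤ) : Function.Periodic (expI k) (2 * π) := by
  intro x
  rw [expI_add_right]
  have : expI k (2 * π) = 1 := by
    rw [expI]
    exact Complex.exp_eq_one_iff.2 ⟨k, by push_cast; ring⟩
  rw [this, mul_one]

lemma expI_neg_pi (k : ℤ) : expI k (-π) = expI k π := by
  have := expI_periodic k (-π)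
  rw [← this]; congr 1; ring

lemma hasDerivAt_expI (k : ℤ) (x : ℝ) : HasDerivAt (expI k) (Complex.I * k * expI k x) x := by
  have h : HasDerivAt (fun y : ℝ => Complex.I * k * (y : ℂ)) (Complex.I * k * 1) x :=
    (Complex.ofRealCLM.hasDerivAt (x := x)).const_mul _
  have := h.cexp
  rw [mul_one, mul_comm (Complex.exp _)] at this
  exact this

/-- The `k`-th Fourier coefficient of a complex valued function on `(-π, π]`. -/
def fc (u : ℝ → ℂ) (k : ℤ) : ℂ := fourierCoeffOn (neg_lt_self Real.pi_pos : -π < π) u k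

lemma fc_eq (u : ℝ → ℂ) (k : ℤ) :
    fc u k = (2 * π : ℂ)⁻¹ * ∫ x, expI (-k) x * u x ∂torusMeasure := by
  have h2 : π - -π = 2 * π := by ring
  have hpi : (π : ℂ) ≠ 0 := by exact_mod_cast Real.pi_ne_zero
  rw [fc, fourierCoeffOn_eq_integral, intervalIntegral_eq_torus, Complex.real_smul]
  congr 1
  · push_cast; rw [one_div]; congr 1; ring
  · refine integral_congr_ae (ae_of_all _ fun x => ?_)
    simp only [smul_eq_mul, fourier_coe_apply, h2, expI]
    congr 2
    push_cast
    field_simp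

lemma fc_congr {u v : ℝ → ℂ} (h : u =ᵐ[torusMeasure] v) : fc u = fc v :=
  fourierCoeffOn_congr_ae (neg_lt_self Real.pi_pos) h

lemma integrable_expI_mul {u : ℝ → ℂ} (hu : Integrable u torusMeasure) (k : ℤ) :
    Integrable (fun x => expI k x * u x) torusMeasure :=
  hu.bdd_mul (continuous_expI k).aestronglyMeasurable (c := 1)
    (ae_of_all _ fun x => (norm_expI k x).le)

lemma memLp_expI_mul {u : ℝ → ℂ} (hu : MemLp u 2 torusMeasure) (k : ℤ) :
    MemLp (fun x => expI k x * u x) 2 torusMeasure :=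
  MemLp.of_le hu ((continuous_expI k).aestronglyMeasurable.mul hu.1)
    (ae_of_all _ fun x => by simp [norm_expI])

lemma fc_add {u v : ℝ → ℂ} (hu : Integrable u torusMeasure) (hv : Integrable v torusMeasure)
    (k : ℤ) : fc (fun x => u x + v x) k = fc u k + fc v k := by
  simp only [fc_eq, mul_add]
  rw [integral_add (integrable_expI_mul hu _) (integrable_expI_mul hv _), mul_add]

lemma fc_const_mul (u : ℝ → ℂ) (c : ℂ) (k : ℤ) : fc (fun x => c * u x) k = c * fc u k :=
  fourierCoeffOn.const_mul u c k _

lemma fc_sub {u v : ℝ → ℂ} (hu : Integrable u torusMeasure) (hv : Integrable v torusMeasure)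
    (k : ℤ) : fc (fun x => u x - v x) k = fc u k - fc v k := by
  simp only [fc_eq, mul_sub]
  rw [integral_sub (integrable_expI_mul hu _) (integrable_expI_mul hv _), mul_sub]

lemma fc_sum {ι : Type*} (s : Finset ι) {u : ι → ℝ → ℂ}
    (hu : ∀ i ∈ s, Integrable (u i) torusMeasure) (k : ℤ) :
    fc (fun x => ∑ i ∈ s, u i x) k = ∑ i ∈ s, fc (u i) k := by
  simp only [fc_eq, Finset.mul_sum]
  rw [integral_finsetSum _ fun i hi => integrable_expI_mul (hu i hi) _, Finset.mul_sum]

lemma norm_fc_le (u : ℝ → ℂ) (k : ℤ) :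
    ‖fc u k‖ ≤ (2 * π)⁻¹ * ∫ x, ‖u x‖ ∂torusMeasure := by
  have hpi := Real.pi_pos
  rw [fc_eq, norm_mul]
  have : ‖(2 * π : ℂ)⁻¹‖ = (2 * π)⁻¹ := by
    rw [norm_inv, norm_mul, Complex.norm_real, Real.norm_of_nonneg hpi.le]; simp
  rw [this]
  gcongr
  refine (norm_integral_le_integral_norm _).trans (le_of_eq ?_)
  exact integral_congr_ae (ae_of_all _ fun x => by simp [norm_expI])

lemma fc_expI_mul (u : ℝ → ℂ) (m k : ℤ) : fc (fun x => expI m x * u x) k = fc u (k - m) := by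
  simp only [fc_eq]
  congr 2
  ext x
  rw [← mul_assoc, ← expI_add]; congr 2; ring

lemma fc_conj (u : ℝ → ℂ) (k : ℤ) :
    fc (fun x => (starRingEnd ℂ) (u x)) k = (starRingEnd ℂ) (fc u (-k)) := by
  simp only [fc_eq, map_mul, ← integral_conj, conj_expI, map_inv₀, Complex.conj_ofReal]
  simp [Complex.conj_ofNat]

lemma fc_zero_eq (u : ℝ → ℂ) : fc u 0 = (2 * π : ℂ)⁻¹ * ∫ x, u x ∂torusMeasure := by
  simp [fc_eq, expI_zero]

/-- Parseval's identity. -/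
lemma hasSum_norm_sq_fc {u : ℝ → ℂ} (hu : MemLp u 2 torusMeasure) :
    HasSum (fun k => ‖fc u k‖ ^ 2) ((2 * π)⁻¹ * ∫ x, ‖u x‖ ^ 2 ∂torusMeasure) := by
  have := hasSum_sq_fourierCoeffOn (neg_lt_self Real.pi_pos : -π < π) hu
  rwa [show π - -π = 2 * π by ring, intervalIntegral_eq_torus, smul_eq_mul] at this

/-- Polarization reduces Parseval's identity for pairings to the one for squared norms. -/
lemma norm_sq_polarization (a b : ℂ) :
    a * (starRingEnd ℂ) b = ((‖a + b‖ ^ 2 : ℝ) : ℂ) * (1 / 4) - ((‖a - b‖ ^ 2 : ℝ) : ℂ) * (1 / 4)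
      + ((‖a + Complex.I * b‖ ^ 2 : ℝ) : ℂ) * (Complex.I / 4)
      - ((‖a - Complex.I * b‖ ^ 2 : ℝ) : ℂ) * (Complex.I / 4) := by
  simp only [Complex.ofReal_pow, ← Complex.mul_conj', map_add, map_sub, map_mul, Complex.conj_I]
  linear_combination ((1/2) * a * (starRingEnd ℂ) b - (1/2) * (starRingEnd ℂ) a * b ) * Complex.I_sq

lemma integrable_norm_sq {u : ℝ → ℂ} (hu : MemLp u 2 torusMeasure) :
    Integrable (fun x => ‖u x‖ ^ 2) torusMeasure := hu.integrable_norm_pow (by norm_num)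

/-- Parseval's identity for the inner product. -/
lemma hasSum_fc_mul_conj {u v : ℝ → ℂ} (hu : MemLp u 2 torusMeasure) (hv : MemLp v 2 torusMeasure) :
    HasSum (fun k => fc u k * (starRingEnd ℂ) (fc v k))
      ((2 * π : ℂ)⁻¹ * ∫ x, u x * (starRingEnd ℂ) (v x) ∂torusMeasure) := by
  have hiv : MemLp (fun x => Complex.I * v x) 2 torusMeasure := hv.const_mul _
  have iu : Integrable u torusMeasure := hu.integrable (by norm_num)
  have iv : Integrable v torusMeasure := hv.integrable (by norm_num)
  have iiv : Integrable (fun x => Complex.I * v x) torusMeasure := hiv.integrable (by norm_num)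
  have key : ∀ w : ℝ → ℂ, MemLp w 2 torusMeasure → ∀ c : ℂ,
      HasSum (fun k => ((‖fc w k‖ ^ 2 : ℝ) : ℂ) * c)
        ((2 * π : ℂ)⁻¹ * ∫ x, ((‖w x‖ ^ 2 : ℝ) : ℂ) * c ∂torusMeasure) := by
    intro w hw c
    have := (Complex.hasSum_ofReal.2 (hasSum_norm_sq_fc hw)).mul_right c
    convert! this using 1
    rw [integral_mul_const, integral_complex_ofReal]
    push_cast; ring
  have h1 := key _ (hu.add hv) (1 / 4)
  have h2 := key _ (hu.sub hv) (1 / 4)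
  have h3 := key _ (hu.add hiv) (Complex.I / 4)
  have h4 := key _ (hu.sub hiv) (Complex.I / 4)
  have hi : ∀ w : ℝ → ℂ, MemLp w 2 torusMeasure → ∀ c : ℂ,
      Integrable (fun x => ((‖w x‖ ^ 2 : ℝ) : ℂ) * c) torusMeasure := fun w hw c =>
    ((integrable_norm_sq hw).ofReal).mul_const c
  have h := ((h1.sub h2).add h3).sub h4
  rw [← mul_sub, ← mul_add, ← mul_sub, ← integral_sub (hi _ (hu.add hv) _) (hi _ (hu.sub hv) _)] at h
  have e1 := integral_add ((hi _ (hu.add hv) (1 / 4)).sub (hi _ (hu.sub hv) (1 / 4)))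
    (hi _ (hu.add hiv) (Complex.I / 4))
  have e2 := integral_sub (((hi _ (hu.add hv) (1 / 4)).sub (hi _ (hu.sub hv) (1 / 4))).add
    (hi _ (hu.add hiv) (Complex.I / 4))) (hi _ (hu.sub hiv) (Complex.I / 4))
  simp only [Pi.sub_apply, Pi.add_apply] at e1 e2 h
  rw [← e1, ← e2] at h
  convert! h using 1
  · ext k
    have e1 : fc (u + v) k = fc u k + fc v k := fc_add iu iv k
    have e2 : fc (u - v) k = fc u k - fc v k := fc_sub iu iv k
    have e3 : fc (u + fun x => Complex.I * v x) k = fc u k + Complex.I * fc v k := by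
      rw [← fc_const_mul]; exact fc_add iu iiv k
    have e4 : fc (u - fun x => Complex.I * v x) k = fc u k - Complex.I * fc v k := by
      rw [← fc_const_mul]; exact fc_sub iu iiv k
    rw [e1, e2, e3, e4, norm_sq_polarization]
  · congr 2
    ext x
    exact norm_sq_polarization _ _

/-- The Fourier coefficients of a product are the convolution of the Fourier coefficients. -/
lemma hasSum_fc_mul {u v : ℝ → ℂ} (hu : MemLp u 2 torusMeasure) (hv : MemLp v 2 torusMeasure)
    (k : ℤ) : HasSum (fun j => fc u j * fc v (k - j)) (fc (fun x => u x * v x) k) := by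
  -- The `k`-th coefficient of `u v` is the `L²` pairing of `u` with `e^{ikx}` times the conjugate
  -- of `v`, whose `j`-th coefficient is the conjugate of that of `v` at `k - j`.
  have hw : MemLp (fun x => expI k x * (starRingEnd ℂ) (v x)) 2 torusMeasure :=
    memLp_expI_mul hv.star k
  have h := hasSum_fc_mul_conj hu hw
  convert h using 1
  · ext j
    rw [fc_expI_mul, fc_conj]; simp
  · rw [fc_eq]
    congr 2
    ext x
    simp only [map_mul, conj_expI, Complex.conj_conj]; ring

/-- An `L²` function is determined by its Fourier coefficients. -/
lemma ae_eq_zero_of_fc {u : ℝ → ℂ} (hu : MemLp u 2 torusMeasure) (h : ∀ k, fc u k = 0) :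
    u =ᵐ[torusMeasure] 0 := by
  have h1 := hasSum_norm_sq_fc hu
  simp only [h, norm_zero, ne_eq, OfNat.ofNat_ne_zero, not_false_eq_true, zero_pow] at h1
  have h2 := h1.unique hasSum_zero
  have h3 : ∫ x, ‖u x‖ ^ 2 ∂torusMeasure = 0 := by
    have := Real.pi_pos
    rcases mul_eq_zero.1 h2 with h | h
    · exact absurd h (by positivity)
    · exact h
  rw [integral_eq_zero_iff_of_nonneg (fun x => by positivity) (integrable_norm_sq hu)] at h3
  filter_upwards [h3] with x hx
  simpa using hx

lemma ae_eq_of_fc {u v : ℝ → ℂ} (hu : MemLp u 2 torusMeasure) (hv : MemLp v 2 torusMeasure)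
    (h : ∀ k, fc u k = fc v k) : u =ᵐ[torusMeasure] v := by
  have := ae_eq_zero_of_fc (hu.sub hv) fun k => by
    have := fc_sub (hu.integrable (by norm_num)) (hv.integrable (by norm_num)) k
    rw [h, sub_self] at this
    exact this
  filter_upwards [this] with x hx
  exact sub_eq_zero.1 hx

/-- The Riesz–Fischer theorem. -/
lemma exists_fc_eq {a : ℤ → ℂ} (ha : Summable fun k => ‖a k‖ ^ 2) :
    ∃ g : ℝ → ℂ, MemLp g 2 torusMeasure ∧ ∀ k, fc g k = a k := by
  have : Fact (0 < π - -π) := ⟨by linarith [Real.pi_pos]⟩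
  let b : lp (fun _ : ℤ => ℂ) 2 := ⟨a, memℓp_gen (by simpa using ha)⟩
  let G := (fourierBasis (T := π - -π)).repr.symm b
  have hG : ∀ k, fourierCoeff (G : AddCircle (π - -π) → ℂ) k = a k := by
    intro k
    rw [← fourierBasis_repr]
    simp [G, b]
  have hmp := AddCircle.measurePreserving_mk (π - -π) (-π)
  rw [show -π + (π - -π) = π by ring] at hmp
  have hGm : MemLp (G : AddCircle (π - -π) → ℂ) 2 volume := by
    exact memLp_haarAddCircle_iff.1 (Lp.memLp G)
  refine ⟨fun x => G (x : AddCircle (π - -π)), hGm.comp_measurePreserving hmp, fun k => ?_⟩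
  rw [← hG k, fc, fourierCoeffOn_eq_integral, fourierCoeff_eq_intervalIntegral _ _ (-π)]
  rw [show -π + (π - -π) = π by ring]

/-- Integration by parts against the primitive of an integrable function. -/
lemma integral_mul_integral {e f : ℝ → ℂ} (he : Continuous e) (hf : Integrable f torusMeasure) :
    ∫ x, e x * (∫ z in (-π)..x, f z) ∂torusMeasure
      = ∫ z, (∫ x in z..π, e x) * f z ∂torusMeasure := by
  -- Fubini on the triangle `z ≤ x` needs only integrability of `f`, not differentiability of its
  -- primitive.
  let Φ : ℝ × ℝ → ℂ := fun p => {q : ℝ × ℝ | q.2 ≤ q.1}.indicator (fun q => e q.1 * f q.2) p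
  have hms : MeasurableSet {q : ℝ × ℝ | q.2 ≤ q.1} := measurableSet_le measurable_snd measurable_fst
  have hint : Integrable Φ (torusMeasure.prod torusMeasure) :=
    Integrable.indicator (Integrable.mul_prod (f := e) (g := f)
      ((memLp_of_continuousOn (p := 1) he.continuousOn).integrable le_rfl) hf) hms
  have hsw := integral_integral_swap (f := fun x z => Φ (x, z)) hint
  have hL : ∀ x ∈ Ioc (-π) π, ∫ z, Φ (x, z) ∂torusMeasure = e x * ∫ z in (-π)..x, f z := by
    intro x hx
    have : (fun z => Φ (x, z)) = (Iic x).indicator (fun z => e x * f z) := by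
      ext z; simp [Φ, indicator]
    rw [this, integral_indicator measurableSet_Iic, torusMeasure,
      Measure.restrict_restrict measurableSet_Iic, intervalIntegral.integral_of_le hx.1.le,
      integral_const_mul]
    congr 3
    ext z; simp only [mem_inter_iff, mem_Iic, mem_Ioc]
    exact ⟨fun h => ⟨h.2.1, h.1⟩, fun h => ⟨h.2, h.1, h.2.trans hx.2⟩⟩
  have hR : ∀ z ∈ Ioc (-π) π, ∫ x, Φ (x, z) ∂torusMeasure = (∫ x in z..π, e x) * f z := by
    intro z hz
    have : (fun x => Φ (x, z)) = (Ici z).indicator (fun x => e x * f z) := by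
      ext x; simp [Φ, indicator]
    rw [this, integral_indicator measurableSet_Ici, torusMeasure,
      Measure.restrict_restrict measurableSet_Ici,
      show Ici z ∩ Ioc (-π) π = Icc z π by
        ext x; simp only [mem_inter_iff, mem_Ici, mem_Ioc, mem_Icc]
        exact ⟨fun h => ⟨h.1, h.2.2⟩, fun h => ⟨h.1, hz.1.trans_le h.1, h.2⟩⟩,
      integral_mul_const, integral_Icc_eq_integral_Ioc, ← intervalIntegral.integral_of_le hz.2]
  have e1 : ∫ x, ∫ z, Φ (x, z) ∂torusMeasure ∂torusMeasure
      = ∫ x, e x * (∫ z in (-π)..x, f z) ∂torusMeasure := setIntegral_congr_fun measurableSet_Ioc hL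
  have e2 : ∫ z, ∫ x, Φ (x, z) ∂torusMeasure ∂torusMeasure
      = ∫ z, (∫ x in z..π, e x) * f z ∂torusMeasure := setIntegral_congr_fun measurableSet_Ioc hR
  rw [← e1, hsw, e2]

/-- Fourier coefficients of the primitive of a function of mean zero. -/
lemma fc_integral {f : ℝ → ℂ} (hf : Integrable f torusMeasure)
    (h0 : ∫ x, f x ∂torusMeasure = 0) (k : ℤ) :
    Complex.I * k * fc (fun x => ∫ z in (-π)..x, f z) k = fc f k := by
  rcases eq_or_ne k 0 with rfl | hk
  · simp [fc_zero_eq, h0]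
  have hk' : (k : ℂ) ≠ 0 := by exact_mod_cast hk
  have hI := Complex.I_ne_zero
  -- The second term is a multiple of `f` itself, so its integral vanishes by the mean zero
  -- assumption.
  have hR : ∀ z : ℝ, (∫ x in z..π, expI (-k) x) * f z
      = (Complex.I * k)⁻¹ * (expI (-k) z * f z) - (Complex.I * k)⁻¹ * expI (-k) π * f z := by
    intro z
    have hd : ∀ x ∈ uIcc z π,
        HasDerivAt (fun y => -(Complex.I * k)⁻¹ * expI (-k) y) (expI (-k) x) x := by
      intro x _
      convert! (hasDerivAt_expI (-k) x).const_mul (-(Complex.I * k)⁻¹) using 1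
      push_cast; field_simp
    rw [intervalIntegral.integral_eq_sub_of_hasDerivAt hd
      ((continuous_expI _).intervalIntegrable _ _)]
    ring
  rw [fc_eq, fc_eq, integral_mul_integral (continuous_expI _) hf]
  simp only [hR]
  rw [integral_sub ((integrable_expI_mul hf _).const_mul _) (hf.const_mul _), integral_const_mul,
      integral_const_mul, h0, mul_zero, sub_zero]
  field_simp

/-- The mean of the primitive of an integrable function. -/
lemma integral_integral_eq {f : ℝ → ℂ} (hf : Integrable f torusMeasure) :
    ∫ x, (∫ z in (-π)..x, f z) ∂torusMeasure = ∫ z, ((π - z : ℝ) : ℂ) * f z ∂torusMeasure := by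
  have := integral_mul_integral (e := fun _ => 1) continuous_const hf
  simpa using this

lemma fc_const (c : ℂ) (k : ℤ) : fc (fun _ => c) k = if k = 0 then c else 0 := by
  have hpi : (π : ℂ) ≠ 0 := by exact_mod_cast Real.pi_ne_zero
  split_ifs with hk
  · subst hk
    rw [fc_zero_eq, integral_const, torusMeasure_real_univ, Complex.real_smul]
    push_cast; field_simp
  · have hk' : (k : ℂ) ≠ 0 := by exact_mod_cast hk
    have h5 : ∀ x : ℝ, HasDerivAt (fun y => (Complex.I * -k)⁻¹ * c * expI (-k) y)
        (expI (-k) x * c) x := fun x => by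
      convert! (hasDerivAt_expI (-k) x).const_mul ((Complex.I * -k)⁻¹ * c) using 1
      have hI := Complex.I_ne_zero
      push_cast; field_simp
    rw [fc_eq, ← intervalIntegral_eq_torus,
      intervalIntegral.integral_eq_sub_of_hasDerivAt (fun x _ => h5 x)
        (((continuous_expI _).mul continuous_const).intervalIntegrable _ _), expI_neg_pi,
      sub_self, mul_zero]

/-! ### Vector valued functions: components, derivatives and primitives -/

/-- The `i`-th component of a vector field, as a complex valued function. -/
def cpt (u : ℝ → R3) (i : Fin 3) (x : ℝ) : ℂ := ((u x i : ℝ) : ℂ)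

lemma fourierVec_cpt (u : ℝ → R3) (k : ℤ) (i : Fin 3) : fourierVec u k i = fc (cpt u i) k := rfl

lemma norm_sq_fourierVec (u : ℝ → R3) (k : ℤ) :
    ‖fourierVec u k‖ ^ 2 = ∑ i, ‖fc (cpt u i) k‖ ^ 2 := by
  rw [EuclideanSpace.norm_sq_eq]; rfl

lemma norm_fc_cpt_le (u : ℝ → R3) (k : ℤ) (i : Fin 3) :
    ‖fc (cpt u i) k‖ ≤ ‖fourierVec u k‖ := by
  rw [← fourierVec_cpt]; exact PiLp.norm_apply_le _ _

lemma norm_cpt_le (u : ℝ → R3) (i : Fin 3) (x : ℝ) : ‖cpt u i x‖ ≤ ‖u x‖ := by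
  rw [cpt, Complex.norm_real]; exact PiLp.norm_apply_le _ _

lemma norm_sq_eq_sum_cpt (u : ℝ → R3) (x : ℝ) : ‖u x‖ ^ 2 = ∑ i, ‖cpt u i x‖ ^ 2 := by
  rw [EuclideanSpace.norm_sq_eq]; simp [cpt]

lemma continuous_cpt {u : ℝ → R3} (hu : Continuous u) (i : Fin 3) : Continuous (cpt u i) := by
  unfold cpt; fun_prop

lemma memLp_cpt {u : ℝ → R3} {p : ℝ≥0∞} (hu : MemLp u p torusMeasure) (i : Fin 3) :
    MemLp (cpt u i) p torusMeasure := by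
  refine MemLp.of_le hu ?_ (ae_of_all _ (norm_cpt_le u i))
  exact Complex.continuous_ofReal.comp_aestronglyMeasurable
    ((EuclideanSpace.proj (𝕜 := ℝ) i).continuous.comp_aestronglyMeasurable hu.1)

lemma integrable_cpt {u : ℝ → R3} (hu : Integrable u torusMeasure) (i : Fin 3) :
    Integrable (cpt u i) torusMeasure :=
  memLp_one_iff_integrable.1 (memLp_cpt (memLp_one_iff_integrable.2 hu) i)

lemma memLp_of_cpt {u : ℝ → R3} {p : ℝ≥0∞} (hu : ∀ i, MemLp (cpt u i) p torusMeasure) :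
    MemLp u p torusMeasure := by
  have h : ∀ i, MemLp (fun x => u x i) p torusMeasure := fun i => by
    have := (hu i).re
    simpa [cpt] using this
  have h2 : MemLp (fun x => ∑ i, u x i • (EuclideanSpace.single i (1 : ℝ) : R3)) p torusMeasure := by
    refine memLp_finsetSum _ fun i _ => ?_
    refine MemLp.of_le (h i) ?_ (ae_of_all _ fun x => by simp [norm_smul])
    exact (h i).1.smul_const (EuclideanSpace.single i (1 : ℝ) : R3)
  convert h2 using 2 with x
  ext j
  simp [Finset.sum_apply, Pi.single_apply]

lemma integral_cpt {u : ℝ → R3} (μ : Measure ℝ) (hu : Integrable u μ) (i : Fin 3) :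
    ∫ x, cpt u i x ∂μ = (((∫ x, u x ∂μ) i : ℝ) : ℂ) := by
  have h := (EuclideanSpace.proj (𝕜 := ℝ) i).integral_comp_comm hu
  refine Eq.trans ?_ (congrArg _ h)
  exact integral_complex_ofReal

/-- Parseval's identity for vector fields. -/
lemma hasSum_norm_sq_fourierVec {u : ℝ → R3} (hu : MemLp u 2 torusMeasure) :
    HasSum (fun k => ‖fourierVec u k‖ ^ 2) (mean fun x => ‖u x‖ ^ 2) := by
  have h := hasSum_sum (s := Finset.univ) fun i (_ : i ∈ Finset.univ) =>
    hasSum_norm_sq_fc (memLp_cpt hu i)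
  convert! h using 1
  · ext k; exact norm_sq_fourierVec u k
  · rw [← Finset.mul_sum, ← integral_finsetSum _ fun i _ => integrable_norm_sq (memLp_cpt hu i),
      mean_eq_torus, smul_eq_mul]
    simp only [norm_sq_eq_sum_cpt]

lemma summable_sq_fc_cpt {s : ℕ} {u : ℝ → R3} (hu : MemSobolev s u) (i : Fin 3) :
    Summable fun k : ℤ => |(k : ℝ)| ^ (2 * s) * ‖fc (cpt u i) k‖ ^ 2 :=
  hu.2.of_nonneg_of_le (fun k => by positivity) fun k => by
    gcongr; exact norm_fc_cpt_le u k i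

/-- A continuous function in `H¹` is differentiable almost everywhere, and the derivative is
square integrable with the expected Fourier coefficients. -/
lemma exists_ae_hasDerivAt {u : ℝ → ℂ} (hu : Continuous u)
    (hs : Summable fun k : ℤ => |(k : ℝ)| ^ 2 * ‖fc u k‖ ^ 2) :
    ∃ g : ℝ → ℂ, MemLp g 2 torusMeasure ∧ (∀ k : ℤ, fc g k = Complex.I * k * fc u k) ∧
      ∀ᵐ x ∂torusMeasure, HasDerivAt u (g x) x := by
  have hpi := Real.pi_pos
  obtain ⟨g, hg, hgk⟩ := exists_fc_eq (a := fun k : ℤ => Complex.I * k * fc u k) (by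
    convert! hs using 2 with k
    rw [norm_mul, norm_mul, Complex.norm_I, one_mul, mul_pow, Complex.norm_intCast])
  refine ⟨g, hg, hgk, ?_⟩
  have gi : Integrable g torusMeasure := hg.integrable (by norm_num)
  -- The candidate derivative `g` has no zero mode, so its primitive `W` has the same coefficients
  -- as `u` except at `k = 0`; the constant `c` repairs that one.
  have g0 : ∫ x, g x ∂torusMeasure = 0 := by
    have := hgk 0
    rw [fc_zero_eq] at this
    simpa [hpi.ne'] using this
  have gii : IntervalIntegrable g volume (-π) π := intervalIntegrable_iff_torus.2 gi
  let W : ℝ → ℂ := fun x => ∫ z in (-π)..x, g z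
  have hW : ContinuousOn W (Icc (-π) π) := by
    have := intervalIntegral.continuousOn_primitive_interval' gii left_mem_uIcc
    rwa [uIcc_of_le (by linarith)] at this
  have hWL : MemLp W 2 torusMeasure := memLp_of_continuousOn hW
  have huL : MemLp u 2 torusMeasure := memLp_of_continuousOn hu.continuousOn
  let c : ℂ := fc (fun x => u x - W x) 0
  have hcL : MemLp (fun _ : ℝ => c) 2 torusMeasure := memLp_const c
  have hae : u =ᵐ[torusMeasure] fun x => W x + c := by
    refine ae_eq_of_fc huL (hWL.add hcL) fun k => ?_
    have e1 : fc (fun x => W x + c) k = fc W k + fc (fun _ => c) k :=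
      fc_add (hWL.integrable (by norm_num)) (hcL.integrable (by norm_num)) k
    have e2 : fc (fun x => u x - W x) k = fc u k - fc W k :=
      fc_sub (huL.integrable (by norm_num)) (hWL.integrable (by norm_num)) k
    have e3 : Complex.I * k * fc W k = fc g k := fc_integral gi g0 k
    have e4 := fc_const c k
    rw [e1, e4]
    split_ifs with hk
    · subst hk; rw [show c = fc u 0 - fc W 0 from e2]; ring
    · rw [hgk] at e3
      have hk' : Complex.I * (k : ℂ) ≠ 0 :=
        mul_ne_zero Complex.I_ne_zero (by exact_mod_cast hk)
      rw [add_zero]; exact (mul_left_cancel₀ hk' e3).symm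
  have heq : EqOn u (fun x => W x + c) (Ioo (-π) π) := by
    refine Measure.eqOn_open_of_ae_eq (μ := volume) ?_ isOpen_Ioo hu.continuousOn
      ((hW.mono Ioo_subset_Icc_self).add continuousOn_const)
    exact ae_restrict_of_ae_restrict_of_subset Ioo_subset_Ioc_self hae
  -- Lebesgue differentiation applies to `W`; the identity `u = W + c` holds on an open interval, so
  -- the derivative passes to `u`.
  have hd := gii.ae_hasDerivAt_integral
  rw [torusMeasure, ← restrict_Ioo_eq_restrict_Ioc, ae_restrict_iff' measurableSet_Ioo]
  filter_upwards [hd] with x hx hxI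
  have hx2 := hx (by rw [uIcc_of_le (by linarith)]; exact Ioo_subset_Icc_self hxI) (-π) left_mem_uIcc
  refine (hx2.add_const c).congr_of_eventuallyEq ?_
  filter_upwards [isOpen_Ioo.mem_nhds hxI] with y hy using heq hy

lemma ae_hasDerivAt_of_memSobolev {τ : ℝ → R3} (hc : Continuous τ) (hs : MemSobolev 1 τ) :
    ∀ᵐ x ∂torusMeasure, HasDerivAt τ (deriv τ x) x := by
  have h : ∀ i, ∃ g : ℝ → ℂ, MemLp g 2 torusMeasure ∧
      (∀ k : ℤ, fc g k = Complex.I * k * fc (cpt τ i) k) ∧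
      ∀ᵐ x ∂torusMeasure, HasDerivAt (cpt τ i) (g x) x := fun i =>
    exists_ae_hasDerivAt (continuous_cpt hc i) (by simpa using summable_sq_fc_cpt hs i)
  choose g h1 h2 h3 using h
  filter_upwards [ae_all_iff.2 h3] with x hx
  have : DifferentiableAt ℝ τ x := by
    rw [differentiableAt_euclidean]
    intro i
    have := (Complex.reCLM.hasFDerivAt (x := cpt τ i x)).comp_hasDerivAt x (hx i)
    exact this.differentiableAt
  exact this.hasDerivAt

/-- The Fourier coefficients of the derivative of a vector field in `H¹`. -/
lemma deriv_of_memSobolev {τ : ℝ → R3} (hc : Continuous τ) (hs : MemSobolev 1 τ) (i : Fin 3) :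
    MemLp (cpt (deriv τ) i) 2 torusMeasure ∧
      ∀ k : ℤ, fc (cpt (deriv τ) i) k = Complex.I * k * fc (cpt τ i) k := by
  obtain ⟨g, h1, h2, h3⟩ := exists_ae_hasDerivAt (continuous_cpt hc i)
    (by simpa using summable_sq_fc_cpt hs i)
  have hae : cpt (deriv τ) i =ᵐ[torusMeasure] g := by
    filter_upwards [h3, ae_hasDerivAt_of_memSobolev hc hs] with x hx hτ
    have hi : HasDerivAt (fun y => τ y i) (deriv τ x i) x :=
      ((EuclideanSpace.proj (𝕜 := ℝ) i).hasFDerivAt (x := τ x)).comp_hasDerivAt x hτ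
    exact hi.ofReal_comp.unique hx
  exact ⟨h1.ae_eq hae.symm, fun k => by rw [fc_congr hae, h2]⟩

lemma memLp_deriv {τ : ℝ → R3} (hc : Continuous τ) (hs : MemSobolev 1 τ) :
    MemLp (deriv τ) 2 torusMeasure :=
  memLp_of_cpt fun i => (deriv_of_memSobolev hc hs i).1

lemma mean_norm_sq_deriv {τ : ℝ → R3} (hc : Continuous τ) (hs : MemSobolev 1 τ) :
    (mean fun x => ‖deriv τ x‖ ^ 2) = homSobolevNorm 1 τ ^ 2 := by
  rw [homSobolevNorm, Real.sq_sqrt (tsum_nonneg fun k => by positivity),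
    ← (hasSum_norm_sq_fourierVec (memLp_deriv hc hs)).tsum_eq]
  refine tsum_congr fun k => ?_
  rw [norm_sq_fourierVec, norm_sq_fourierVec, Finset.mul_sum]
  refine Finset.sum_congr rfl fun i _ => ?_
  rw [(deriv_of_memSobolev hc hs i).2, norm_mul, norm_mul, Complex.norm_I, one_mul, mul_pow,
    Complex.norm_intCast]

/-! ### Primitives -/

lemma integrable_Ioc_of_mem {f : ℝ → R3} (hf : Integrable f torusMeasure) {x : ℝ}
    (hx : x ∈ Icc (-π) π) : IntervalIntegrable f volume (-π) x :=
  (intervalIntegrable_iff_torus.2 hf).mono_set (by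
    rw [uIcc_of_le hx.1, uIcc_of_le (by linarith [Real.pi_pos])]; exact Icc_subset_Icc_right hx.2)

lemma continuousOn_primitive {f : ℝ → R3} (hf : Integrable f torusMeasure) :
    ContinuousOn (primitive f) (Icc (-π) π) := by
  have := intervalIntegral.continuousOn_primitive_interval'
    (intervalIntegrable_iff_torus.2 hf) left_mem_uIcc
  rw [uIcc_of_le (by linarith [Real.pi_pos])] at this
  exact continuousOn_const.add this

lemma integrable_sub_pi_smul {f : ℝ → R3} (hf : Integrable f torusMeasure) :
    Integrable (fun z => (z - π) • f z) torusMeasure := by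
  have hpi := Real.pi_pos
  refine hf.bdd_smul (φ := fun z => z - π) (2 * π) (by fun_prop) ?_
  refine (ae_restrict_iff' measurableSet_Ioc).2 (ae_of_all _ fun x hx => ?_)
  rw [Real.norm_eq_abs, abs_le]; constructor <;> linarith [hx.1, hx.2]

lemma cpt_primitive {f : ℝ → R3} (hf : Integrable f torusMeasure) (i : Fin 3) {x : ℝ}
    (hx : x ∈ Icc (-π) π) :
    cpt (primitive f) i x = cpt (fun _ => mean fun z => (z - π) • f z) i x
      + ∫ z in (-π)..x, cpt f i z := by
  have h := integral_cpt (volume.restrict (Ioc (-π) x))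
    ((intervalIntegrable_iff_integrableOn_Ioc_of_le hx.1).1 (integrable_Ioc_of_mem hf hx)) i
  rw [← intervalIntegral.integral_of_le hx.1, ← intervalIntegral.integral_of_le hx.1] at h
  rw [h]
  simp [cpt, primitive]

/-- The constant in `primitive` is minus the mean of the plain integral from `-π`, by Fubini, which
kills the zero mode. The other modes do not see constants. -/
lemma fc_primitive {f : ℝ → R3} (hf : Integrable f torusMeasure)
    (h0 : ∫ x, f x ∂torusMeasure = 0) (i : Fin 3) :
    fc (cpt (primitive f) i) 0 = 0 ∧
      ∀ k : ℤ, Complex.I * k * fc (cpt (primitive f) i) k = fc (cpt f i) k := by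
  have hpi := Real.pi_pos
  have hpi' : (π : ℂ) ≠ 0 := by exact_mod_cast hpi.ne'
  have hfi := integrable_cpt hf i
  set m : R3 := mean fun z => (z - π) • f z with hm
  let W : ℝ → ℂ := fun x => ∫ z in (-π)..x, cpt f i z
  have hW : ContinuousOn W (Icc (-π) π) := by
    have := intervalIntegral.continuousOn_primitive_interval'
      (intervalIntegrable_iff_torus.2 hfi) left_mem_uIcc
    rwa [uIcc_of_le (by linarith)] at this
  have hWi : Integrable W torusMeasure :=
    (memLp_of_continuousOn (p := 1) hW).integrable le_rfl
  have hae : cpt (primitive f) i =ᵐ[torusMeasure] fun x => ((m i : ℝ) : ℂ) + W x := by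
    refine (ae_restrict_iff' measurableSet_Ioc).2 (ae_of_all _ fun x hx => ?_)
    exact cpt_primitive hf i (Ioc_subset_Icc_self hx)
  have hF : ∀ k, fc (cpt (primitive f) i) k = fc (fun _ => ((m i : ℝ) : ℂ)) k + fc W k := by
    intro k
    rw [fc_congr hae]
    exact fc_add (integrable_const _) hWi k
  have h0i : ∫ x, cpt f i x ∂torusMeasure = 0 := by
    rw [integral_cpt _ hf, h0]; simp
  constructor
  · rw [hF, fc_zero_eq, fc_zero_eq, integral_integral_eq hfi, integral_const,
      torusMeasure_real_univ, Complex.real_smul]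
    have e1 : ((m i : ℝ) : ℂ) = (2 * π : ℂ)⁻¹ * ∫ z, ((z - π : ℝ) : ℂ) * cpt f i z ∂torusMeasure := by
      have := integral_cpt _ (integrable_sub_pi_smul hf) i
      rw [hm, mean_eq_torus, PiLp.smul_apply, smul_eq_mul, Complex.ofReal_mul, ← this]
      congr 1
      · push_cast; rfl
      · refine integral_congr_ae (ae_of_all _ fun x => by simp [cpt])
    have e2 : ∫ z, ((π - z : ℝ) : ℂ) * cpt f i z ∂torusMeasure
        = -∫ z, ((z - π : ℝ) : ℂ) * cpt f i z ∂torusMeasure := by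
      rw [← integral_neg]
      refine integral_congr_ae (ae_of_all _ fun x => ?_)
      push_cast; ring
    rw [e1, e2]; push_cast; field_simp; ring
  · intro k
    rw [hF, mul_add, fc_integral hfi h0i]
    rcases eq_or_ne k 0 with rfl | hk
    · simp
    · rw [fc_const, if_neg hk]; simp

lemma norm_primitive_le {f : ℝ → R3} (hf : Integrable f torusMeasure) {x : ℝ}
    (hx : x ∈ Icc (-π) π) : ‖primitive f x‖ ≤ 4 * π * mean fun z => ‖f z‖ := by
  have hpi := Real.pi_pos
  rw [mean_eq_torus, smul_eq_mul]
  have h1 : ‖∫ z in (-π)..x, f z‖ ≤ ∫ z, ‖f z‖ ∂torusMeasure := by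
    rw [intervalIntegral.integral_of_le hx.1]
    refine (norm_integral_le_integral_norm _).trans ?_
    exact setIntegral_mono_set hf.norm (ae_of_all _ fun _ => norm_nonneg _)
      (Ioc_subset_Ioc_right hx.2).eventuallyLE
  have h2 : ‖mean fun z => (z - π) • f z‖ ≤ ∫ z, ‖f z‖ ∂torusMeasure := by
    rw [mean_eq_torus, norm_smul, Real.norm_of_nonneg (by positivity)]
    have : ‖∫ z, (z - π) • f z ∂torusMeasure‖ ≤ ∫ z, 2 * π * ‖f z‖ ∂torusMeasure := by
      refine norm_integral_le_of_norm_le (hf.norm.const_mul _) ?_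
      refine (ae_restrict_iff' measurableSet_Ioc).2 (ae_of_all _ fun x hx => ?_)
      rw [norm_smul, Real.norm_eq_abs]
      gcongr
      rw [abs_le]; constructor <;> linarith [hx.1, hx.2]
    rw [integral_const_mul] at this
    rw [inv_mul_le_iff₀ (by positivity)]; exact this
  have : 4 * π * ((2 * π)⁻¹ * ∫ z, ‖f z‖ ∂torusMeasure) = 2 * ∫ z, ‖f z‖ ∂torusMeasure := by
    field_simp; ring
  rw [this]
  exact (norm_add_le _ _).trans (by linarith)

/-! ### Decay classes of Fourier coefficients -/

/-- The weight `(1 + |k|)^{1/2}`. -/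
def rho (k : ℤ) : ℝ := √(1 + |(k : ℝ)|)

lemma rho_sq (k : ℤ) : rho k ^ 2 = 1 + |(k : ℝ)| := Real.sq_sqrt (by positivity)

lemma one_le_rho (k : ℤ) : 1 ≤ rho k := Real.one_le_sqrt.2 (by linarith [abs_nonneg (k : ℝ)])

lemma rho_pos (k : ℤ) : 0 < rho k := zero_lt_one.trans_le (one_le_rho k)

lemma rho_zero : rho 0 = 1 := by simp [rho]

/-- This subadditivity lets a weight at `k` be distributed over the two factors of a convolution. -/
lemma rho_le_add (j k : ℤ) : rho k ≤ rho j + rho (k - j) := by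
  refine Real.sqrt_le_iff.2 ⟨by positivity [rho_pos j, rho_pos (k - j)], ?_⟩
  have h1 : |(k : ℝ)| ≤ |(j : ℝ)| + |((k - j : ℤ) : ℝ)| := by
    calc |(k : ℝ)| = |(j : ℝ) + ((k - j : ℤ) : ℝ)| := by push_cast; congr 1; ring
      _ ≤ _ := abs_add_le _ _
  nlinarith [rho_sq j, rho_sq (k - j), rho_pos j, rho_pos (k - j),
    mul_pos (rho_pos j) (rho_pos (k - j))]

/-- The cube is the smallest integer power that works, since the exponent `3/2` exceeds `1` while
`rho⁻²` gives the harmonic series. This is why decay is counted in half powers. -/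
lemma summable_inv_rho_cube : Summable fun k : ℤ => (rho k)⁻¹ ^ 3 := by
  have key : Summable fun n : ℕ => (√(1 + (n : ℝ)))⁻¹ ^ 3 := by
    have h := (summable_nat_add_iff 1).2
      (Real.summable_nat_rpow_inv.2 (by norm_num : (1 : ℝ) < 3 / 2))
    refine h.congr fun n => ?_
    push_cast
    rw [Real.sqrt_eq_rpow, inv_pow, ← Real.rpow_natCast, ← Real.rpow_mul (by positivity)]
    norm_num [add_comm]
  refine Summable.of_nat_of_neg ?_ ?_
  · simpa [rho] using key
  · simpa [rho] using key

/-- The constant `∑ₖ (1 + |k|)^{-3/2}`. -/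
def rhoSum : ℝ := ∑' k : ℤ, (rho k)⁻¹ ^ 3

lemma rhoSum_nonneg : 0 ≤ rhoSum := tsum_nonneg fun k => by have := rho_pos k; positivity

/-- The Fourier coefficients of `u` are bounded by `B (1 + |k|)^{-p/2}`. -/
def Decay (p : ℕ) (B : ℝ) (u : ℝ → ℂ) : Prop := ∀ k, rho k ^ p * ‖fc u k‖ ≤ B

lemma Decay.nonneg {p : ℕ} {B : ℝ} {u : ℝ → ℂ} (h : Decay p B u) : 0 ≤ B :=
  (by have := rho_pos 0; positivity : 0 ≤ rho 0 ^ p * ‖fc u 0‖).trans (h 0)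

lemma Decay.mono {p q : ℕ} {B B' : ℝ} {u : ℝ → ℂ} (h : Decay p B u) (hq : q ≤ p) (hB : B ≤ B') :
    Decay q B' u := fun k =>
  (mul_le_mul_of_nonneg_right (pow_le_pow_right₀ (one_le_rho k) hq) (norm_nonneg _)).trans
    ((h k).trans hB)

lemma Decay.norm_le {p : ℕ} {B : ℝ} {u : ℝ → ℂ} (h : Decay p B u) (k : ℤ) :
    ‖fc u k‖ ≤ B * (rho k ^ p)⁻¹ := by
  have := rho_pos k
  rw [← div_eq_mul_inv, le_div_iff₀ (by positivity), mul_comm]; exact h k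

lemma Decay.add {p : ℕ} {B B' : ℝ} {u v : ℝ → ℂ} (hu : Decay p B u) (hv : Decay p B' v)
    (iu : Integrable u torusMeasure) (iv : Integrable v torusMeasure) :
    Decay p (B + B') fun x => u x + v x := fun k => by
  have := rho_pos k
  rw [fc_add iu iv]
  calc _ ≤ rho k ^ p * (‖fc u k‖ + ‖fc v k‖) := by gcongr; exact norm_add_le _ _
    _ ≤ _ := by rw [mul_add]; exact add_le_add (hu k) (hv k)

lemma Decay.sub {p : ℕ} {B B' : ℝ} {u v : ℝ → ℂ} (hu : Decay p B u) (hv : Decay p B' v)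
    (iu : Integrable u torusMeasure) (iv : Integrable v torusMeasure) :
    Decay p (B + B') fun x => u x - v x := fun k => by
  have := rho_pos k
  rw [fc_sub iu iv]
  calc _ ≤ rho k ^ p * (‖fc u k‖ + ‖fc v k‖) := by gcongr; exact norm_sub_le _ _
    _ ≤ _ := by rw [mul_add]; exact add_le_add (hu k) (hv k)

lemma Decay.sum {ι : Type*} {s : Finset ι} {p : ℕ} {B : ι → ℝ} {u : ι → ℝ → ℂ}
    (hu : ∀ i ∈ s, Decay p (B i) (u i)) (iu : ∀ i ∈ s, Integrable (u i) torusMeasure) :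
    Decay p (∑ i ∈ s, B i) fun x => ∑ i ∈ s, u i x := fun k => by
  have := rho_pos k
  rw [fc_sum s iu]
  calc _ ≤ rho k ^ p * ∑ i ∈ s, ‖fc (u i) k‖ := by gcongr; exact norm_sum_le _ _
    _ ≤ _ := by rw [Finset.mul_sum]; exact Finset.sum_le_sum fun i hi => hu i hi k

lemma Decay.const_mul {p : ℕ} {B : ℝ} {u : ℝ → ℂ} (hu : Decay p B u) (c : ℂ) :
    Decay p (‖c‖ * B) fun x => c * u x := fun k => by
  rw [fc_const_mul, norm_mul, mul_left_comm]
  exact mul_le_mul_of_nonneg_left (hu k) (norm_nonneg _)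

lemma decay_const (p : ℕ) (c : ℂ) : Decay p ‖c‖ fun _ => c := fun k => by
  rw [fc_const]
  split_ifs with hk
  · subst hk; simp [rho_zero]
  · simp

/-- The larger of `x` and `y` is at least `z / 2` and absorbs `z ^ c`. The at least three remaining
powers are then estimated by powers of the smaller one. With `x = rho j`, `y = rho (k - j)`, `z =
rho k` this is the summand of a convolution. -/
lemma pow_mul_inv_mul_inv_le {x y z : ℝ} {a b c : ℕ} (hx : 1 ≤ x) (hy : 1 ≤ y) (hz : 0 ≤ z)
    (hxy : z ≤ x + y) (ha : c ≤ a) (hb : c ≤ b) (hab : c + 3 ≤ a + b) :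
    z ^ c * ((x ^ a)⁻¹ * (y ^ b)⁻¹) ≤ 2 ^ c * (x⁻¹ ^ 3 + y⁻¹ ^ 3) := by
  have key : ∀ {x y : ℝ} {a b : ℕ}, 1 ≤ x → 1 ≤ y → z ≤ x + y → c ≤ b → c + 3 ≤ a + b → x ≤ y →
      z ^ c * ((x ^ a)⁻¹ * (y ^ b)⁻¹) ≤ 2 ^ c * x⁻¹ ^ 3 := by
    intro x y a b hx hy hxy hb hab hle
    have h1 : z ^ c ≤ 2 ^ c * y ^ c := by rw [← mul_pow]; gcongr; linarith
    obtain ⟨d, rfl⟩ := Nat.exists_eq_add_of_le hb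
    calc z ^ c * ((x ^ a)⁻¹ * (y ^ (c + d))⁻¹)
        ≤ 2 ^ c * y ^ c * ((x ^ a)⁻¹ * (y ^ (c + d))⁻¹) := by gcongr
      _ = 2 ^ c * ((x ^ a)⁻¹ * (y ^ d)⁻¹) := by rw [pow_add]; field_simp
      _ ≤ 2 ^ c * ((x ^ a)⁻¹ * (x ^ d)⁻¹) := by gcongr
      _ = 2 ^ c * x⁻¹ ^ (a + d) := by rw [pow_add, inv_pow, inv_pow]
      _ ≤ 2 ^ c * x⁻¹ ^ 3 := by
        gcongr 2 ^ c * ?_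
        exact pow_le_pow_of_le_one (by positivity) (inv_le_one_of_one_le₀ hx) (by omega)
  rcases le_total x y with h | h
  · refine (key hx hy hxy hb hab h).trans ?_
    gcongr; simp; positivity
  · rw [mul_comm (x ^ a)⁻¹]
    refine (key hy hx (by linarith) ha (by omega) h).trans ?_
    gcongr; simp; positivity

/-- Products of functions with decaying Fourier coefficients. -/
lemma Decay.mul {a b : ℕ} (c : ℕ) {B B' : ℝ} {u v : ℝ → ℂ} (hu : Decay a B u) (hv : Decay b B' v)
    (lu : MemLp u 2 torusMeasure) (lv : MemLp v 2 torusMeasure)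
    (ha : c ≤ a) (hb : c ≤ b) (hab : c + 3 ≤ a + b) :
    Decay c (2 ^ (c + 1) * rhoSum * B * B') fun x => u x * v x := fun k => by
  have hB := hu.nonneg
  have hB' := hv.nonneg
  have hk := rho_pos k
  have hs : HasSum (fun j => (rho j)⁻¹ ^ 3 + (rho (k - j))⁻¹ ^ 3) (rhoSum + rhoSum) := by
    have h := summable_inv_rho_cube.hasSum
    -- The substitution `j ↦ k - j` turns the second series into the first; the resulting factor `2`
    -- raises `2 ^ c` to `2 ^ (c + 1)`.
    exact h.add ((Equiv.subLeft k).hasSum_iff.2 h)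
  have h := tsum_of_norm_bounded (hs.mul_left ((rho k ^ c)⁻¹ * B * B' * 2 ^ c))
    (f := fun j => fc u j * fc v (k - j)) fun j => by
      have hj := rho_pos j
      have hkj := rho_pos (k - j)
      rw [norm_mul]
      calc _ ≤ (B * (rho j ^ a)⁻¹) * (B' * (rho (k - j) ^ b)⁻¹) :=
            mul_le_mul (hu.norm_le j) (hv.norm_le _) (norm_nonneg _) (by positivity)
        _ = (rho k ^ c)⁻¹ * B * B' *
            (rho k ^ c * ((rho j ^ a)⁻¹ * (rho (k - j) ^ b)⁻¹)) := by field_simp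
        _ ≤ (rho k ^ c)⁻¹ * B * B' *
            (2 ^ c * ((rho j)⁻¹ ^ 3 + (rho (k - j))⁻¹ ^ 3)) := by
          refine mul_le_mul_of_nonneg_left ?_ (by positivity)
          exact pow_mul_inv_mul_inv_le (one_le_rho _) (one_le_rho _) hk.le (rho_le_add j k) ha hb hab
        _ = _ := by ring
  rw [(hasSum_fc_mul lu lv k).tsum_eq] at h
  refine (mul_le_mul_of_nonneg_left h (by positivity : 0 ≤ rho k ^ c)).trans (le_of_eq ?_)
  field_simp; ring

/-! ### The heat semigroup on the Fourier side -/

lemma summable_norm_mul_expI {c : ℤ → ℂ} (hc : Summable fun k => ‖c k‖) (x : ℝ) :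
    Summable fun k => c k * expI k x :=
  .of_norm (hc.congr fun k => by rw [norm_mul, norm_expI, mul_one])

lemma continuous_tsum_mul_expI {c : ℤ → ℂ} (hc : Summable fun k => ‖c k‖) :
    Continuous fun x => ∑' k, c k * expI k x :=
  continuous_tsum (fun k => continuous_const.mul (continuous_expI k)) hc fun k x => by
    rw [norm_mul, norm_expI, mul_one]

/-- Fourier coefficients of an absolutely convergent trigonometric series. -/
lemma fc_tsum_mul_expI {c : ℤ → ℂ} (hc : Summable fun k => ‖c k‖) (k : ℤ) :
    fc (fun x => ∑' m, c m * expI m x) k = c k := by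
  have hpi : (π : ℂ) ≠ 0 := by exact_mod_cast Real.pi_ne_zero
  have hint : ∀ m, Integrable (fun x => expI (-k) x * (c m * expI m x)) torusMeasure := fun m =>
    integrable_expI_mul (((memLp_of_continuousOn (p := 1)
      (continuous_expI m).continuousOn).integrable le_rfl).const_mul _) _
  have hs : HasSum (fun m => ∫ x, expI (-k) x * (c m * expI m x) ∂torusMeasure)
      (∫ x, ∑' m, expI (-k) x * (c m * expI m x) ∂torusMeasure) := by
    refine hasSum_integral_of_summable_integral_norm hint ?_
    simp only [norm_mul, norm_expI, one_mul, mul_one, integral_const, smul_eq_mul]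
    exact hc.mul_left _
  have hfc : ∀ m, ∫ x, expI (-k) x * (c m * expI m x) ∂torusMeasure
      = if m = k then (2 * π) * c k else 0 := by
    intro m
    have h1 := fc_expI_mul (fun _ => c m) m k
    rw [fc_const, fc_eq, inv_mul_eq_iff_eq_mul₀ (by simp [hpi])] at h1
    simp only [mul_comm (expI m _)] at h1
    rw [h1]
    by_cases h : m = k
    · subst h; simp
    · rw [if_neg (by omega), if_neg h, mul_zero]
  simp only [hfc] at hs
  have h2 := hs.unique (hasSum_ite_eq k _)
  rw [fc_eq]
  simp only [← tsum_mul_left]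
  rw [h2]; field_simp

/-- The heat factor `e^{-k² r}`. -/
def heatFactor (r : ℝ) (k : ℤ) : ℝ := Real.exp (-(k : ℝ) ^ 2 * r)

lemma heatFactor_pos (r : ℝ) (k : ℤ) : 0 < heatFactor r k := Real.exp_pos _

/-- With `x = k² r`, the inequality `x^{3/4} ≤ e^x` trades `|k|^{-3/2}` for `r^{-3/4}`. The first is
summable in `k`, and the second is integrable at `r = 0`, as domination of the Duhamel integral
requires. -/
lemma heatFactor_le {r : ℝ} (hr : 0 < r) (k : ℤ) :
    heatFactor r k ≤ 3 * (1 + r ^ (-(3 / 4) : ℝ)) * (rho k)⁻¹ ^ 3 := by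
  have hr' : 0 < r ^ (-(3 / 4) : ℝ) := Real.rpow_pos_of_pos hr _
  have hrho := rho_pos k
  rcases eq_or_ne k 0 with rfl | hk
  · simp [heatFactor, rho_zero]; linarith
  have hk1 : (1 : ℝ) ≤ |(k : ℝ)| := by exact_mod_cast Int.one_le_abs hk
  set x : ℝ := (k : ℝ) ^ 2 * r with hx
  have hx0 : 0 < x := by positivity
  have h1 : x ^ (3 / 4 : ℝ) ≤ Real.exp x := by
    have : x ^ (3 / 4 : ℝ) ≤ 1 + x := by
      rcases le_total x 1 with h | h
      · exact (Real.rpow_le_one hx0.le h (by norm_num)).trans (by linarith)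
      · calc x ^ (3 / 4 : ℝ) ≤ x ^ (1 : ℝ) := Real.rpow_le_rpow_of_exponent_le h (by norm_num)
          _ ≤ _ := by rw [Real.rpow_one]; linarith
    linarith [Real.add_one_le_exp x]
  have h2 : x ^ (3 / 4 : ℝ) = |(k : ℝ)| ^ (3 / 2 : ℝ) * r ^ (3 / 4 : ℝ) := by
    rw [hx, Real.mul_rpow (by positivity) hr.le, ← sq_abs, ← Real.rpow_natCast,
      ← Real.rpow_mul (abs_nonneg _)]
    norm_num
  have h3 : rho k ^ 3 ≤ 3 * |(k : ℝ)| ^ (3 / 2 : ℝ) := by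
    have e1 : rho k ^ 3 = (1 + |(k : ℝ)|) ^ (3 / 2 : ℝ) := by
      rw [rho, Real.sqrt_eq_rpow, ← Real.rpow_natCast, ← Real.rpow_mul (by positivity)]; norm_num
    have e2 : (2 : ℝ) ^ (3 / 2 : ℝ) ≤ 3 := by
      have : (2 : ℝ) ^ (3 / 2 : ℝ) = √ 8 := by
        rw [Real.sqrt_eq_rpow, show (8 : ℝ) = 2 ^ (3 : ℝ) by norm_num, ← Real.rpow_mul (by norm_num)]
        norm_num
      rw [this]; exact Real.sqrt_le_iff.2 (by norm_num)
    rw [e1]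
    calc (1 + |(k : ℝ)|) ^ (3 / 2 : ℝ) ≤ (2 * |(k : ℝ)|) ^ (3 / 2 : ℝ) :=
          Real.rpow_le_rpow (by positivity) (by linarith) (by norm_num)
      _ = 2 ^ (3 / 2 : ℝ) * |(k : ℝ)| ^ (3 / 2 : ℝ) := Real.mul_rpow (by norm_num) (abs_nonneg _)
      _ ≤ _ := by gcongr
  rw [heatFactor, neg_mul, Real.exp_neg, inv_pow]
  have h4 : rho k ^ 3 ≤ 3 * r ^ (-(3 / 4) : ℝ) * Real.exp x := by
    calc rho k ^ 3 ≤ 3 * |(k : ℝ)| ^ (3 / 2 : ℝ) := h3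
      _ = 3 * r ^ (-(3 / 4) : ℝ) * x ^ (3 / 4 : ℝ) := by
        rw [h2, Real.rpow_neg hr.le]
        have := Real.rpow_pos_of_pos hr (3 / 4)
        field_simp
      _ ≤ _ := by gcongr
  rw [← hx, inv_le_iff_one_le_mul₀ (Real.exp_pos _)]
  have h5 : 1 ≤ 3 * r ^ (-(3 / 4) : ℝ) * Real.exp x * (rho k ^ 3)⁻¹ := by
    rw [← div_eq_mul_inv, one_le_div (by positivity)]; exact h4
  have h6 : 0 ≤ Real.exp x * (rho k ^ 3)⁻¹ := by positivity
  nlinarith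

lemma summable_heatFactor {r : ℝ} (hr : 0 < r) : Summable (heatFactor r) :=
  .of_nonneg_of_le (fun k => (heatFactor_pos r k).le) (heatFactor_le hr)
    (summable_inv_rho_cube.mul_left _)

lemma tsum_heatFactor_le {r : ℝ} (hr : 0 < r) :
    ∑' k, heatFactor r k ≤ 3 * (1 + r ^ (-(3 / 4) : ℝ)) * rhoSum := by
  rw [rhoSum, ← tsum_mul_left]
  exact (summable_heatFactor hr).tsum_le_tsum (heatFactor_le hr) (summable_inv_rho_cube.mul_left _)

lemma summable_norm_heatFactor {r : ℝ} (hr : 0 < r) :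
    Summable fun k => ‖((heatFactor r k : ℝ) : ℂ)‖ :=
  (summable_heatFactor hr).congr fun k => by
    rw [Complex.norm_real, Real.norm_of_nonneg (heatFactor_pos r k).le]

/-- The factors are even in `k`, so the exponential series is invariant under conjugation and equals
its cosine part. In exponential form, convolution with the kernel is diagonal. -/
lemma heatKernel_eq {r : ℝ} (hr : 0 < r) (z : ℝ) :
    ((heatKernel z r : ℝ) : ℂ) = (2 * π : ℂ)⁻¹ * ∑' k, ((heatFactor r k : ℝ) : ℂ) * expI k z := by
  set S : ℂ := ∑' k, ((heatFactor r k : ℝ) : ℂ) * expI k z with hS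
  have hsum := (summable_norm_mul_expI (summable_norm_heatFactor hr) z).hasSum
  have hre : S.re = ∑' k : ℤ, Real.exp (-(k : ℝ) ^ 2 * r) * Real.cos (k * z) := by
    rw [← (Complex.hasSum_re hsum).tsum_eq]
    refine tsum_congr fun k => ?_
    have : Complex.I * k * z = ((k * z : ℝ) : ℂ) * Complex.I := by push_cast; ring
    rw [Complex.re_ofReal_mul, expI, this, Complex.exp_ofReal_mul_I_re, heatFactor]
  have hconj : (starRingEnd ℂ) S = S := by
    rw [hS, Complex.conj_tsum, ← (Equiv.neg ℤ).tsum_eq]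
    refine tsum_congr fun k => ?_
    rw [map_mul, Complex.conj_ofReal, conj_expI]
    simp [heatFactor]
  rw [heatKernel, ← hre]
  push_cast
  rw [Complex.conj_eq_iff_re.1 hconj]

lemma continuous_heatKernel {r : ℝ} (hr : 0 < r) : Continuous fun z => heatKernel z r := by
  have h := continuous_const (y := (2 * π : ℂ)⁻¹) |>.mul
    (continuous_tsum_mul_expI (summable_norm_heatFactor hr))
  have h2 : (fun z => heatKernel z r) = fun z => ((2 * π : ℂ)⁻¹ *
      ∑' k, ((heatFactor r k : ℝ) : ℂ) * expI k z).re := by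
    ext z; rw [← heatKernel_eq hr, Complex.ofReal_re]
  rw [h2]
  exact Complex.continuous_re.comp h

/-- The heat semigroup multiplies the Fourier coefficients by `e^{-k² r}`. -/
lemma integral_heatKernel_mul {r : ℝ} (hr : 0 < r) {u : ℝ → ℂ} (hu : Integrable u torusMeasure)
    (x : ℝ) : ∫ y, ((heatKernel (x - y) r : ℝ) : ℂ) * u y ∂torusMeasure
      = ∑' k, ((heatFactor r k : ℝ) : ℂ) * fc u k * expI k x := by
  have hpi : (π : ℂ) ≠ 0 := by exact_mod_cast Real.pi_ne_zero
  let F : ℤ → ℝ → ℂ := fun k y =>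
    (2 * π : ℂ)⁻¹ * ((heatFactor r k : ℝ) : ℂ) * expI k x * (expI (-k) y * u y)
  have hF : ∀ k, Integrable (F k) torusMeasure := fun k => (integrable_expI_mul hu _).const_mul _
  have h := hasSum_integral_of_summable_integral_norm hF (by
    simp only [F, norm_mul, norm_expI, one_mul, mul_one, integral_const_mul]
    exact ((summable_norm_heatFactor hr).mul_left _).mul_right _)
  have e1 : ∀ y, ∑' k, F k y = ((heatKernel (x - y) r : ℝ) : ℂ) * u y := by
    intro y
    rw [heatKernel_eq hr, ← tsum_mul_left, ← tsum_mul_right]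
    refine tsum_congr fun k => ?_
    have : expI k (x - y) = expI k x * expI (-k) y := by
      rw [sub_eq_add_neg, expI_add_right]; congr 1; simp [expI]
    simp only [F]; rw [this]; ring
  have e2 : ∀ k, ∫ y, F k y ∂torusMeasure = ((heatFactor r k : ℝ) : ℂ) * fc u k * expI k x := by
    intro k
    simp only [F]
    rw [integral_const_mul, fc_eq]; ring
  simp only [e1, e2] at h
  exact h.tsum_eq.symm

lemma norm_fc_cpt_le_mean {u : ℝ → R3} (hu : Integrable u torusMeasure) (i : Fin 3) (k : ℤ) :
    ‖fc (cpt u i) k‖ ≤ mean fun x => ‖u x‖ := by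
  have := Real.pi_pos
  refine (norm_fc_le _ _).trans ?_
  rw [mean_eq_torus, smul_eq_mul]
  refine mul_le_mul_of_nonneg_left ?_ (by positivity)
  exact integral_mono (integrable_cpt hu i).norm hu.norm fun x => norm_cpt_le u i x

lemma cpt_heat {r : ℝ} (hr : 0 < r) {u : ℝ → R3} (hu : Integrable u torusMeasure) (i : Fin 3) :
    cpt (heat r u) i = fun x => ∑' k, ((heatFactor r k : ℝ) : ℂ) * fc (cpt u i) k * expI k x := by
  ext x
  have hk : Continuous fun y => heatKernel (x - y) r :=
    (continuous_heatKernel hr).comp (continuous_const.sub continuous_id)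
  obtain ⟨c, hc⟩ := isCompact_Icc.exists_bound_of_continuousOn (hk.continuousOn (s := Icc (-π) π))
  have hint : Integrable (fun y => heatKernel (x - y) r • u y) torusMeasure := by
    refine hu.bdd_smul (φ := fun y => heatKernel (x - y) r) c hk.aestronglyMeasurable ?_
    exact (ae_restrict_iff' measurableSet_Ioc).2
      (ae_of_all _ fun y hy => hc y (Ioc_subset_Icc_self hy))
  rw [← integral_heatKernel_mul hr (integrable_cpt hu i)]
  have h := integral_cpt _ hint i
  rw [cpt, heat, if_neg hr.ne', intervalIntegral_eq_torus, ← h]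
  refine integral_congr_ae (ae_of_all _ fun y => ?_)
  simp [cpt]

lemma summable_heat_coeff {r : ℝ} (hr : 0 < r) {u : ℝ → R3} (hu : Integrable u torusMeasure)
    (i : Fin 3) : Summable fun k => ‖((heatFactor r k : ℝ) : ℂ) * fc (cpt u i) k‖ := by
  refine .of_nonneg_of_le (fun k => norm_nonneg _) (fun k => ?_)
    ((summable_norm_heatFactor hr).mul_right (mean fun x => ‖u x‖))
  rw [norm_mul]
  exact mul_le_mul_of_nonneg_left (norm_fc_cpt_le_mean hu i k) (norm_nonneg _)

lemma fc_heat {r : ℝ} (hr : 0 < r) {u : ℝ → R3} (hu : Integrable u torusMeasure) (i : Fin 3)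
    (k : ℤ) : fc (cpt (heat r u) i) k = ((heatFactor r k : ℝ) : ℂ) * fc (cpt u i) k := by
  rw [cpt_heat hr hu, fc_tsum_mul_expI (summable_heat_coeff hr hu i)]

lemma continuous_cpt_heat {r : ℝ} (hr : 0 < r) {u : ℝ → R3} (hu : Integrable u torusMeasure)
    (i : Fin 3) : Continuous (cpt (heat r u) i) := by
  rw [cpt_heat hr hu]; exact continuous_tsum_mul_expI (summable_heat_coeff hr hu i)

lemma norm_cpt_heat_le {r : ℝ} (hr : 0 < r) {u : ℝ → R3} (hu : Integrable u torusMeasure)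
    (i : Fin 3) (x : ℝ) :
    ‖cpt (heat r u) i x‖ ≤ 3 * (1 + r ^ (-(3 / 4) : ℝ)) * rhoSum * mean fun x => ‖u x‖ := by
  have hM : 0 ≤ mean fun x => ‖u x‖ := (norm_nonneg _).trans (norm_fc_cpt_le_mean hu i 0)
  rw [cpt_heat hr hu]
  refine (tsum_of_norm_bounded ((summable_heatFactor hr).hasSum.mul_right
    (mean fun x => ‖u x‖)) fun k => ?_).trans
    (mul_le_mul_of_nonneg_right (tsum_heatFactor_le hr) hM)
  rw [norm_mul, norm_expI, mul_one, norm_mul, Complex.norm_real,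
    Real.norm_of_nonneg (heatFactor_pos r k).le]
  exact mul_le_mul_of_nonneg_left (norm_fc_cpt_le_mean hu i k) (heatFactor_pos r k).le

/-! ### Duhamel's formula on the Fourier side -/

/-- A function that is measurable in the first variable and continuous in the second one is
jointly measurable. -/
lemma aestronglyMeasurable_uncurry {h : ℝ → ℝ → ℂ} {μ ν : Measure ℝ} [SFinite μ] [SFinite ν]
    (hm : ∀ x, AEStronglyMeasurable (fun s => h s x) μ)
    (hc : ∀ᵐ s ∂μ, Continuous (h s)) :
    AEStronglyMeasurable (fun p : ℝ × ℝ => h p.1 p.2) (μ.prod ν) := by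
  -- Rounding `x` down to the grid of step `1/n` involves only countably many slices, so measurable
  -- versions of all of them agree with `h` off one null set of `s`. Continuity in `x` then gives
  -- the limit `n → ∞`.
  let q : ℕ → ℝ → ℝ := fun n x => (⌊(n : ℝ) * x⌋ : ℝ) / n
  have hq : ∀ x, Tendsto (fun n => q n x) atTop (𝓝 x) := fun x => by
    have h0 : Tendsto (fun n : ℕ => x - 1 / (n : ℝ)) atTop (𝓝 x) := by
      simpa using (tendsto_const_nhds (x := x)).sub (tendsto_one_div_atTop_nhds_zero_nat (𝕜 := ℝ))
    refine tendsto_of_tendsto_of_tendsto_of_le_of_le' h0 tendsto_const_nhds ?_ ?_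
    · filter_upwards [eventually_gt_atTop 0] with n hn
      have hn' : (0 : ℝ) < n := by exact_mod_cast hn
      rw [le_div_iff₀ hn', sub_mul, one_div, inv_mul_cancel₀ hn'.ne']
      linarith [Int.lt_floor_add_one ((n : ℝ) * x)]
    · filter_upwards [eventually_gt_atTop 0] with n hn
      have hn' : (0 : ℝ) < n := by exact_mod_cast hn
      rw [div_le_iff₀ hn']
      linarith [Int.floor_le ((n : ℝ) * x)]
  let g : ℤ × ℕ → ℝ → ℂ := fun m => (hm ((m.1 : ℝ) / m.2)).mk _
  have hg : ∀ᵐ s ∂μ, ∀ m : ℤ × ℕ, h s ((m.1 : ℝ) / m.2) = g m s :=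
    ae_all_iff.2 fun m => (hm _).ae_eq_mk
  refine aestronglyMeasurable_of_tendsto_ae (u := atTop)
    (f := fun (n : ℕ) (p : ℝ × ℝ) => g (⌊(n : ℝ) * p.2⌋, n) p.1) (fun n => ?_) ?_
  · have h1 : Measurable fun p : ℤ × ℝ => g (p.1, n) p.2 :=
      measurable_from_prod_countable_right fun m =>
        (hm ((m : ℝ) / n)).stronglyMeasurable_mk.measurable
    have h2 : Measurable fun p : ℝ × ℝ => ((⌊(n : ℝ) * p.2⌋ : ℤ), p.1) :=
      (Int.measurable_floor.comp (measurable_const.mul measurable_snd)).prodMk measurable_fst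
    exact (h1.comp h2).aestronglyMeasurable
  · have h3 : ∀ᵐ p ∂(μ.prod ν), Continuous (h p.1) ∧
        ∀ m : ℤ × ℕ, h p.1 ((m.1 : ℝ) / m.2) = g m p.1 :=
      Measure.quasiMeasurePreserving_fst.ae (hc.and hg)
    filter_upwards [h3] with p hp
    have h4 := (hp.1.tendsto p.2).comp (hq p.2)
    refine h4.congr fun n => ?_
    exact hp.2 (⌊(n : ℝ) * p.2⌋, n)

/-- Fourier coefficients of a parametric integral. -/
lemma fc_intervalIntegral {h : ℝ → ℝ → ℂ} {b : ℝ → ℝ} {t : ℝ} (ht : 0 ≤ t)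
    (hm : ∀ x, IntervalIntegrable (fun s => h s x) volume 0 t)
    (hc : ∀ s ∈ Ioo 0 t, Continuous (h s)) (hb : IntervalIntegrable b volume 0 t)
    (hhb : ∀ s ∈ Ioo 0 t, ∀ x, ‖h s x‖ ≤ b s) (k : ℤ) :
    IntervalIntegrable (fun s => fc (h s) k) volume 0 t ∧
      fc (fun x => ∫ s in (0 : ℝ)..t, h s x) k = ∫ s in (0 : ℝ)..t, fc (h s) k := by
  let μ : Measure ℝ := volume.restrict (Ioc 0 t)
  have hbμ : Integrable b μ := (intervalIntegrable_iff_integrableOn_Ioc_of_le ht).1 hb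
  have hIoo : ∀ᵐ s ∂μ, s ∈ Ioo 0 t := by
    simp only [μ]
    rw [← restrict_Ioo_eq_restrict_Ioc]
    exact ae_restrict_mem measurableSet_Ioo
  have hmeas := aestronglyMeasurable_uncurry (h := h) (μ := μ) (ν := torusMeasure)
    (fun x => ((intervalIntegrable_iff_integrableOn_Ioc_of_le ht).1 (hm x)).1)
    (hIoo.mono hc)
  have hint : Integrable (fun p : ℝ × ℝ => expI (-k) p.2 * h p.1 p.2) (μ.prod torusMeasure) := by
    refine Integrable.mono' (g := fun p : ℝ × ℝ => b p.1 * (1 : ℝ)) ?_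
      (((continuous_expI (-k)).comp continuous_snd).aestronglyMeasurable.mul hmeas) ?_
    · exact Integrable.mul_prod (f := b) (g := fun _ => (1 : ℝ)) hbμ (integrable_const _)
    · have : ∀ᵐ p ∂(μ.prod torusMeasure), p.1 ∈ Ioo 0 t :=
        Measure.quasiMeasurePreserving_fst.ae hIoo
      filter_upwards [this] with p hp
      rw [norm_mul, norm_expI, one_mul, mul_one]
      exact hhb p.1 hp p.2
  constructor
  · refine (intervalIntegrable_iff_integrableOn_Ioc_of_le ht).2 ?_
    simp only [fc_eq]
    exact hint.integral_prod_left.const_mul _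
  · have hsw := integral_integral_swap (f := fun s x => expI (-k) x * h s x) hint
    simp only [fc_eq]
    rw [intervalIntegral.integral_const_mul, intervalIntegral.integral_of_le ht, hsw]
    congr 1
    refine integral_congr_ae (ae_of_all _ fun x => ?_)
    simp only
    rw [intervalIntegral.integral_of_le ht, integral_const_mul]

lemma intervalIntegrable_sub_rpow (t : ℝ) :
    IntervalIntegrable (fun s => (t - s) ^ (-(3 / 4) : ℝ)) volume 0 t := by
  have h := (intervalIntegral.intervalIntegrable_rpow' (a := 0) (b := t)
    (r := (-(3 / 4) : ℝ)) (by norm_num)).comp_sub_left t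
  simpa using h.symm

/-- The hypotheses of Duhamel's formula with a right hand side of bounded mean. -/
structure IsDuhamel (T M : ℝ) (τ G : ℝ → ℝ → R3) : Prop where
  continuous : ∀ t ∈ Icc 0 T, Continuous (τ t)
  integrable : ∀ t ∈ Icc 0 T, Integrable (G t) torusMeasure
  mean_le : ∀ t ∈ Icc 0 T, (mean fun x => ‖G t x‖) ≤ M
  duhamel : ∀ t ∈ Icc 0 T, ∀ x,
      IntervalIntegrable (fun s => heat (t - s) (G s) x) volume 0 t ∧
      τ t x = heat t (τ 0) x + ∫ s in (0 : ℝ)..t, heat (t - s) (G s) x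

/-- Duhamel's formula is assumed only pointwise in `x`. Exchanging the time integral with a Fourier
coefficient is justified by the majorant `(t - s)^{-3/4}`, which needs only the mean of `‖G s‖` to
be bounded. Joint measurability is free because `S(t - s) G(s)` is continuous in `x` for `s < t`. -/
lemma IsDuhamel.fc_eq {T M : ℝ} {τ G : ℝ → ℝ → R3} (H : IsDuhamel T M τ G) {t : ℝ}
    (ht : t ∈ Icc 0 T) (i : Fin 3) (k : ℤ) :
    IntervalIntegrable (fun s => ((heatFactor (t - s) k : ℝ) : ℂ) * fc (cpt (G s) i) k) volume 0 t ∧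
    fc (cpt (τ t) i) k = ((heatFactor t k : ℝ) : ℂ) * fc (cpt (τ 0) i) k
      + ∫ s in (0 : ℝ)..t, ((heatFactor (t - s) k : ℝ) : ℂ) * fc (cpt (G s) i) k := by
  rcases ht.1.eq_or_lt with h0 | h0
  · subst h0; simp [heatFactor]
  have hT : (0 : ℝ) ∈ Icc 0 T := ⟨le_rfl, ht.1.trans ht.2⟩
  have mem : ∀ s ∈ Ioo 0 t, s ∈ Icc 0 T := fun s hs => ⟨hs.1.le, hs.2.le.trans ht.2⟩
  have τi : ∀ s ∈ Icc 0 T, Integrable (τ s) torusMeasure := fun s hs =>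
    (memLp_of_continuousOn (p := 1) (H.continuous s hs).continuousOn).integrable le_rfl
  let h : ℝ → ℝ → ℂ := fun s x => cpt (heat (t - s) (G s)) i x
  have hm : ∀ x, IntervalIntegrable (fun s => h s x) volume 0 t := fun x => by
    rw [intervalIntegrable_iff_integrableOn_Ioc_of_le ht.1]
    have := (intervalIntegrable_iff_integrableOn_Ioc_of_le ht.1).1 (H.duhamel t ht x).1
    exact ((EuclideanSpace.proj (𝕜 := ℝ) i).integrable_comp this).ofReal
  have hb : IntervalIntegrable (fun s => 3 * (1 + (t - s) ^ (-(3 / 4) : ℝ)) * rhoSum * M)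
      volume 0 t :=
    (((intervalIntegrable_const.add (intervalIntegrable_sub_rpow t)).const_mul 3).mul_const
      rhoSum).mul_const M
  obtain ⟨h1, h2⟩ := fc_intervalIntegral ht.1 hm
    (fun s hs => continuous_cpt_heat (by linarith [hs.2]) (H.integrable s (mem s hs)) i) hb
    (fun s hs x => (norm_cpt_heat_le (by linarith [hs.2]) (H.integrable s (mem s hs)) i x).trans (by
      have := Real.rpow_nonneg (by linarith [hs.2] : 0 ≤ t - s) (-(3 / 4))
      have := rhoSum_nonneg
      gcongr
      exact H.mean_le s (mem s hs))) k
  have h3 : ∀ s ∈ Ioo 0 t, fc (h s) k = ((heatFactor (t - s) k : ℝ) : ℂ) * fc (cpt (G s) i) k :=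
    fun s hs => fc_heat (by linarith [hs.2]) (H.integrable s (mem s hs)) i k
  have hae : (fun s => fc (h s) k) =ᵐ[volume.restrict (Ioc 0 t)]
      fun s => ((heatFactor (t - s) k : ℝ) : ℂ) * fc (cpt (G s) i) k := by
    rw [← restrict_Ioo_eq_restrict_Ioc]
    exact (ae_restrict_iff' measurableSet_Ioo).2 (ae_of_all _ h3)
  constructor
  · rw [intervalIntegrable_iff_integrableOn_Ioc_of_le ht.1] at h1 ⊢
    exact Integrable.congr h1 hae
  · have h4 : ∫ s in (0 : ℝ)..t, fc (h s) k
        = ∫ s in (0 : ℝ)..t, ((heatFactor (t - s) k : ℝ) : ℂ) * fc (cpt (G s) i) k := by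
      rw [intervalIntegral.integral_of_le ht.1, intervalIntegral.integral_of_le ht.1]
      exact integral_congr_ae hae
    have h5 : (fun x => ∫ s in (0 : ℝ)..t, h s x)
        = fun x => cpt (τ t) i x - cpt (heat t (τ 0)) i x := by
      ext x
      have e := integral_cpt (u := fun s => heat (t - s) (G s) x) _
        ((intervalIntegrable_iff_integrableOn_Ioc_of_le ht.1).1 (H.duhamel t ht x).1) i
      rw [← intervalIntegral.integral_of_le ht.1, ← intervalIntegral.integral_of_le ht.1] at e
      have e' := (H.duhamel t ht x).2
      simp only [h, cpt] at e ⊢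
      rw [e, ← Complex.ofReal_sub, e']
      simp
    rw [← h4, ← h2, h5, fc_sub (integrable_cpt (τi t ht) i), fc_heat h0 (τi 0 hT)]
    · ring
    · exact (memLp_of_continuousOn (p := 1)
        (continuous_cpt_heat h0 (τi 0 hT) i).continuousOn).integrable le_rfl

lemma heatFactor_add (r s : ℝ) (k : ℤ) : heatFactor (r + s) k = heatFactor r k * heatFactor s k := by
  rw [heatFactor, heatFactor, heatFactor, ← Real.exp_add]; congr 1; ring

/-- Smoothing estimate: Duhamel's formula restarted at time `r`. -/
lemma IsDuhamel.norm_fc_le {T M : ℝ} {τ G : ℝ → ℝ → R3} (H : IsDuhamel T M τ G) {r t N : ℝ}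
    (hr : 0 ≤ r) (hrt : r ≤ t) (ht : t ≤ T) (i : Fin 3) {k : ℤ} (hk : k ≠ 0)
    (hN : ∀ s ∈ Icc r t, ‖fc (cpt (G s) i) k‖ ≤ N) :
    (k : ℝ) ^ 2 * ‖fc (cpt (τ t) i) k‖
      ≤ (k : ℝ) ^ 2 * heatFactor (t - r) k * ‖fc (cpt (τ r) i) k‖ + N := by
  have hk2 : 0 < (k : ℝ) ^ 2 := by have : (k : ℝ) ≠ 0 := (by exact_mod_cast hk); positivity
  have hN0 : 0 ≤ N := (norm_nonneg _).trans (hN r ⟨le_rfl, hrt⟩)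
  obtain ⟨i1, e1⟩ := H.fc_eq ⟨hr.trans hrt, ht⟩ i k
  obtain ⟨i2, e2⟩ := H.fc_eq ⟨hr, hrt.trans ht⟩ i k
  let g : ℝ → ℂ := fun s => ((heatFactor (t - s) k : ℝ) : ℂ) * fc (cpt (G s) i) k
  have hr1 : IntervalIntegrable g volume 0 r := i1.mono_set (by
    rw [uIcc_of_le hr, uIcc_of_le (hr.trans hrt)]; exact Icc_subset_Icc_right hrt)
  have hr2 : IntervalIntegrable g volume r t := i1.mono_set (by
    rw [uIcc_of_le hrt, uIcc_of_le (hr.trans hrt)]; exact Icc_subset_Icc_left hr)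
  have e3 : ∫ s in (0 : ℝ)..r, g s = ((heatFactor (t - r) k : ℝ) : ℂ) *
      ∫ s in (0 : ℝ)..r, ((heatFactor (r - s) k : ℝ) : ℂ) * fc (cpt (G s) i) k := by
    rw [← intervalIntegral.integral_const_mul]
    refine intervalIntegral.integral_congr fun s _ => ?_
    simp only [g]
    rw [show t - s = (t - r) + (r - s) by ring, heatFactor_add]; push_cast; ring
  have e4 : fc (cpt (τ t) i) k
      = ((heatFactor (t - r) k : ℝ) : ℂ) * fc (cpt (τ r) i) k + ∫ s in r..t, g s := by
    rw [e1, e2, mul_add, ← e3, add_assoc, intervalIntegral.integral_add_adjacent_intervals hr1 hr2,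
      ← mul_assoc, ← Complex.ofReal_mul, ← heatFactor_add, sub_add_cancel]
  -- Integrating the majorant exactly produces the factor `k⁻²`: this is the gain of two
  -- derivatives.
  have hd : ∀ s ∈ uIcc r t, HasDerivAt (fun s => ((k : ℝ) ^ 2)⁻¹ * heatFactor (t - s) k * N)
      (heatFactor (t - s) k * N) s := by
    intro s _
    have h1 : HasDerivAt (fun s => -(k : ℝ) ^ 2 * (t - s)) (-(k : ℝ) ^ 2 * (-1)) s :=
      ((hasDerivAt_id s).const_sub t).const_mul _
    convert! (h1.exp.const_mul (((k : ℝ) ^ 2)⁻¹)).mul_const N using 1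
    simp only [heatFactor]; field_simp
  have hcont : Continuous fun s => heatFactor (t - s) k * N := by unfold heatFactor; fun_prop
  have e5 : ‖∫ s in r..t, g s‖ ≤ ((k : ℝ) ^ 2)⁻¹ * N := by
    have h1 : ‖∫ s in r..t, g s‖ ≤ ∫ s in r..t, heatFactor (t - s) k * N := by
      refine intervalIntegral.norm_integral_le_of_norm_le hrt (ae_of_all _ fun s hs => ?_)
        (hcont.intervalIntegrable _ _)
      rw [norm_mul, Complex.norm_real, Real.norm_of_nonneg (heatFactor_pos _ k).le]
      exact mul_le_mul_of_nonneg_left (hN s (Ioc_subset_Icc_self hs)) (heatFactor_pos _ k).le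
    rw [intervalIntegral.integral_eq_sub_of_hasDerivAt hd (hcont.intervalIntegrable _ _)] at h1
    have h2 : heatFactor (t - t) k = 1 := by simp [heatFactor]
    rw [h2, mul_one] at h1
    have := mul_nonneg (mul_nonneg (inv_nonneg.2 hk2.le) (heatFactor_pos (t - r) k).le) hN0
    linarith
  calc (k : ℝ) ^ 2 * ‖fc (cpt (τ t) i) k‖
      ≤ (k : ℝ) ^ 2 * (heatFactor (t - r) k * ‖fc (cpt (τ r) i) k‖ + ((k : ℝ) ^ 2)⁻¹ * N) := by
        gcongr
        rw [e4]
        refine (norm_add_le _ _).trans (add_le_add (le_of_eq ?_) e5)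
        rw [norm_mul, Complex.norm_real, Real.norm_of_nonneg (heatFactor_pos _ k).le]
    _ = _ := by field_simp

/-! ### The nonlocal force -/

lemma continuous_theta : Continuous theta :=
  continuous_norm.comp (AddCircle.continuous_mk' (2 * π))

lemma theta_nonneg (z : ℝ) : 0 ≤ theta z := norm_nonneg _

lemma theta_neg (z : ℝ) : theta (-z) = theta z := by
  rw [theta, theta, AddCircle.coe_neg, norm_neg]

lemma IsBiLipschitz.continuous {γ : ℝ → R3} (hγ : IsBiLipschitz γ) : Continuous γ := by
  obtain ⟨l, _, h⟩ := hγ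
  rw [continuous_iff_continuousAt]
  intro x
  rw [ContinuousAt, tendsto_iff_norm_sub_tendsto_zero]
  have h1 : Tendsto (fun y => theta (y - x)) (𝓝 x) (𝓝 0) := by
    have h2 : Continuous fun y => theta (y - x) :=
      continuous_theta.comp (continuous_id.sub continuous_const)
    have h3 : theta (x - x) = 0 := by simp [theta]
    rw [← h3]; exact h2.tendsto x
  exact squeeze_zero (fun _ => norm_nonneg _) (fun y => (h y x).2) h1

/-- The integrand of the nonlocal force away from the diagonal. -/
def forceDensity (K : ℝ → ℝ → ℝ) (γ : ℝ → R3) (ε : ℝ) : ℝ × ℝ → R3 :=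
  {p : ℝ × ℝ | ε ≤ theta (p.1 - p.2)}.indicator fun p =>
    kernelDeriv K (‖γ p.1 - γ p.2‖ ^ 2) (theta (p.1 - p.2) ^ 2) • (γ p.1 - γ p.2)

lemma forceDensity_swap (K : ℝ → ℝ → ℝ) (γ : ℝ → R3) (ε x y : ℝ) :
    forceDensity K γ ε (y, x) = -forceDensity K γ ε (x, y) := by
  have h : theta (y - x) = theta (x - y) := by rw [← theta_neg, neg_sub]
  simp only [forceDensity, indicator, mem_ofPred_eq, h, norm_sub_rev (γ y) (γ x)]
  split_ifs
  · rw [← smul_neg, neg_sub]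
  · simp

/-- Where `ε ≤ theta`, the bi-Lipschitz bounds keep the chord positive and at most the arc length,
hence inside the region where `K_u` is continuous. The integrand is therefore continuous on a
compact set. -/
lemma integrable_forceDensity {K : ℝ → ℝ → ℝ} (hK : IsC1Kernel K) {γ : ℝ → R3}
    (hγ : IsBiLipschitz γ) {ε : ℝ} (hε : 0 < ε) :
    Integrable (forceDensity K γ ε) (torusMeasure.prod torusMeasure) := by
  have hc := hγ.continuous
  obtain ⟨l, hl, h⟩ := hγ
  have hclosed : IsClosed {p : ℝ × ℝ | ε ≤ theta (p.1 - p.2)} :=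
    isClosed_le continuous_const (continuous_theta.comp (continuous_fst.sub continuous_snd))
  have hsub : Continuous fun p : ℝ × ℝ => γ p.1 - γ p.2 :=
    (hc.comp continuous_fst).sub (hc.comp continuous_snd)
  have hcont : ContinuousOn (fun p : ℝ × ℝ =>
      kernelDeriv K (‖γ p.1 - γ p.2‖ ^ 2) (theta (p.1 - p.2) ^ 2) • (γ p.1 - γ p.2))
      {p : ℝ × ℝ | ε ≤ theta (p.1 - p.2)} := by
    refine ContinuousOn.smul (f := fun p : ℝ × ℝ =>
      kernelDeriv K (‖γ p.1 - γ p.2‖ ^ 2) (theta (p.1 - p.2) ^ 2)) ?_ hsub.continuousOn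
    refine hK.continuous.comp (f := fun p : ℝ × ℝ =>
      (‖γ p.1 - γ p.2‖ ^ 2, theta (p.1 - p.2) ^ 2)) ?_ ?_
    · exact ((hsub.norm.pow 2).prodMk
        ((continuous_theta.comp (continuous_fst.sub continuous_snd)).pow 2)).continuousOn
    · intro p hp
      have hp' : ε ≤ theta (p.1 - p.2) := hp
      have h1 : 0 < ‖γ p.1 - γ p.2‖ :=
        (mul_pos (inv_pos.2 hl) (hε.trans_le hp')).trans_le (h p.1 p.2).1
      exact ⟨by positivity, pow_le_pow_left₀ (norm_nonneg _) (h p.1 p.2).2 2⟩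
  rw [forceDensity, integrable_indicator_iff hclosed.measurableSet, torusMeasure,
    Measure.prod_restrict, IntegrableOn, Measure.restrict_restrict hclosed.measurableSet]
  have hcomp : IsCompact ({p : ℝ × ℝ | ε ≤ theta (p.1 - p.2)} ∩ Icc (-π) π ×ˢ Icc (-π) π) :=
    (isCompact_Icc.prod isCompact_Icc).inter_left hclosed
  refine ((hcont.mono inter_subset_left).integrableOn_compact
    (μ := (volume : Measure ℝ).prod volume) hcomp).mono_set ?_
  exact inter_subset_inter_right _ (prod_mono Ioc_subset_Icc_self Ioc_subset_Icc_self)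

lemma truncatedForce_eq (K : ℝ → ℝ → ℝ) (γ : ℝ → R3) (ε x : ℝ) :
    truncatedForce K γ ε x = ∫ y, forceDensity K γ ε (x, y) ∂torusMeasure := by
  have hm : MeasurableSet {y : ℝ | ε ≤ theta (x - y)} :=
    (isClosed_le continuous_const (continuous_theta.comp
      (continuous_const.sub continuous_id))).measurableSet
  have : (fun y => forceDensity K γ ε (x, y)) = {y : ℝ | ε ≤ theta (x - y)}.indicator fun y =>
      kernelDeriv K (‖γ x - γ y‖ ^ 2) (theta (x - y) ^ 2) • (γ x - γ y) := by
    ext y; simp [forceDensity, indicator]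
  rw [this, integral_indicator hm, torusMeasure, Measure.restrict_restrict hm, truncatedForce,
    inter_comm]
  rfl

/-- The density changes sign under `x ↔ y`, so by Fubini the double integral equals its own
negative. -/
lemma integral_truncatedForce {K : ℝ → ℝ → ℝ} (hK : IsC1Kernel K) {γ : ℝ → R3}
    (hγ : IsBiLipschitz γ) {ε : ℝ} (hε : 0 < ε) :
    Integrable (truncatedForce K γ ε) torusMeasure ∧
      ∫ x, truncatedForce K γ ε x ∂torusMeasure = 0 := by
  have hi := integrable_forceDensity hK hγ hε
  have he : truncatedForce K γ ε = fun x => ∫ y, forceDensity K γ ε (x, y) ∂torusMeasure :=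
    funext (truncatedForce_eq K γ ε)
  rw [he]
  refine ⟨hi.integral_prod_left, ?_⟩
  have hsw := integral_integral_swap (f := fun x y => forceDensity K γ ε (x, y)) hi
  have h2 : ∫ y, ∫ x, forceDensity K γ ε (x, y) ∂torusMeasure ∂torusMeasure
      = -∫ x, ∫ y, forceDensity K γ ε (x, y) ∂torusMeasure ∂torusMeasure := by
    rw [← integral_neg]
    refine integral_congr_ae (ae_of_all _ fun y => ?_)
    simp only
    rw [← integral_neg]
    exact integral_congr_ae (ae_of_all _ fun x => forceDensity_swap K γ ε y x)
  rw [h2] at hsw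
  set v := ∫ x, ∫ y, forceDensity K γ ε (x, y) ∂torusMeasure ∂torusMeasure
  have h3 : (2 : ℝ) • v = 0 := by rw [two_smul]; nth_rewrite 1 [hsw]; simp
  exact (smul_eq_zero.1 h3).resolve_left two_ne_zero

/-- The nonlocal force has mean zero. -/
lemma IsNonlocalForce.integral_eq_zero {K : ℝ → ℝ → ℝ} (hK : IsC1Kernel K) {γ f : ℝ → R3}
    (hγ : IsBiLipschitz γ) (hf : IsNonlocalForce K γ f) : ∫ x, f x ∂torusMeasure = 0 := by
  have fi : Integrable f torusMeasure := hf.1.integrable (by norm_num)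
  -- On a finite measure space, `L²` convergence controls the `L¹` norm and hence the integral; the
  -- extra factor is the Hölder constant.
  have h1 : Tendsto (fun ε => eLpNorm (fun x => truncatedForce K γ ε x - f x) 2 torusMeasure
      * torusMeasure univ ^ (1 / (1 : ℝ≥0∞).toReal - 1 / (2 : ℝ≥0∞).toReal)) (𝓝[>] 0) (𝓝 0) := by
    have := ENNReal.Tendsto.mul_const hf.2
      (b := torusMeasure univ ^ (1 / (1 : ℝ≥0∞).toReal - 1 / (2 : ℝ≥0∞).toReal))
      (Or.inr (ENNReal.rpow_ne_top_of_nonneg (by norm_num) (measure_ne_top _ _)))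
    simpa using this
  have h2 : ∀ᶠ ε in 𝓝[>] (0 : ℝ), ‖∫ x, f x ∂torusMeasure‖ₑ
      ≤ eLpNorm (fun x => truncatedForce K γ ε x - f x) 2 torusMeasure
      * torusMeasure univ ^ (1 / (1 : ℝ≥0∞).toReal - 1 / (2 : ℝ≥0∞).toReal) := by
    filter_upwards [self_mem_nhdsWithin] with ε hε
    obtain ⟨i1, i2⟩ := integral_truncatedForce hK hγ hε
    have h3 : ∫ x, (truncatedForce K γ ε x - f x) ∂torusMeasure = -∫ x, f x ∂torusMeasure := by
      rw [integral_sub i1 fi, i2, zero_sub]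
    rw [← enorm_neg, ← h3]
    refine (enorm_integral_le_lintegral_enorm _).trans ?_
    rw [← eLpNorm_one_eq_lintegral_enorm]
    exact eLpNorm_le_eLpNorm_mul_rpow_measure_univ (by norm_num) (i1.sub fi).1
  have h4 := ge_of_tendsto h1 h2
  simpa using h4

/-! ### Weak derivatives on the Fourier side -/

lemma contDiff_re_mul_expI (c : ℂ) (k : ℤ) : ContDiff ℝ ∞ fun x => (c * expI k x).re := by
  have h : ContDiff ℝ ∞ fun x : ℝ => c * expI k x := by
    unfold expI
    exact contDiff_const.mul ((contDiff_const.mul Complex.ofRealCLM.contDiff).cexp)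
  exact Complex.reCLM.contDiff.comp h

lemma iteratedDeriv_re_mul_expI (n : ℕ) (c : ℂ) (k : ℤ) :
    iteratedDeriv n (fun x => (c * expI k x).re) =
      fun x => ((Complex.I * k) ^ n * c * expI k x).re := by
  induction n generalizing c with
  | zero => simp
  | succ n ih =>
    rw [iteratedDeriv_succ', show deriv (fun x => (c * expI k x).re)
      = fun x => (Complex.I * k * c * expI k x).re from ?_, ih]
    · ext x; congr 1; ring
    · ext x
      have h1 := (hasDerivAt_expI k x).const_mul c
      have h2 := (Complex.reCLM.hasFDerivAt (x := c * expI k x)).comp_hasDerivAt x h1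
      have h3 : deriv (fun x => (c * expI k x).re) x = (c * (Complex.I * k * expI k x)).re :=
        h2.deriv
      rw [h3]; congr 1; ring

lemma integral_re_mul_expI_smul {f : ℝ → R3} (hf : Integrable f torusMeasure) (c : ℂ) (k : ℤ)
    (i : Fin 3) : (∫ x in (-π)..π, (c * expI (-k) x).re • f x) i
      = (c * (2 * π) * fc (cpt f i) k).re := by
  have hpi : (π : ℂ) ≠ 0 := by exact_mod_cast Real.pi_ne_zero
  have hi : Integrable (fun x => (c * expI (-k) x).re • f x) torusMeasure := by
    refine hf.bdd_smul (φ := fun x => (c * expI (-k) x).re) ‖c‖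
      (contDiff_re_mul_expI c (-k)).continuous.aestronglyMeasurable (ae_of_all _ fun x => ?_)
    refine (Complex.abs_re_le_norm _).trans ?_
    rw [norm_mul, norm_expI, mul_one]
  have h1 := integral_cpt _ hi i
  have h2 := (EuclideanSpace.proj (𝕜 := ℝ) i).integral_comp_comm hi
  have h3 : ∫ x, (c * expI (-k) x * cpt f i x).re ∂torusMeasure
      = (∫ x, c * expI (-k) x * cpt f i x ∂torusMeasure).re := by
    have : Integrable (fun x => c * expI (-k) x * cpt f i x) torusMeasure := by
      simp only [mul_assoc]
      exact (integrable_expI_mul (integrable_cpt hf i) _).const_mul c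
    exact Complex.reCLM.integral_comp_comm this
  rw [intervalIntegral_eq_torus]
  refine h2.symm.trans ?_
  have h4 : ∀ x, (EuclideanSpace.proj (𝕜 := ℝ) i) ((c * expI (-k) x).re • f x)
      = (c * expI (-k) x * cpt f i x).re := fun x => by
    simp [cpt]
  simp only [h4]
  rw [h3, fc_eq]
  congr 1
  simp only [mul_assoc c]
  rw [integral_const_mul]
  field_simp

/-- Test functions are real valued, so one tests with `Re (c e^{-ikx})` for every complex `c`.
Taking `c` to be the conjugate of the defect `A` yields `|A|² = 0`. -/
lemma IsWeakDeriv.fc_eq {n : ℕ} {f g : ℝ → R3} (h : IsWeakDeriv n f g)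
    (hf : Integrable f torusMeasure) (hg : Integrable g torusMeasure) (i : Fin 3) (k : ℤ) :
    fc (cpt g i) k = (Complex.I * k) ^ n * fc (cpt f i) k := by
  have hpi : (π : ℂ) ≠ 0 := by exact_mod_cast Real.pi_ne_zero
  have key : ∀ c : ℂ, (c * ((2 * π) * ((-1) ^ n * ((Complex.I * k) ^ n * fc (cpt f i) k
      - fc (cpt g i) k)))).re = 0 := by
    intro c
    have h1 := h (fun x => (c * expI (-k) x).re) (contDiff_re_mul_expI c (-k)) (fun x => by
      simp only [(expI_periodic (-k)) x])
    rw [iteratedDeriv_re_mul_expI] at h1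
    have h2 := congrArg (fun v : R3 => v i) h1
    simp only [PiLp.smul_apply] at h2
    rw [integral_re_mul_expI_smul hf, integral_re_mul_expI_smul hg, smul_eq_mul] at h2
    have h3 : ((-1 : ℝ) ^ n) * (c * (2 * π) * fc (cpt g i) k).re
        = ((-1) ^ n * (c * (2 * π) * fc (cpt g i) k)).re := by
      rw [← Complex.re_ofReal_mul]; push_cast; rfl
    rw [h3, ← sub_eq_zero, ← Complex.sub_re] at h2
    rw [← h2]; congr 1
    push_cast
    rw [show Complex.I * -(k : ℂ) = (-1) * (Complex.I * k) by ring, mul_pow]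
    ring
  set A := (2 * π : ℂ) * ((-1) ^ n * ((Complex.I * k) ^ n * fc (cpt f i) k - fc (cpt g i) k))
    with hA
  have h0 := key ((starRingEnd ℂ) A)
  have hA0 : A = 0 := by
    rw [mul_comm, Complex.mul_conj] at h0
    exact Complex.normSq_eq_zero.1 (by exact_mod_cast h0)
  have h1 : (-1 : ℂ) ^ n ≠ 0 := pow_ne_zero _ (by norm_num)
  have h2 : (Complex.I * k) ^ n * fc (cpt f i) k - fc (cpt g i) k = 0 := by
    simpa [hA, hpi, h1] using hA0
  exact (sub_eq_zero.1 h2).symm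

/-! ### `L²` norms -/

lemma mean_mono {u v : ℝ → ℝ} (hu : Integrable u torusMeasure) (hv : Integrable v torusMeasure)
    (h : ∀ᵐ x ∂torusMeasure, u x ≤ v x) : mean u ≤ mean v := by
  have := Real.pi_pos
  rw [mean_eq_torus, mean_eq_torus]
  exact mul_le_mul_of_nonneg_left (integral_mono_ae hu hv h) (by positivity)

lemma mean_const {V : Type*} [NormedAddCommGroup V] [NormedSpace ℝ V] [CompleteSpace V] (c : V) :
    mean (fun _ => c) = c := by
  have := Real.pi_pos
  rw [mean_eq_torus, integral_const, torusMeasure_real_univ, smul_smul,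
    inv_mul_cancel₀ (by positivity), one_smul]

lemma mean_nonneg {u : ℝ → ℝ} (h : ∀ x, 0 ≤ u x) : 0 ≤ mean u := by
  have := Real.pi_pos
  rw [mean_eq_torus]
  exact mul_nonneg (by positivity) (integral_nonneg h)

lemma mean_norm_le_l2Norm {u : ℝ → R3} (hu : MemLp u 2 torusMeasure) :
    (mean fun x => ‖u x‖) ≤ l2Norm u := by
  have ui : Integrable (fun x => ‖u x‖) torusMeasure := (hu.integrable (by norm_num)).norm
  have u2 : Integrable (fun x => ‖u x‖ ^ 2) torusMeasure := hu.integrable_norm_pow (by norm_num)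
  set m := mean fun x => ‖u x‖ with hm
  refine Real.le_sqrt_of_sq_le ?_
  -- Cauchy–Schwarz in the form that a variance is nonnegative.
  have h1 : 0 ≤ mean fun x => (‖u x‖ - m) ^ 2 := mean_nonneg fun x => sq_nonneg _
  have h2 : (mean fun x => (‖u x‖ - m) ^ 2) = (mean fun x => ‖u x‖ ^ 2) - m ^ 2 := by
    have e : ∀ x, (‖u x‖ - m) ^ 2 = ‖u x‖ ^ 2 - 2 * m * ‖u x‖ + m ^ 2 := fun x => by ring
    have h3 : mean (fun _ : ℝ => m ^ 2) = m ^ 2 := mean_const _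
    simp only [mean_eq_torus, smul_eq_mul] at h3 hm ⊢
    simp only [e]
    have e3 := integral_add (u2.sub (ui.const_mul (2 * m))) (integrable_const (m ^ 2))
    simp only [Pi.sub_apply] at e3
    rw [e3, integral_sub u2 (ui.const_mul _), integral_const_mul, mul_add, h3, mul_sub,
      mul_left_comm _ (2 * m), ← hm]
    ring
  linarith

/-- For `n = 0` the force hypothesis bounds some `g` that is only weakly equal to `f`; the bound has
to be carried over to `f`. -/
lemma l2Norm_eq_of_isWeakDeriv_zero {f g : ℝ → R3} (hf : MemLp f 2 torusMeasure)
    (hg : MemLp g 2 torusMeasure) (h : IsWeakDeriv 0 f g) : l2Norm f = l2Norm g := by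
  rw [l2Norm, l2Norm, ← (hasSum_norm_sq_fourierVec hf).tsum_eq,
    ← (hasSum_norm_sq_fourierVec hg).tsum_eq]
  congr 1
  refine tsum_congr fun k => ?_
  simp only [norm_sq_fourierVec]
  refine Finset.sum_congr rfl fun i _ => ?_
  rw [h.fc_eq (hf.integrable (by norm_num)) (hg.integrable (by norm_num))]; simp

/-! ### The curve induced by a tangent field -/

lemma hasDerivAt_primitive {τ : ℝ → R3} (hc : Continuous τ) (x : ℝ) :
    HasDerivAt (primitive τ) (τ x) x := by
  have := intervalIntegral.integral_hasDerivAt_right (hc.intervalIntegrable (-π) x)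
    (hc.stronglyMeasurableAtFilter _ _) hc.continuousAt
  exact this.const_add _

lemma integral_torus_eq_zero {τ : ℝ → R3} (h : mean τ = 0) : ∫ x, τ x ∂torusMeasure = 0 := by
  have := Real.pi_pos
  rw [mean_eq_torus] at h
  exact (smul_eq_zero.1 h).resolve_left (by positivity)

lemma periodic_primitive {τ : ℝ → R3} (hc : Continuous τ) (hp : Function.Periodic τ (2 * π))
    (h0 : mean τ = 0) : Function.Periodic (primitive τ) (2 * π) := by
  intro x
  have h1 : ∫ z in x..(x + 2 * π), τ z = 0 := by
    rw [hp.intervalIntegral_add_eq x (-π), show -π + 2 * π = π by ring, intervalIntegral_eq_torus,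
      integral_torus_eq_zero h0]
  rw [primitive, primitive, ← intervalIntegral.integral_add_adjacent_intervals
    (hc.intervalIntegrable (-π) x) (hc.intervalIntegrable x (x + 2 * π)), h1, add_zero]

lemma integrable_of_continuous {V : Type*} [NormedAddCommGroup V] {u : ℝ → V}
    (hu : Continuous u) : Integrable u torusMeasure :=
  (memLp_of_continuousOn (p := 1) hu.continuousOn).integrable le_rfl

/-- Integration divides coefficients by `ik`, so homogeneous norms of `γ_τ` are those of `τ` with
the index shifted by one. The force hypothesis on `γ ∈ H^{n+2}` thereby becomes one on `τ ∈
H^{n+1}`. -/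
lemma sq_mul_norm_fourierVec_knot {τ : ℝ → R3} (hc : Continuous τ) (h0 : mean τ = 0) (k : ℤ) :
    |(k : ℝ)| ^ 2 * ‖fourierVec (knot τ) k‖ ^ 2 = ‖fourierVec τ k‖ ^ 2 := by
  have h := fun i => (fc_primitive (integrable_of_continuous hc) (integral_torus_eq_zero h0) i).2 k
  rw [norm_sq_fourierVec, norm_sq_fourierVec, Finset.mul_sum]
  refine Finset.sum_congr rfl fun i _ => ?_
  rw [← h i, norm_mul, norm_mul, Complex.norm_I, one_mul, mul_pow, Complex.norm_intCast]; rfl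

lemma isUnitSpeedCurve_knot {s : ℕ} {τ : ℝ → R3} (hc : Continuous τ)
    (hp : Function.Periodic τ (2 * π)) (h0 : mean τ = 0) (h1 : ∀ x, ‖τ x‖ = 1)
    (hs : MemSobolev s τ) : IsUnitSpeedCurve (s + 1) (knot τ) := by
  have hcont : Continuous (knot τ) :=
    continuous_iff_continuousAt.2 fun x => (hasDerivAt_primitive hc x).continuousAt
  refine ⟨periodic_primitive hc hp h0, ⟨memLp_of_continuousOn hcont.continuousOn, ?_⟩, ?_,
    fun x => ?_⟩
  · refine hs.2.congr fun k => ?_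
    rw [← sq_mul_norm_fourierVec_knot hc h0]; ring
  · have h2 : ∀ i, (mean (knot τ)) i = 0 := fun i => by
      have e := (fc_primitive (integrable_of_continuous hc) (integral_torus_eq_zero h0) i).1
      rw [← knot, fc_zero_eq, integral_cpt _ (integrable_of_continuous hcont)] at e
      rw [mean_eq_torus, PiLp.smul_apply, smul_eq_mul]
      refine Complex.ofReal_eq_zero.1 ?_
      rw [Complex.ofReal_mul]; push_cast; exact e
    ext i; simpa using h2 i
  · rw [knot, (hasDerivAt_primitive hc x).deriv, h1]

lemma homSobolevNorm_knot {s : ℕ} {τ : ℝ → R3} (hc : Continuous τ) (h0 : mean τ = 0) :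
    homSobolevNorm (s + 1) (knot τ) = homSobolevNorm s τ := by
  rw [homSobolevNorm, homSobolevNorm]
  congr 1
  refine tsum_congr fun k => ?_
  rw [← sq_mul_norm_fourierVec_knot hc h0]; ring

/-- The bounds assumed for the nonlocal force. -/
def ForceBound (K : ℝ → ℝ → ℝ) (C : ℕ → ℝ → ℝ → ℝ) : Prop :=
  ∀ (n : ℕ) (γ : ℝ → R3), IsUnitSpeedCurve (n + 2) γ → IsBiLipschitz γ →
    ∀ f : ℝ → R3, IsNonlocalForce K γ f →
      ∃ g : ℝ → R3, MemLp g 2 torusMeasure ∧ IsWeakDeriv n f g ∧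
        l2Norm g ≤ C n (distortion γ).toReal (homSobolevNorm (n + 2) γ)

/-- A unit tangent field in `H¹` inducing an embedded closed curve. -/
structure IsTangent (τ : ℝ → R3) : Prop where
  continuous : Continuous τ
  periodic : Function.Periodic τ (2 * π)
  memSobolev : MemSobolev 1 τ
  mean_eq_zero : mean τ = 0
  norm_eq_one : ∀ x, ‖τ x‖ = 1
  biLipschitz : IsBiLipschitz (knot τ)

/-- Because `f` has mean zero, `|k|^{n+1}` times the coefficient of its primitive is, in modulus,
the coefficient of the `n`-th weak derivative `g`, which is at most `l2Norm g`. The factor `2 ^ (n +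
1)` comes from `1 + |k| ≤ 2|k|` for `k ≠ 0`. -/
lemma decay_primitive_force {K : ℝ → ℝ → ℝ} {C : ℕ → ℝ → ℝ → ℝ} (hK : IsC1Kernel K)
    (hC : ForceBound K C) {τ f : ℝ → R3} (hτ : IsTangent τ) (n : ℕ) (hs : MemSobolev (n + 1) τ)
    (hf : IsNonlocalForce K (knot τ) f) (i : Fin 3) :
    Decay (2 * (n + 1))
      (2 ^ (n + 1) * C n (distortion (knot τ)).toReal (homSobolevNorm (n + 1) τ))
      (cpt (primitive f) i) := by
  obtain ⟨g, hg, hw, hle⟩ := hC n (knot τ) (isUnitSpeedCurve_knot hτ.continuous hτ.periodic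
    hτ.mean_eq_zero hτ.norm_eq_one hs) hτ.biLipschitz f hf
  rw [homSobolevNorm_knot hτ.continuous hτ.mean_eq_zero] at hle
  set c := C n (distortion (knot τ)).toReal (homSobolevNorm (n + 1) τ)
  have fi : Integrable f torusMeasure := hf.1.integrable (by norm_num)
  have gi : Integrable g torusMeasure := hg.integrable (by norm_num)
  obtain ⟨z, hz⟩ := fc_primitive fi (hf.integral_eq_zero hK hτ.biLipschitz) i
  have hc0 : 0 ≤ c := (Real.sqrt_nonneg _).trans hle
  intro k
  rcases eq_or_ne k 0 with rfl | hk
  · rw [z, norm_zero, mul_zero]; positivity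
  have hk1 : (1 : ℝ) ≤ |(k : ℝ)| := by exact_mod_cast Int.one_le_abs hk
  have h1 : |(k : ℝ)| ^ (n + 1) * ‖fc (cpt (primitive f) i) k‖ ≤ c := by
    calc _ = ‖fc (cpt g i) k‖ := by
          rw [hw.fc_eq fi gi, ← hz k, ← mul_assoc, ← pow_succ, norm_mul, norm_pow, norm_mul,
            Complex.norm_I, one_mul, Complex.norm_intCast]
      _ ≤ mean fun x => ‖g x‖ := norm_fc_cpt_le_mean gi i k
      _ ≤ l2Norm g := mean_norm_le_l2Norm hg
      _ ≤ c := hle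
  calc rho k ^ (2 * (n + 1)) * ‖fc (cpt (primitive f) i) k‖
      ≤ (2 ^ (n + 1) * |(k : ℝ)| ^ (n + 1)) * ‖fc (cpt (primitive f) i) k‖ := by
        rw [pow_mul, rho_sq, ← mul_pow]
        gcongr; linarith
    _ ≤ _ := by rw [mul_assoc]; gcongr

lemma norm_primitive_force_le {K : ℝ → ℝ → ℝ} {C : ℕ → ℝ → ℝ → ℝ}
    (hC : ForceBound K C) {τ f : ℝ → R3} (hτ : IsTangent τ)
    (hf : IsNonlocalForce K (knot τ) f) {x : ℝ} (hx : x ∈ Icc (-π) π) :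
    ‖primitive f x‖ ≤ 4 * π * C 0 (distortion (knot τ)).toReal (homSobolevNorm 1 τ) := by
  obtain ⟨g, hg, hw, hle⟩ := hC 0 (knot τ) (isUnitSpeedCurve_knot hτ.continuous hτ.periodic
    hτ.mean_eq_zero hτ.norm_eq_one hτ.memSobolev) hτ.biLipschitz f hf
  rw [homSobolevNorm_knot hτ.continuous hτ.mean_eq_zero] at hle
  have := Real.pi_pos
  refine (norm_primitive_le (hf.1.integrable (by norm_num)) hx).trans ?_
  gcongr
  exact (mean_norm_le_l2Norm hf.1).trans ((l2Norm_eq_of_isWeakDeriv_zero hf.1 hg hw).trans_le hle)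

/-! ### Bounds for the lower order terms at a fixed time -/

/-- The supremum of a continuous function over `[0, δ] × [0, H]`. -/
def supOn (c : ℝ → ℝ → ℝ) (δ H : ℝ) : ℝ :=
  sSup ((fun q : ℝ × ℝ => c q.1 q.2) '' (Icc 0 δ ×ˢ Icc 0 H))

/-- The bounds `C n` are continuous but need not be monotone. The supremum over a box turns upper
bounds on the arguments into an upper bound on the value. -/
lemma le_supOn {c : ℝ → ℝ → ℝ} (hc : Continuous fun q : ℝ × ℝ => c q.1 q.2) {δ H d h : ℝ}
    (hd : d ∈ Icc 0 δ) (hh : h ∈ Icc 0 H) : c d h ≤ supOn c δ H :=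
  le_csSup ((isCompact_Icc.prod isCompact_Icc).image hc).bddAbove ⟨(d, h), ⟨hd, hh⟩, rfl⟩

/-- In each component the summand is at most `B² (1 + |k|)^{2s - p}`, hence at most `B² (1 +
|k|)^{-2}`, which is dominated by the terms of `rhoSum`. The factor `3` counts components. -/
lemma Decay.memSobolev {p s : ℕ} {B : ℝ} {u : ℝ → R3} (hu : MemLp u 2 torusMeasure)
    (h : ∀ i, Decay p B (cpt u i)) (hs : 2 * s + 2 ≤ p) :
    MemSobolev s u ∧ homSobolevNorm s u ≤ √(3 * B ^ 2 * rhoSum) := by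
  have hle : ∀ k : ℤ, |(k : ℝ)| ^ (2 * s) * ‖fourierVec u k‖ ^ 2 ≤ 3 * B ^ 2 * (rho k)⁻¹ ^ 3 := by
    intro k
    have hk := rho_pos k
    have h1 := one_le_rho k
    have h2 : ∀ i, |(k : ℝ)| ^ (2 * s) * ‖fc (cpt u i) k‖ ^ 2 ≤ B ^ 2 * (rho k)⁻¹ ^ 3 := by
      intro i
      have h3 : |(k : ℝ)| ^ (2 * s) ≤ rho k ^ (4 * s) := by
        rw [show 4 * s = 2 * (2 * s) by ring, pow_mul (rho k), rho_sq]
        gcongr; linarith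
      have h4 : rho k ^ (4 * s) * (rho k) ^ 3 ≤ (rho k ^ p) ^ 2 := by
        rw [← pow_add, ← pow_mul]
        exact pow_le_pow_right₀ h1 (by omega)
      have h5 : (rho k ^ p * ‖fc (cpt u i) k‖) ^ 2 ≤ B ^ 2 :=
        pow_le_pow_left₀ (by positivity) (h i k) 2
      rw [inv_pow, ← div_eq_mul_inv, le_div_iff₀ (by positivity)]
      calc |(k : ℝ)| ^ (2 * s) * ‖fc (cpt u i) k‖ ^ 2 * rho k ^ 3
          ≤ rho k ^ (4 * s) * ‖fc (cpt u i) k‖ ^ 2 * rho k ^ 3 := by gcongr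
        _ = rho k ^ (4 * s) * rho k ^ 3 * ‖fc (cpt u i) k‖ ^ 2 := by ring
        _ ≤ (rho k ^ p) ^ 2 * ‖fc (cpt u i) k‖ ^ 2 := by gcongr
        _ ≤ B ^ 2 := by rw [← mul_pow]; exact h5
    rw [norm_sq_fourierVec, Finset.mul_sum]
    refine (Finset.sum_le_sum fun i _ => h2 i).trans (le_of_eq ?_)
    simp; ring
  have hsum : Summable fun k : ℤ => |(k : ℝ)| ^ (2 * s) * ‖fourierVec u k‖ ^ 2 :=
    .of_nonneg_of_le (fun k => by positivity) hle (summable_inv_rho_cube.mul_left _)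
  refine ⟨⟨hu, hsum⟩, Real.sqrt_le_sqrt ?_⟩
  rw [rhoSum, ← tsum_mul_left]
  exact hsum.tsum_le_tsum hle (summable_inv_rho_cube.mul_left _)

lemma homSobolevNorm_nonneg (s : ℕ) (u : ℝ → R3) : 0 ≤ homSobolevNorm s u := Real.sqrt_nonneg _

lemma homSobolevNorm_le_sobolevNorm (s : ℕ) (u : ℝ → R3) : homSobolevNorm s u ≤ sobolevNorm s u :=
  Real.le_sqrt_of_sq_le (by linarith [sq_nonneg ‖fourierVec u 0‖])

lemma norm_mean_le {u : ℝ → R3} : ‖mean u‖ ≤ mean fun x => ‖u x‖ := by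
  have := Real.pi_pos
  rw [mean_eq_torus, mean_eq_torus, norm_smul, Real.norm_of_nonneg (by positivity), smul_eq_mul]
  gcongr
  exact norm_integral_le_integral_norm _

/-- Quantitative bounds on a unit tangent field. -/
structure TangentBound (A δ H : ℝ) (τ : ℝ → R3) : Prop extends IsTangent τ where
  invNorm_le : invNorm τ ≤ A
  distortion_le : (distortion (knot τ)).toReal ≤ δ
  sobolevNorm_le : sobolevNorm 1 τ ≤ H

/-- Bound for the primitive of the force. -/
def primitiveBound (C : ℕ → ℝ → ℝ → ℝ) (δ H : ℝ) : ℝ := 4 * π * supOn (C 0) δ H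

/-- Bound for the multiplier `λ_τ`. -/
def lamBound (C : ℕ → ℝ → ℝ → ℝ) (A δ H : ℝ) : ℝ := A * (primitiveBound C δ H + H ^ 2)

/-- Bound for the mean of the lower order terms. -/
def lowerBound (C : ℕ → ℝ → ℝ → ℝ) (A δ H : ℝ) : ℝ :=
  2 * primitiveBound C δ H + 2 * lamBound C A δ H + H ^ 2

section Static

variable {K : ℝ → ℝ → ℝ} {C : ℕ → ℝ → ℝ → ℝ} {A δ H : ℝ} {τ f : ℝ → R3}

lemma TangentBound.homSobolevNorm_mem (hτ : TangentBound A δ H τ) :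
    homSobolevNorm 1 τ ∈ Icc 0 H :=
  ⟨homSobolevNorm_nonneg _ _, (homSobolevNorm_le_sobolevNorm _ _).trans hτ.sobolevNorm_le⟩

lemma TangentBound.distortion_mem (hτ : TangentBound A δ H τ) :
    (distortion (knot τ)).toReal ∈ Icc 0 δ := ⟨ENNReal.toReal_nonneg, hτ.distortion_le⟩

lemma TangentBound.mean_sq_deriv_le (hτ : TangentBound A δ H τ) :
    (mean fun x => ‖deriv τ x‖ ^ 2) ≤ H ^ 2 := by
  rw [mean_norm_sq_deriv hτ.continuous hτ.memSobolev]
  exact pow_le_pow_left₀ hτ.homSobolevNorm_mem.1 hτ.homSobolevNorm_mem.2 2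

lemma TangentBound.norm_primitive_le (hC : ForceBound K C)
    (hCc : ∀ n, Continuous fun q : ℝ × ℝ => C n q.1 q.2) (hτ : TangentBound A δ H τ)
    (hf : IsNonlocalForce K (knot τ) f) {x : ℝ} (hx : x ∈ Icc (-π) π) :
    ‖primitive f x‖ ≤ primitiveBound C δ H := by
  refine (norm_primitive_force_le hC hτ.toIsTangent hf hx).trans ?_
  have := Real.pi_pos
  exact mul_le_mul_of_nonneg_left (le_supOn (hCc 0) hτ.distortion_mem hτ.homSobolevNorm_mem)
    (by positivity)

lemma ae_torus_mem_Icc : ∀ᵐ x ∂torusMeasure, x ∈ Icc (-π) π :=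
  (ae_restrict_iff' measurableSet_Ioc).2 (ae_of_all _ fun _ hx => Ioc_subset_Icc_self hx)

lemma primitiveBound_nonneg (hC : ForceBound K C)
    (hCc : ∀ n, Continuous fun q : ℝ × ℝ => C n q.1 q.2) (hτ : TangentBound A δ H τ)
    (hf : IsNonlocalForce K (knot τ) f) : 0 ≤ primitiveBound C δ H :=
  (norm_nonneg _).trans (hτ.norm_primitive_le hC hCc hf
    (⟨by linarith [Real.pi_pos], Real.pi_pos.le⟩ : (0 : ℝ) ∈ Icc (-π) π))

lemma aestronglyMeasurable_primitive (hf : IsNonlocalForce K (knot τ) f) :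
    AEStronglyMeasurable (primitive f) torusMeasure :=
  (memLp_of_continuousOn (p := 1)
    (continuousOn_primitive (hf.1.integrable (by norm_num)))).1

lemma norm_lam_le (hC : ForceBound K C)
    (hCc : ∀ n, Continuous fun q : ℝ × ℝ => C n q.1 q.2) (hτ : TangentBound A δ H τ)
    (hf : IsNonlocalForce K (knot τ) f) : ‖lam (primitive f) τ‖ ≤ lamBound C A δ H := by
  have hb0 := primitiveBound_nonneg hC hCc hτ hf
  have hd2 : Integrable (fun x => ‖deriv τ x‖ ^ 2) torusMeasure :=
    (memLp_deriv hτ.continuous hτ.memSobolev).integrable_norm_pow (by norm_num)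
  have h1 : ‖mean fun x => ((inner ℝ (primitive f x) (τ x) - ‖deriv τ x‖ ^ 2) / ‖τ x‖ ^ 2) • τ x‖
      ≤ primitiveBound C δ H + H ^ 2 := by
    have hle : ∀ x ∈ Icc (-π) π,
        ‖((inner ℝ (primitive f x) (τ x) - ‖deriv τ x‖ ^ 2) / ‖τ x‖ ^ 2) • τ x‖
          ≤ primitiveBound C δ H + ‖deriv τ x‖ ^ 2 := by
      intro x hx
      rw [norm_smul, hτ.norm_eq_one x, one_pow, div_one, mul_one]
      refine (norm_sub_le _ _).trans (add_le_add ?_ (le_of_eq ?_))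
      · refine (norm_inner_le_norm _ _).trans ?_
        rw [hτ.norm_eq_one x, mul_one]; exact hτ.norm_primitive_le hC hCc hf hx
      · rw [Real.norm_of_nonneg (by positivity)]
    have hi : Integrable (fun x => primitiveBound C δ H + ‖deriv τ x‖ ^ 2) torusMeasure :=
      (integrable_const _).add hd2
    have hm : AEStronglyMeasurable (fun x =>
        ((inner ℝ (primitive f x) (τ x) - ‖deriv τ x‖ ^ 2) / ‖τ x‖ ^ 2) • τ x) torusMeasure := by
      simp only [hτ.norm_eq_one, one_pow, div_one]
      exact (((aestronglyMeasurable_primitive hf).inner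
        hτ.continuous.aestronglyMeasurable).sub hd2.1).smul hτ.continuous.aestronglyMeasurable
    have hi' := hi.mono' hm (ae_torus_mem_Icc.mono hle)
    refine norm_mean_le.trans ((mean_mono hi'.norm hi (ae_torus_mem_Icc.mono hle)).trans ?_)
    have h3 : (mean fun x => primitiveBound C δ H + ‖deriv τ x‖ ^ 2)
        = primitiveBound C δ H + mean fun x => ‖deriv τ x‖ ^ 2 := by
      have h4 : mean (fun _ : ℝ => primitiveBound C δ H) = primitiveBound C δ H := mean_const _
      nth_rewrite 2 [← h4]
      simp only [mean_eq_torus]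
      rw [integral_add (integrable_const _) hd2, smul_add]
    rw [h3]
    linarith [hτ.mean_sq_deriv_le]
  rw [lam, lamBound]
  refine (ContinuousLinearMap.le_opNorm _ _).trans ?_
  exact mul_le_mul hτ.invNorm_le h1 (norm_nonneg _) ((norm_nonneg _).trans hτ.invNorm_le)

lemma abs_mu_le (hC : ForceBound K C)
    (hCc : ∀ n, Continuous fun q : ℝ × ℝ => C n q.1 q.2) (hτ : TangentBound A δ H τ)
    (hf : IsNonlocalForce K (knot τ) f) {x : ℝ} (hx : x ∈ Icc (-π) π) :
    |mu (primitive f) τ x| ≤ ‖deriv τ x‖ ^ 2 + primitiveBound C δ H + lamBound C A δ H := by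
  rw [mu, hτ.norm_eq_one x, one_pow, div_one]
  have h1 : |inner ℝ (primitive f x) (τ x)| ≤ primitiveBound C δ H := by
    refine (abs_real_inner_le_norm _ _).trans ?_
    rw [hτ.norm_eq_one x, mul_one]; exact hτ.norm_primitive_le hC hCc hf hx
  have h2 : |inner ℝ (lam (primitive f) τ) (τ x)| ≤ lamBound C A δ H := by
    refine (abs_real_inner_le_norm _ _).trans ?_
    rw [hτ.norm_eq_one x, mul_one]; exact norm_lam_le hC hCc hτ hf
  rw [abs_le] at h1 h2 ⊢
  have := sq_nonneg ‖deriv τ x‖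
  constructor <;> linarith [h1.1, h1.2, h2.1, h2.2]

/-- Only a mean can be bounded here, since `|τ_x|²` is merely integrable for `τ ∈ H¹`. This starts
the bootstrap. The factors `2` in `lowerBound` arise because `F` and `λ` also occur in `μ`. -/
lemma lowerOrder_mean_le (hC : ForceBound K C)
    (hCc : ∀ n, Continuous fun q : ℝ × ℝ => C n q.1 q.2) (hτ : TangentBound A δ H τ)
    (hf : IsNonlocalForce K (knot τ) f) :
    Integrable (lowerOrder f τ) torusMeasure ∧
      (mean fun x => ‖lowerOrder f τ x‖) ≤ lowerBound C A δ H := by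
  have hd2 : Integrable (fun x => ‖deriv τ x‖ ^ 2) torusMeasure :=
    (memLp_deriv hτ.continuous hτ.memSobolev).integrable_norm_pow (by norm_num)
  set c := 2 * primitiveBound C δ H + 2 * lamBound C A δ H with hc
  have hle : ∀ x ∈ Icc (-π) π, ‖lowerOrder f τ x‖ ≤ c + ‖deriv τ x‖ ^ 2 := by
    intro x hx
    have h1 := hτ.norm_primitive_le hC hCc hf hx
    have h2 := norm_lam_le hC hCc hτ hf
    have h3 := abs_mu_le hC hCc hτ hf hx
    have h4 : ‖mu (primitive f) τ x • τ x‖ = |mu (primitive f) τ x| := by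
      rw [norm_smul, hτ.norm_eq_one x, mul_one, Real.norm_eq_abs]
    have h5 := norm_add_le (primitive f x + lam (primitive f) τ) (mu (primitive f) τ x • τ x)
    have h6 := norm_add_le (primitive f x) (lam (primitive f) τ)
    rw [lowerOrder]; linarith
  have hi : Integrable (fun x => c + ‖deriv τ x‖ ^ 2) torusMeasure := (integrable_const _).add hd2
  have hτm := hτ.continuous.aestronglyMeasurable (μ := torusMeasure)
  have hFm := aestronglyMeasurable_primitive hf
  have hm : AEStronglyMeasurable (lowerOrder f τ) torusMeasure := by
    have hmu : AEStronglyMeasurable (mu (primitive f) τ) torusMeasure := by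
      have : mu (primitive f) τ = fun x => ‖deriv τ x‖ ^ 2 - inner ℝ (primitive f x) (τ x)
          - inner ℝ (lam (primitive f) τ) (τ x) := by
        ext x; rw [mu, hτ.norm_eq_one x, one_pow, div_one]
      rw [this]
      exact (hd2.1.sub (hFm.inner hτm)).sub (aestronglyMeasurable_const.inner hτm)
    exact (hFm.add aestronglyMeasurable_const).add (hmu.smul hτm)
  have hi' := hi.mono' hm (ae_torus_mem_Icc.mono hle)
  refine ⟨hi', (mean_mono hi'.norm hi (ae_torus_mem_Icc.mono hle)).trans ?_⟩
  have h3 : (mean fun x => c + ‖deriv τ x‖ ^ 2) = c + mean fun x => ‖deriv τ x‖ ^ 2 := by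
    have h4 : mean (fun _ : ℝ => c) = c := mean_const _
    nth_rewrite 2 [← h4]
    simp only [mean_eq_torus]
    rw [integral_add (integrable_const _) hd2, smul_add]
  rw [h3, lowerBound]
  linarith [hτ.mean_sq_deriv_le]

/-! ### Decay of the lower order terms from decay of the tangent field -/

/-- Unit length removes the denominators, leaving a polynomial. The products are bracketed so that
each multiplication of two functions has both factors in `L²`, as `Decay.mul` demands; `τ_x` times
`τ_x` alone would be only in `L¹`. -/
lemma cpt_lowerOrder (hτ : IsTangent τ) (i : Fin 3) (x : ℝ) :
    cpt (lowerOrder f τ) i x = cpt (primitive f) i x + ((lam (primitive f) τ i : ℝ) : ℂ)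
      + (∑ l, cpt (deriv τ) l x * (cpt (deriv τ) l x * cpt τ i x)
        - ∑ l, cpt (primitive f) l x * (cpt τ l x * cpt τ i x)
        - ∑ l, ((lam (primitive f) τ l : ℝ) : ℂ) * (cpt τ l x * cpt τ i x)) := by
  have h1 : mu (primitive f) τ x = ∑ l, deriv τ x l * deriv τ x l
      - ∑ l, primitive f x l * τ x l - ∑ l, lam (primitive f) τ l * τ x l := by
    rw [mu, hτ.norm_eq_one x, one_pow, div_one, ← real_inner_self_eq_norm_sq]
    simp only [PiLp.inner_apply, RCLike.inner_apply, conj_trivial]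
    simp only [mul_comm]
  have h2 : lowerOrder f τ x i = primitive f x i + lam (primitive f) τ i
      + (∑ l, deriv τ x l * (deriv τ x l * τ x i) - ∑ l, primitive f x l * (τ x l * τ x i)
        - ∑ l, lam (primitive f) τ l * (τ x l * τ x i)) := by
    rw [lowerOrder, PiLp.add_apply, PiLp.add_apply, PiLp.smul_apply, smul_eq_mul, h1, sub_mul,
      sub_mul, Finset.sum_mul, Finset.sum_mul, Finset.sum_mul]
    simp only [mul_assoc]
  simp only [cpt, h2]
  push_cast
  rfl

/-- The constant in the bootstrap step for the lower order terms. -/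
def stepBound (p : ℕ) (B F L : ℝ) : ℝ :=
  F + L + (3 * (2 ^ (p - 2) * rhoSum * B * (2 ^ (p - 1) * rhoSum * B * B))
    + 3 * (2 ^ (p - 2) * rhoSum * F * (2 ^ (p + 1) * rhoSum * B * B))
    + 3 * (L * (2 ^ (p + 1) * rhoSum * B * B)))

lemma decay_deriv {p : ℕ} {B : ℝ} (hτ : IsTangent τ) (hp : 2 ≤ p) (i : Fin 3)
    (h : Decay p B (cpt τ i)) : Decay (p - 2) B (cpt (deriv τ) i) := by
  intro k
  have hk := rho_pos k
  obtain ⟨q, rfl⟩ := Nat.exists_eq_add_of_le hp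
  rw [(deriv_of_memSobolev hτ.continuous hτ.memSobolev i).2, norm_mul, norm_mul, Complex.norm_I,
    one_mul, Complex.norm_intCast, show 2 + q - 2 = q by omega]
  refine le_trans ?_ (h k)
  rw [pow_add, rho_sq, mul_comm (1 + |(k : ℝ)|), mul_assoc]
  gcongr; linarith

/-- The worst term is `τ_x (τ_x τ)`, a product of two factors of order `p - 2`. Order `c` for the
product requires `c + 3 ≤ 2(p - 2)`, which for `c = p - 3` is exactly `4 ≤ p`. -/
lemma decay_lowerOrder_aux {p : ℕ} {B F L : ℝ} (hτ : IsTangent τ)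
    (hf : IsNonlocalForce K (knot τ) f) (hp : 4 ≤ p)
    (h : ∀ i, Decay p B (cpt τ i)) (hF : ∀ i, Decay (p - 3) F (cpt (primitive f) i))
    (hL : ‖lam (primitive f) τ‖ ≤ L) (i : Fin 3) :
    Decay (p - 3) (stepBound p B F L) (cpt (lowerOrder f τ) i) := by
  have hτ2 : ∀ l, MemLp (cpt τ l) 2 torusMeasure := fun l =>
    memLp_of_continuousOn (continuous_cpt hτ.continuous l).continuousOn
  have hd2 : ∀ l, MemLp (cpt (deriv τ) l) 2 torusMeasure := fun l =>
    (deriv_of_memSobolev hτ.continuous hτ.memSobolev l).1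
  have hF2 : ∀ l, MemLp (cpt (primitive f) l) 2 torusMeasure := fun l =>
    memLp_cpt (memLp_of_continuousOn (continuousOn_primitive
      (hf.1.integrable (by norm_num)))) l
  have hle : ∀ l x, ‖cpt τ l x‖ ≤ 1 := fun l x => (norm_cpt_le τ l x).trans (hτ.norm_eq_one x).le
  have hdτ2 : ∀ l, MemLp (fun x => cpt (deriv τ) l x * cpt τ i x) 2 torusMeasure := fun l =>
    (hd2 l).of_le ((hd2 l).1.mul (hτ2 i).1) (ae_of_all _ fun x => by
      rw [norm_mul]; exact mul_le_of_le_one_right (norm_nonneg _) (hle i x))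
  have hττ2 : ∀ l, MemLp (fun x => cpt τ l x * cpt τ i x) 2 torusMeasure := fun l =>
    memLp_of_continuousOn ((continuous_cpt hτ.continuous l).mul
      (continuous_cpt hτ.continuous i)).continuousOn
  have hLl : ∀ l, ‖((lam (primitive f) τ l : ℝ) : ℂ)‖ ≤ L := fun l => by
    rw [Complex.norm_real]; exact (PiLp.norm_apply_le _ _).trans hL
  have hd := fun l => decay_deriv hτ (by omega) l (h l)
  have d1 : ∀ l, Decay (p - 2) (2 ^ (p - 1) * rhoSum * B * B)
      fun x => cpt (deriv τ) l x * cpt τ i x := fun l => by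
    have := (hd l).mul (p - 2) (h i) (hd2 l) (hτ2 i) le_rfl (by omega) (by omega)
    rwa [show p - 2 + 1 = p - 1 by omega] at this
  have d2 : ∀ l, Decay (p - 3) (2 ^ (p - 2) * rhoSum * B * (2 ^ (p - 1) * rhoSum * B * B))
      fun x => cpt (deriv τ) l x * (cpt (deriv τ) l x * cpt τ i x) := fun l => by
    have := (hd l).mul (p - 3) (d1 l) (hd2 l) (hdτ2 l) (by omega) (by omega) (by omega)
    rwa [show p - 3 + 1 = p - 2 by omega] at this
  have d3 : ∀ l, Decay p (2 ^ (p + 1) * rhoSum * B * B) fun x => cpt τ l x * cpt τ i x := fun l =>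
    (h l).mul p (h i) (hτ2 l) (hτ2 i) le_rfl le_rfl (by omega)
  have d4 : ∀ l, Decay (p - 3) (2 ^ (p - 2) * rhoSum * F * (2 ^ (p + 1) * rhoSum * B * B))
      fun x => cpt (primitive f) l x * (cpt τ l x * cpt τ i x) := fun l => by
    have := (hF l).mul (p - 3) (d3 l) (hF2 l) (hττ2 l) le_rfl (by omega) (by omega)
    rwa [show p - 3 + 1 = p - 2 by omega] at this
  have d5 : ∀ l, Decay (p - 3) (L * (2 ^ (p + 1) * rhoSum * B * B))
      fun x => ((lam (primitive f) τ l : ℝ) : ℂ) * (cpt τ l x * cpt τ i x) := fun l =>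
    ((d3 l).const_mul _).mono (by omega) (mul_le_mul_of_nonneg_right (hLl l) (d3 l).nonneg)
  have i2 : ∀ l, Integrable (fun x => cpt (deriv τ) l x * (cpt (deriv τ) l x * cpt τ i x))
      torusMeasure := fun l => (hd2 l).integrable_mul (hdτ2 l)
  have i4 : ∀ l, Integrable (fun x => cpt (primitive f) l x * (cpt τ l x * cpt τ i x))
      torusMeasure := fun l => (hF2 l).integrable_mul (hττ2 l)
  have i5 : ∀ l, Integrable (fun x => ((lam (primitive f) τ l : ℝ) : ℂ)
      * (cpt τ l x * cpt τ i x)) torusMeasure := fun l =>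
    ((hττ2 l).integrable (by norm_num)).const_mul _
  have s2 := integrable_finsetSum Finset.univ fun l _ => i2 l
  have s4 := integrable_finsetSum Finset.univ fun l _ => i4 l
  have s5 := integrable_finsetSum Finset.univ fun l _ => i5 l
  have D2 := Decay.sum (s := Finset.univ) (fun l _ => d2 l) fun l _ => i2 l
  have D4 := Decay.sum (s := Finset.univ) (fun l _ => d4 l) fun l _ => i4 l
  have D5 := Decay.sum (s := Finset.univ) (fun l _ => d5 l) fun l _ => i5 l
  have hFi : Integrable (cpt (primitive f) i) torusMeasure := (hF2 i).integrable (by norm_num)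
  have D1 := (hF i).add (decay_const (p - 3) ((lam (primitive f) τ i : ℝ) : ℂ)) hFi
    (integrable_const _)
  have D := D1.add ((D2.sub D4 s2 s4).sub D5 (s2.sub s4) s5) (hFi.add (integrable_const _))
    ((s2.sub s4).sub s5)
  have heq : cpt (lowerOrder f τ) i = _ := funext (cpt_lowerOrder hτ i)
  rw [heq]
  refine D.mono le_rfl ?_
  simp only [Finset.sum_const, Finset.card_univ, Fintype.card_fin, nsmul_eq_mul, stepBound]
  have := hLl i
  push_cast
  linarith

/-- Bound for the Fourier coefficients of the primitive of the force in the bootstrap step. -/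
def forceStep (C : ℕ → ℝ → ℝ → ℝ) (p : ℕ) (B δ : ℝ) : ℝ :=
  2 ^ (p / 2 - 2 + 1) * supOn (C (p / 2 - 2)) δ √(3 * B ^ 2 * rhoSum)

lemma decay_lowerOrder (hK : IsC1Kernel K) (hC : ForceBound K C)
    (hCc : ∀ n, Continuous fun q : ℝ × ℝ => C n q.1 q.2) (hτ : TangentBound A δ H τ)
    (hf : IsNonlocalForce K (knot τ) f) {p : ℕ} {B : ℝ} (hp : 4 ≤ p)
    (h : ∀ i, Decay p B (cpt τ i)) (i : Fin 3) :
    Decay (p - 3) (stepBound p B (forceStep C p B δ) (lamBound C A δ H))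
      (cpt (lowerOrder f τ) i) := by
  refine decay_lowerOrder_aux hτ.toIsTangent hf hp h (fun l => ?_) (norm_lam_le hC hCc hτ hf) i
  -- With `n = p / 2 - 2`, decay of order `p` just suffices for `τ ∈ H^{n+1}`. The resulting order
  -- `2(n + 1)` of the primitive is at least `p - 3`, for both parities of `p`.
  obtain ⟨h1, h2⟩ := Decay.memSobolev (s := p / 2 - 2 + 1) hτ.memSobolev.1 h (by omega)
  refine (decay_primitive_force hK hC hτ.toIsTangent _ h1 hf l).mono (by omega) ?_
  rw [forceStep]
  gcongr
  exact le_supOn (hCc _) hτ.distortion_mem ⟨homSobolevNorm_nonneg _ _, h2⟩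

end Static

/-! ### Pointwise convergence of Fourier series and the Sobolev embedding -/

/-- A continuous periodic function is the sum of its Fourier series, if that series converges
absolutely. -/
lemma eq_tsum_of_summable {u : ℝ → ℂ} (hu : Continuous u) (hp : Function.Periodic u (2 * π))
    (hs : Summable fun k => ‖fc u k‖) (x : ℝ) : u x = ∑' k, fc u k * expI k x := by
  have hc := continuous_tsum_mul_expI hs
  have hae := ae_eq_of_fc (memLp_of_continuousOn hu.continuousOn)
    (memLp_of_continuousOn hc.continuousOn) fun k => (fc_tsum_mul_expI hs k).symm
  have heq : EqOn u (fun x => ∑' k, fc u k * expI k x) (Ioo (-π) π) :=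
    Measure.eqOn_open_of_ae_eq (μ := volume)
      (ae_restrict_of_ae_restrict_of_subset Ioo_subset_Ioc_self hae) isOpen_Ioo hu.continuousOn
      hc.continuousOn
  have heq' : EqOn u (fun x => ∑' k, fc u k * expI k x) (Icc (-π) π) := by
    have := heq.closure hu hc
    rwa [closure_Ioo (by linarith [Real.pi_pos])] at this
  have hp2 : Function.Periodic (fun x => ∑' k, fc u k * expI k x) (2 * π) := fun y => by
    simp only [(expI_periodic _) y]
  obtain ⟨y, hy, hxy⟩ := hp.exists_mem_Ico (by linarith [Real.pi_pos]) x (-π)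
  -- The difference of both sides is periodic, so its value at `x` is attained in the fundamental
  -- interval, where it vanishes.
  obtain ⟨z, hz, hxz⟩ := (hp.sub hp2).exists_mem_Ico (by linarith [Real.pi_pos]) x (-π)
  have h0 : u z - ∑' k, fc u k * expI k z = 0 :=
    sub_eq_zero.2 (heq' ⟨hz.1, by linarith [hz.2]⟩)
  have h1 : u x - ∑' k, fc u k * expI k x = 0 := hxz.trans h0
  exact sub_eq_zero.1 h1

/-- The weight of the `H¹` norm. -/
def sobolevWeight (k : ℤ) : ℝ := if k = 0 then 1 else |(k : ℝ)|

lemma rho_sq_le_sobolevWeight (k : ℤ) : rho k ^ 2 ≤ 2 * sobolevWeight k := by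
  rw [rho_sq, sobolevWeight]
  split_ifs with h
  · subst h; simp
  · have : (1 : ℝ) ≤ |(k : ℝ)| := by exact_mod_cast Int.one_le_abs h
    linarith

lemma sobolevWeight_nonneg (k : ℤ) : 0 ≤ sobolevWeight k := by
  rw [sobolevWeight]; split_ifs <;> positivity

lemma hasSum_sobolevNorm_sq {u : ℝ → R3} (hu : MemSobolev 1 u) :
    HasSum (fun k => (sobolevWeight k * ‖fourierVec u k‖) ^ 2) (sobolevNorm 1 u ^ 2) := by
  rw [sobolevNorm, Real.sq_sqrt (by positivity), homSobolevNorm,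
    Real.sq_sqrt (tsum_nonneg fun k => by positivity)]
  convert! (hasSum_ite_eq (0 : ℤ) (‖fourierVec u 0‖ ^ 2)).add hu.2.hasSum using 2 with k
  rw [sobolevWeight]
  split_ifs with h
  · subst h; simp
  · simp [mul_pow]

lemma fourierVec_sub {u v : ℝ → R3} (hu : Integrable u torusMeasure)
    (hv : Integrable v torusMeasure) (k : ℤ) :
    fourierVec (fun x => u x - v x) k = fourierVec u k - fourierVec v k := by
  ext i
  rw [PiLp.sub_apply, fourierVec_cpt, fourierVec_cpt, fourierVec_cpt,
    ← fc_sub (integrable_cpt hu i) (integrable_cpt hv i)]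
  congr 1
  ext x; simp [cpt]

lemma MemSobolev.sub {s : ℕ} {u v : ℝ → R3} (hu : MemSobolev s u) (hv : MemSobolev s v) :
    MemSobolev s fun x => u x - v x := by
  refine ⟨hu.1.sub hv.1, .of_nonneg_of_le (fun k => by positivity) (fun k => ?_)
    ((hu.2.mul_left 2).add (hv.2.mul_left 2))⟩
  rw [fourierVec_sub (hu.1.integrable (by norm_num)) (hv.1.integrable (by norm_num))]
  have h1 : ‖fourierVec u k - fourierVec v k‖ ^ 2
      ≤ 2 * ‖fourierVec u k‖ ^ 2 + 2 * ‖fourierVec v k‖ ^ 2 := by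
    have := pow_le_pow_left₀ (norm_nonneg _) (norm_sub_le (fourierVec u k) (fourierVec v k)) 2
    nlinarith [sq_nonneg (‖fourierVec u k‖ - ‖fourierVec v k‖)]
  calc _ ≤ |(k : ℝ)| ^ (2 * s) * (2 * ‖fourierVec u k‖ ^ 2 + 2 * ‖fourierVec v k‖ ^ 2) := by gcongr
    _ = _ := by ring

/-- The triangle inequality for the `H¹` norm. -/
lemma abs_sobolevNorm_sub_le {u v : ℝ → R3} (hu : MemSobolev 1 u) (hv : MemSobolev 1 v) :
    |sobolevNorm 1 u - sobolevNorm 1 v| ≤ sobolevNorm 1 fun x => u x - v x := by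
  -- The weighted coefficient sequence embeds `H¹` isometrically into `ℓ²`, whose triangle
  -- inequality is then used.
  have key : ∀ {w : ℝ → R3}, MemSobolev 1 w →
      Memℓp (fun k => (sobolevWeight k : ℂ) • fourierVec w k) 2 ∧
      ∀ a : lp (fun _ : ℤ => EuclideanSpace ℂ (Fin 3)) 2,
        (∀ k, a k = (sobolevWeight k : ℂ) • fourierVec w k) → ‖a‖ = sobolevNorm 1 w := by
    intro w hw
    have hn : ∀ k, ‖(sobolevWeight k : ℂ) • fourierVec w k‖ ^ 2
        = (sobolevWeight k * ‖fourierVec w k‖) ^ 2 := fun k => by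
      rw [norm_smul, Complex.norm_real, Real.norm_of_nonneg (sobolevWeight_nonneg k)]
    have hs := hasSum_sobolevNorm_sq hw
    simp only [← hn] at hs
    refine ⟨memℓp_gen (by simpa using hs.summable), fun a ha => ?_⟩
    have h1 := lp.norm_rpow_eq_tsum (p := 2) (by norm_num) a
    simp only [ENNReal.toReal_ofNat, Real.rpow_ofNat, ha] at h1
    rw [hs.tsum_eq] at h1
    exact (pow_left_inj₀ (norm_nonneg _) (Real.sqrt_nonneg _) two_ne_zero).1 h1
  obtain ⟨m1, n1⟩ := key hu
  obtain ⟨m2, n2⟩ := key hv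
  let a : lp (fun _ : ℤ => EuclideanSpace ℂ (Fin 3)) 2 := ⟨_, m1⟩
  let b : lp (fun _ : ℤ => EuclideanSpace ℂ (Fin 3)) 2 := ⟨_, m2⟩
  rw [← n1 a fun k => rfl, ← n2 b fun k => rfl, ← (key (hu.sub hv)).2 (a - b) fun k => ?_]
  · exact abs_norm_sub_norm_le a b
  · rw [fourierVec_sub (hu.1.integrable (by norm_num)) (hv.1.integrable (by norm_num)), smul_sub]
    rfl

/-- The Sobolev embedding of `H¹` into the continuous functions. -/
lemma exists_norm_le_sobolevNorm : ∃ c : ℝ, 0 ≤ c ∧ ∀ u : ℝ → R3, Continuous u →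
    Function.Periodic u (2 * π) → MemSobolev 1 u → ∀ x, ‖u x‖ ≤ c * sobolevNorm 1 u := by
  have hS : Summable fun k => ((rho k ^ 2)⁻¹) ^ 2 := by
    refine .of_nonneg_of_le (fun k => by positivity) (fun k => ?_) summable_inv_rho_cube
    rw [← inv_pow, ← pow_mul]
    exact pow_le_pow_of_le_one (inv_nonneg.2 (rho_pos k).le)
      (inv_le_one_of_one_le₀ (one_le_rho k)) (by norm_num)
  refine ⟨3 * (√(∑' k, ((rho k ^ 2)⁻¹) ^ 2) * 2), by positivity, fun u hc hp hu x => ?_⟩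
  have hw := hasSum_sobolevNorm_sq hu
  have hg : Summable fun k => (rho k ^ 2 * ‖fourierVec u k‖) ^ 2 := by
    refine .of_nonneg_of_le (fun k => by positivity) (fun k => ?_) (hw.summable.mul_left 4)
    rw [show (4 : ℝ) = 2 ^ 2 by norm_num, ← mul_pow, ← mul_assoc]
    have := rho_sq_le_sobolevWeight k
    gcongr
  have hgle : ∑' k, (rho k ^ 2 * ‖fourierVec u k‖) ^ 2 ≤ (2 * sobolevNorm 1 u) ^ 2 := by
    rw [mul_pow, ← hw.tsum_eq, ← tsum_mul_left]
    refine hg.tsum_le_tsum (fun k => ?_) (hw.summable.mul_left _)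
    rw [← mul_pow, ← mul_assoc]
    have := rho_sq_le_sobolevWeight k
    gcongr
  have hmul : ∀ k, (rho k ^ 2)⁻¹ * (rho k ^ 2 * ‖fourierVec u k‖) = ‖fourierVec u k‖ := fun k => by
    have := rho_pos k
    field_simp
  -- Cauchy–Schwarz for the splitting of a coefficient into `rho⁻²` and `rho²` times it gives an
  -- absolutely convergent Fourier series.
  obtain ⟨h1, h2⟩ := Real.summable_and_inner_le_Lp_mul_Lq_tsum_of_nonneg Real.HolderConjugate.two_two
    (f := fun k => (rho k ^ 2)⁻¹) (g := fun k => rho k ^ 2 * ‖fourierVec u k‖)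
    (fun k => by positivity) (fun k => by positivity) (by simpa using hS) (by simpa using hg)
  simp only [hmul, Real.rpow_ofNat, ← Real.sqrt_eq_rpow] at h1 h2
  have h3 : ∑' k, ‖fourierVec u k‖ ≤ √(∑' k, ((rho k ^ 2)⁻¹) ^ 2) * (2 * sobolevNorm 1 u) := by
    refine h2.trans (mul_le_mul_of_nonneg_left ?_ (Real.sqrt_nonneg _))
    exact Real.sqrt_le_iff.2 ⟨mul_nonneg zero_le_two (Real.sqrt_nonneg _), hgle⟩
  have h4 : ∀ i, ‖cpt u i x‖ ≤ ∑' k, ‖fourierVec u k‖ := by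
    intro i
    have hs : Summable fun k => ‖fc (cpt u i) k‖ :=
      .of_nonneg_of_le (fun k => norm_nonneg _) (fun k => norm_fc_cpt_le u k i) h1
    rw [eq_tsum_of_summable (continuous_cpt hc i) (fun y => by simp only [cpt, hp y]) hs x]
    refine tsum_of_norm_bounded h1.hasSum fun k => ?_
    rw [norm_mul, norm_expI, mul_one]; exact norm_fc_cpt_le u k i
  have h5 : ‖u x‖ ≤ ∑ i, ‖cpt u i x‖ := by
    refine abs_le_of_sq_le_sq' ?_ (Finset.sum_nonneg fun i _ => norm_nonneg _) |>.2
    rw [norm_sq_eq_sum_cpt]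
    exact Finset.sum_sq_le_sq_sum_of_nonneg fun i _ => norm_nonneg _
  have h6 := h5.trans (Finset.sum_le_sum fun i _ => h4 i)
  simp only [Finset.sum_const, Finset.card_univ, Fintype.card_fin, nsmul_eq_mul] at h6
  push_cast at h6
  linarith

/-! ### The constraint matrix -/

lemma constraintMatrix_apply {τ : ℝ → R3} (h1 : ∀ x, ‖τ x‖ = 1) (i j : Fin 3) :
    constraintMatrix τ i j = (1 : Matrix (Fin 3) (Fin 3) ℝ) i j - mean fun x => τ x i * τ x j := by
  simp [constraintMatrix, h1]

/-- The right side is the mean Cauchy–Schwarz deficit of `τ(x)` and `v`. A kernel vector of `A_τ`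
therefore forces equality at almost every `x`. -/
lemma dotProduct_constraintMatrix {τ : ℝ → R3} (hc : Continuous τ) (h1 : ∀ x, ‖τ x‖ = 1)
    (v : R3) : (∑ i, v i * ∑ j, constraintMatrix τ i j * v j)
      = mean fun x => ‖v‖ ^ 2 - (inner ℝ (τ x) v) ^ 2 := by
  have hij : ∀ i j, Integrable (fun x => v i * v j * (τ x i * τ x j)) torusMeasure := fun i j =>
    integrable_of_continuous (by fun_prop)
  have e1 : ∀ x, (inner ℝ (τ x) v) ^ 2 = ∑ i, ∑ j, v i * v j * (τ x i * τ x j) := by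
    intro x
    rw [PiLp.inner_apply, sq, Finset.sum_mul_sum]
    refine Finset.sum_congr rfl fun i _ => Finset.sum_congr rfl fun j _ => ?_
    simp only [RCLike.inner_apply, conj_trivial]; ring
  have e2 : (mean fun x => ‖v‖ ^ 2 - (inner ℝ (τ x) v) ^ 2)
      = ‖v‖ ^ 2 - ∑ i, ∑ j, v i * v j * mean fun x => τ x i * τ x j := by
    have h4 : mean (fun _ : ℝ => ‖v‖ ^ 2) = ‖v‖ ^ 2 := mean_const _
    nth_rewrite 2 [← h4]
    simp only [mean_eq_torus, e1, smul_eq_mul]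
    rw [integral_sub (integrable_const _)
      (integrable_finsetSum _ fun i _ => integrable_finsetSum _ fun j _ => hij i j),
      integral_finsetSum _ fun i _ => integrable_finsetSum _ fun j _ => hij i j, mul_sub]
    congr 1
    rw [Finset.mul_sum]
    refine Finset.sum_congr rfl fun i _ => ?_
    rw [integral_finsetSum _ fun j _ => hij i j, Finset.mul_sum]
    refine Finset.sum_congr rfl fun j _ => ?_
    rw [integral_const_mul]; ring
  rw [e2, EuclideanSpace.norm_sq_eq]
  simp only [constraintMatrix_apply h1, sub_mul, Finset.sum_sub_distrib, mul_sub, Matrix.one_apply,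
    ite_mul, one_mul, zero_mul, Finset.sum_ite_eq, Finset.mem_univ, if_true, Finset.mul_sum]
  congr 1
  · refine Finset.sum_congr rfl fun i _ => by rw [Real.norm_eq_abs, sq_abs, sq]
  · exact Finset.sum_congr rfl fun i _ => Finset.sum_congr rfl fun j _ => by ring

/-- The constraint matrix of a closed unit tangent field is invertible. -/
lemma isUnit_constraintMatrix {τ : ℝ → R3} (hc : Continuous τ) (h0 : mean τ = 0)
    (h1 : ∀ x, ‖τ x‖ = 1) : IsUnit (constraintMatrix τ) := by
  have hpi := Real.pi_pos
  rw [← Matrix.mulVec_injective_iff_isUnit]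
  refine (injective_iff_map_eq_zero (constraintMatrix τ).mulVecLin).2 fun w hw => ?_
  set v : R3 := WithLp.toLp 2 w with hv
  have hvw : ∀ i, v i = w i := fun i => rfl
  by_contra hne
  have hv0 : v ≠ 0 := fun h => hne (by ext i; rw [← hvw, h]; rfl)
  have e1 := dotProduct_constraintMatrix hc h1 v
  have e2 : ∀ i, ∑ j, constraintMatrix τ i j * v j = 0 := fun i => congrFun hw i
  simp only [e2, mul_zero, Finset.sum_const_zero] at e1
  have hcs : Continuous fun x => (inner ℝ (τ x) v : ℝ) := hc.inner continuous_const
  have hnn : ∀ x, 0 ≤ ‖v‖ ^ 2 - (inner ℝ (τ x) v : ℝ) ^ 2 := fun x => by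
    have := abs_real_inner_le_norm (τ x) v
    rw [h1, one_mul] at this
    have := sq_le_sq.2 (this.trans (le_abs_self ‖v‖))
    linarith
  have e3 : ∫ x, (‖v‖ ^ 2 - (inner ℝ (τ x) v : ℝ) ^ 2) ∂torusMeasure = 0 := by
    rw [mean_eq_torus] at e1
    exact (smul_eq_zero.1 e1.symm).resolve_left (by positivity)
  have hcont : Continuous fun x => ‖v‖ ^ 2 - (inner ℝ (τ x) v : ℝ) ^ 2 :=
    continuous_const.sub (hcs.pow 2)
  rw [integral_eq_zero_iff_of_nonneg hnn (integrable_of_continuous hcont)] at e3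
  have heq : EqOn (fun x => ‖v‖ ^ 2 - (inner ℝ (τ x) v : ℝ) ^ 2) 0 (Ioo (-π) π) :=
    Measure.eqOn_open_of_ae_eq (μ := volume)
      (ae_restrict_of_ae_restrict_of_subset Ioo_subset_Ioc_self e3) isOpen_Ioo hcont.continuousOn
      continuousOn_const
  have hsq : EqOn ((fun x => (inner ℝ (τ x) v : ℝ)) ^ 2) ((fun _ => ‖v‖) ^ 2) (Ioo (-π) π) :=
    fun x hx => (sub_eq_zero.1 (heq hx)).symm
  have hint : ∫ x, (inner ℝ (τ x) v : ℝ) ∂torusMeasure = 0 := by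
    have h2 := (innerSL ℝ v).integral_comp_comm (integrable_of_continuous hc)
    rw [integral_torus_eq_zero h0, map_zero] at h2
    rw [← h2]
    exact integral_congr_ae (ae_of_all _ fun x => real_inner_comm _ _)
  -- By continuity and connectedness, `⟨τ, v⟩ = ±‖v‖` has a constant sign on the interval. A nonzero
  -- constant is incompatible with `τ` having mean zero.
  have key : ∀ c : ℝ, c ≠ 0 → ¬EqOn (fun x => (inner ℝ (τ x) v : ℝ)) (fun _ => c) (Ioo (-π) π) := by
    intro c hc0 hE
    have h2 : ∫ x, (inner ℝ (τ x) v : ℝ) ∂torusMeasure = ∫ _, c ∂torusMeasure := by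
      rw [torusMeasure, ← restrict_Ioo_eq_restrict_Ioc]
      exact setIntegral_congr_fun measurableSet_Ioo hE
    rw [hint, integral_const, torusMeasure_real_univ, smul_eq_mul] at h2
    rcases mul_eq_zero.1 h2.symm with h | h
    · linarith
    · exact hc0 h
  have hvn : ‖v‖ ≠ 0 := norm_ne_zero_iff.2 hv0
  rcases isPreconnected_Ioo.eq_or_eq_neg_of_sq_eq hcs.continuousOn continuousOn_const hsq
    (fun _ => hvn) with h | h
  · exact key _ hvn h
  · exact key _ (neg_ne_zero.2 hvn) h

/-- The entries of `A_τ` are continuous in time by dominated convergence, and Cramer's rule with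
nonvanishing determinant passes this on to the inverse. -/
lemma continuousOn_invNorm {s : Set ℝ} {τ : ℝ → ℝ → R3} (hc : ∀ t ∈ s, Continuous (τ t))
    (h0 : ∀ t ∈ s, mean (τ t) = 0) (h1 : ∀ t ∈ s, ∀ x, ‖τ t x‖ = 1)
    (hcont : ∀ x, ContinuousOn (fun t => τ t x) s) :
    ContinuousOn (fun t => invNorm (τ t)) s := by
  have hA : ContinuousOn (fun t => constraintMatrix (τ t)) s := by
    refine continuousOn_pi.2 fun i => continuousOn_pi.2 fun j => ?_
    have hm : ContinuousOn (fun t => mean fun x => τ t x i * τ t x j) s := by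
      intro t₀ ht₀
      have hd : Tendsto (fun t => ∫ x in (-π)..π, τ t x i * τ t x j) (𝓝[s] t₀)
          (𝓝 (∫ x in (-π)..π, τ t₀ x i * τ t₀ x j)) := by
        refine intervalIntegral.tendsto_integral_filter_of_dominated_convergence (fun _ => 1)
          ?_ ?_ intervalIntegrable_const ?_
        · filter_upwards [self_mem_nhdsWithin] with t ht
          have := hc t ht
          exact Continuous.aestronglyMeasurable (by fun_prop)
        · filter_upwards [self_mem_nhdsWithin] with t ht
          refine ae_of_all _ fun x _ => ?_
          rw [norm_mul]
          have h2 := fun i => (PiLp.norm_apply_le (τ t x) i).trans (h1 t ht x).le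
          exact mul_le_one₀ (h2 i) (norm_nonneg _) (h2 j)
        · refine ae_of_all _ fun x _ => ?_
          have h2 := fun i => ((by fun_prop : Continuous fun v : R3 => v i).tendsto _).comp
            (hcont x t₀ ht₀)
          exact (h2 i).mul (h2 j)
      exact hd.const_smul ((2 * π)⁻¹)
    exact (continuousOn_const (c := (1 : Matrix (Fin 3) (Fin 3) ℝ) i j)).sub hm |>.congr
      fun t ht => constraintMatrix_apply (h1 t ht) i j
  have hinv : ContinuousOn (fun t => (constraintMatrix (τ t))⁻¹) s := by
    have h2 : ContinuousOn (fun t => (constraintMatrix (τ t)).det) s :=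
      (continuous_id.matrix_det).comp_continuousOn hA
    have h3 : ContinuousOn (fun t => (constraintMatrix (τ t)).adjugate) s :=
      (continuous_id.matrix_adjugate).comp_continuousOn hA
    have h4 : ContinuousOn (fun t => ((constraintMatrix (τ t)).det)⁻¹ •
        (constraintMatrix (τ t)).adjugate) s := by
      refine ContinuousOn.smul (h2.inv₀ fun t ht => ?_) h3
      exact ((Matrix.isUnit_iff_isUnit_det _).1
        (isUnit_constraintMatrix (hc t ht) (h0 t ht) (h1 t ht))).ne_zero
    refine h4.congr fun t _ => ?_
    simp only [Matrix.inv_def, Ring.inverse_eq_inv']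
  have hL : Continuous fun M : Matrix (Fin 3) (Fin 3) ℝ =>
      Matrix.toEuclideanCLM (n := Fin 3) (𝕜 := ℝ) M :=
    LinearMap.continuous_of_finiteDimensional
      ((Matrix.toEuclideanCLM (n := Fin 3) (𝕜 := ℝ)).toAlgEquiv.toLinearMap)
  exact (hL.comp_continuousOn hinv).norm

/-! ### The distortion -/

lemma theta_le_distortion_mul {γ : ℝ → R3} (hγ : IsBiLipschitz γ) (x y : ℝ) :
    theta (x - y) ≤ (distortion γ).toReal * ‖γ x - γ y‖ := by
  obtain ⟨l, hl, h⟩ := hγ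
  have hpos : ∀ x y, 0 < theta (x - y) → 0 < ‖γ x - γ y‖ := fun x y hxy =>
    (mul_pos (inv_pos.2 hl) hxy).trans_le (h x y).1
  -- `toReal` sends `⊤` to `0`, so the inequality would fail for infinite distortion; the
  -- bi-Lipschitz constant excludes it.
  have hfin : distortion γ ≠ ⊤ := by
    refine ne_top_of_le_ne_top (ENNReal.ofReal_ne_top (r := l)) ?_
    refine iSup_le fun x => iSup_le fun y => iSup_le fun hxy => ?_
    rw [← ENNReal.ofReal_div_of_pos (hpos x y hxy)]
    refine ENNReal.ofReal_le_ofReal ?_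
    rw [div_le_iff₀ (hpos x y hxy)]
    have := (h x y).1
    rwa [inv_mul_le_iff₀ hl] at this
  rcases (theta_nonneg (x - y)).eq_or_lt with h0 | h0
  · rw [← h0]; positivity
  have h1 : ENNReal.ofReal (theta (x - y)) / ENNReal.ofReal ‖γ x - γ y‖ ≤ distortion γ :=
    le_iSup_of_le x (le_iSup_of_le y (le_iSup_of_le h0 le_rfl))
  rw [← ENNReal.ofReal_div_of_pos (hpos x y h0), ENNReal.ofReal_le_iff_le_toReal hfin,
    div_le_iff₀ (hpos x y h0)] at h1
  exact h1

lemma distortion_toReal_le {γ : ℝ → R3} {d : ℝ} (hd : 0 ≤ d)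
    (h : ∀ x y, theta (x - y) ≤ d * ‖γ x - γ y‖) : (distortion γ).toReal ≤ d := by
  refine ENNReal.toReal_le_of_le_ofReal hd ?_
  refine iSup_le fun x => iSup_le fun y => iSup_le fun hxy => ?_
  have hpos : 0 < ‖γ x - γ y‖ := by
    by_contra hn
    have h0 := h x y
    rw [le_antisymm (not_lt.1 hn) (norm_nonneg _), mul_zero] at h0
    linarith
  rw [← ENNReal.ofReal_div_of_pos hpos]
  exact ENNReal.ofReal_le_ofReal ((div_le_iff₀ hpos).2 (h x y))

lemma knot_sub_knot {τ : ℝ → R3} (hc : Continuous τ) (x y : ℝ) :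
    knot τ x - knot τ y = ∫ z in y..x, τ z := by
  rw [knot, primitive, primitive, add_sub_add_left_eq_sub,
    intervalIntegral.integral_interval_sub_left (hc.intervalIntegrable _ _)
      (hc.intervalIntegrable _ _)]

lemma norm_knot_sub_le {τ σ : ℝ → R3} (hτ : IsTangent τ) (hσ : IsTangent σ) {η : ℝ}
    (h : ∀ x, ‖τ x - σ x‖ ≤ η) (x y : ℝ) :
    ‖(knot τ x - knot τ y) - (knot σ x - knot σ y)‖ ≤ η * theta (x - y) := by
  -- Moving `y` by `m` periods makes the distance from `x` to `y` equal to the geodesic one, so the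
  -- integral of `τ - σ` runs over an interval of length `theta (x - y)`.
  set m : ℤ := round ((2 * π)⁻¹ * (x - y)) with hm
  have hp : ∀ {u : ℝ → R3}, IsTangent u → knot u y = knot u (y + m * (2 * π)) := fun hu =>
    ((periodic_primitive hu.continuous hu.periodic hu.mean_eq_zero).int_mul m y).symm
  rw [hp hτ, hp hσ, knot_sub_knot hτ.continuous, knot_sub_knot hσ.continuous,
    ← intervalIntegral.integral_sub (hτ.continuous.intervalIntegrable _ _)
      (hσ.continuous.intervalIntegrable _ _)]
  refine (intervalIntegral.norm_integral_le_of_norm_le_const fun z _ => h z).trans (le_of_eq ?_)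
  rw [theta, AddCircle.norm_eq, ← hm]
  congr 2; ring

/-- A uniform perturbation of `τ` by `η` shortens chords by at most `η` times the arc length, so the
reciprocal of the distortion drops by at most `η`. Upper semicontinuity is all that attaining a
maximum requires. -/
lemma upperSemicontinuousOn_distortion {s : Set ℝ} {τ : ℝ → ℝ → R3}
    (hτ : ∀ t ∈ s, IsTangent (τ t))
    (hcont : ∀ t₀ ∈ s, ∀ η > 0, ∀ᶠ t in 𝓝[s] t₀, ∀ x, ‖τ t x - τ t₀ x‖ ≤ η) :
    UpperSemicontinuousOn (fun t => (distortion (knot (τ t))).toReal) s := by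
  intro t₀ ht₀ c hc
  obtain ⟨d, hd1, hd2⟩ := exists_between hc
  have hd0 : 0 < d := ENNReal.toReal_nonneg.trans_lt hd1
  obtain ⟨e, he1, he2⟩ := exists_between hd2
  have he0 : 0 < e := hd0.trans he1
  -- This tolerance degrades the chord-arc constant from `d` at `t₀` exactly to `e` at `t`.
  set η : ℝ := d⁻¹ - e⁻¹ with hη
  have hη0 : 0 < η := sub_pos.2 ((inv_lt_inv₀ he0 hd0).2 he1)
  filter_upwards [hcont t₀ ht₀ η hη0, self_mem_nhdsWithin] with t ht hts
  refine (distortion_toReal_le he0.le fun x y => ?_).trans_lt he2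
  have h1 := theta_le_distortion_mul (hτ t₀ ht₀).biLipschitz x y
  have h2 := norm_knot_sub_le (hτ t hts) (hτ t₀ ht₀) ht x y
  have h3 : ‖knot (τ t₀) x - knot (τ t₀) y‖
      ≤ ‖knot (τ t) x - knot (τ t) y‖ + η * theta (x - y) := by
    have := norm_sub_norm_le (knot (τ t₀) x - knot (τ t₀) y) (knot (τ t) x - knot (τ t) y)
    rw [norm_sub_rev (knot (τ t₀) x - knot (τ t₀) y)] at this
    linarith
  have h4 : theta (x - y) ≤ d * (‖knot (τ t) x - knot (τ t) y‖ + η * theta (x - y)) :=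
    h1.trans (mul_le_mul hd1.le h3 (norm_nonneg _) hd0.le)
  have h5 : d⁻¹ * theta (x - y) ≤ ‖knot (τ t) x - knot (τ t) y‖ + η * theta (x - y) := by
    rwa [inv_mul_le_iff₀ hd0]
  have h6 : e⁻¹ * theta (x - y) ≤ ‖knot (τ t) x - knot (τ t) y‖ := by
    rw [hη, sub_mul] at h5; linarith
  rwa [inv_mul_le_iff₀ he0] at h6

lemma exists_isGreatest_of_isMaxOn {s : Set ℝ} {f : ℝ → ℝ} (h : ∃ t ∈ s, IsMaxOn f s t) :
    ∃ a, IsGreatest (f '' s) a := by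
  obtain ⟨t, ht, hmax⟩ := h
  exact ⟨f t, ⟨t, ht, rfl⟩, by rintro _ ⟨u, hu, rfl⟩; exact hmax hu⟩

/-- The three maxima over the life span of a solution are attained. -/
lemma exists_isGreatest {K : ℝ → ℝ → ℝ} {T : ℝ} (hT : 0 < T) {τ : ℝ → ℝ → R3}
    (hτ : IsMildSolution K T τ) (ht : ∀ t ∈ Icc 0 T, IsTangent (τ t)) :
    (∃ A, IsGreatest ((fun t => invNorm (τ t)) '' Icc 0 T) A) ∧
    (∃ δ, IsGreatest ((fun t => (distortion (knot (τ t))).toReal) '' Icc 0 T) δ) ∧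
    ∃ H, IsGreatest ((fun t => sobolevNorm 1 (τ t)) '' Icc 0 T) H := by
  have hne : (Icc 0 T).Nonempty := ⟨0, le_rfl, hT.le⟩
  obtain ⟨c, hc0, hc⟩ := exists_norm_le_sobolevNorm
  have hbound : ∀ t ∈ Icc 0 T, ∀ t₀ ∈ Icc 0 T, ∀ x,
      ‖τ t x - τ t₀ x‖ ≤ c * sobolevNorm 1 fun x => τ t x - τ t₀ x := fun t h1 t₀ h0 x =>
    hc _ ((hτ.continuous t h1).sub (hτ.continuous t₀ h0))
      ((hτ.periodic t h1).sub (hτ.periodic t₀ h0))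
      ((hτ.memSobolev t h1).sub (hτ.memSobolev t₀ h0)) x
  have hlim : ∀ t₀ ∈ Icc 0 T, Tendsto (fun t => c * sobolevNorm 1 fun x => τ t x - τ t₀ x)
      (𝓝[Icc 0 T] t₀) (𝓝 0) := fun t₀ h0 => by
    simpa using (hτ.continuous_time t₀ h0).const_mul c
  have hunif : ∀ t₀ ∈ Icc 0 T, ∀ η > 0, ∀ᶠ t in 𝓝[Icc 0 T] t₀, ∀ x, ‖τ t x - τ t₀ x‖ ≤ η := by
    intro t₀ h0 η hη
    filter_upwards [(hlim t₀ h0).eventually_le_const hη, self_mem_nhdsWithin] with t h1 h2 x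
    exact (hbound t h2 t₀ h0 x).trans h1
  refine ⟨exists_isGreatest_of_isMaxOn (isCompact_Icc.exists_isMaxOn hne ?_),
    exists_isGreatest_of_isMaxOn (UpperSemicontinuousOn.exists_isMaxOn hne isCompact_Icc
      (upperSemicontinuousOn_distortion ht hunif)),
    exists_isGreatest_of_isMaxOn (isCompact_Icc.exists_isMaxOn hne ?_)⟩
  · refine continuousOn_invNorm hτ.continuous (fun t h => (ht t h).mean_eq_zero)
      (fun t h => (ht t h).norm_eq_one) fun x t₀ h0 => ?_
    rw [ContinuousWithinAt, tendsto_iff_norm_sub_tendsto_zero]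
    refine squeeze_zero' (Eventually.of_forall fun _ => norm_nonneg _) ?_ (hlim t₀ h0)
    filter_upwards [self_mem_nhdsWithin] with t h1 using hbound t h1 t₀ h0 x
  · intro t₀ h0
    rw [ContinuousWithinAt, tendsto_iff_norm_sub_tendsto_zero]
    refine squeeze_zero' (Eventually.of_forall fun _ => norm_nonneg _) ?_
      (hτ.continuous_time t₀ h0)
    filter_upwards [self_mem_nhdsWithin] with t h1
    exact abs_sobolevNorm_sub_le (hτ.memSobolev t h1) (hτ.memSobolev t₀ h0)

/-! ### The bootstrap -/

/-- From `x^m / m! ≤ e^x` at `x = k² r`, together with `rho k ≤ 2k²` for `k ≠ 0`. It bounds the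
contribution of the restart time, to any order. -/
lemma rho_pow_mul_heatFactor_le {r : ℝ} (hr : 0 < r) (m : ℕ) {k : ℤ} (hk : k ≠ 0) :
    rho k ^ m * heatFactor r k ≤ 2 ^ m * (m.factorial / r ^ m) := by
  have hk1 : (1 : ℝ) ≤ |(k : ℝ)| := by exact_mod_cast Int.one_le_abs hk
  have h1 : rho k ^ m ≤ 2 ^ m * ((k : ℝ) ^ 2) ^ m := by
    rw [← mul_pow]
    refine pow_le_pow_left₀ (rho_pos k).le ?_ m
    have h2 : rho k ≤ rho k ^ 2 := le_self_pow₀ (one_le_rho k) two_ne_zero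
    rw [rho_sq] at h2
    nlinarith [sq_abs (k : ℝ)]
  have h3 := Real.pow_div_factorial_le_exp ((k : ℝ) ^ 2 * r) (by positivity) m
  rw [div_le_iff₀ (by positivity), mul_pow] at h3
  have h4 : ((k : ℝ) ^ 2) ^ m * heatFactor r k ≤ m.factorial / r ^ m := by
    rw [heatFactor, neg_mul, Real.exp_neg, ← div_eq_mul_inv, div_le_div_iff₀ (Real.exp_pos _)
      (by positivity), mul_comm (m.factorial : ℝ)]
    exact h3
  calc _ ≤ 2 ^ m * ((k : ℝ) ^ 2) ^ m * heatFactor r k :=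
        mul_le_mul_of_nonneg_right h1 (heatFactor_pos r k).le
    _ ≤ _ := by rw [mul_assoc]; gcongr

lemma IsTangent.fc_zero {τ : ℝ → R3} (hτ : IsTangent τ) (i : Fin 3) : fc (cpt τ i) 0 = 0 := by
  rw [fc_zero_eq, integral_cpt _ (integrable_of_continuous hτ.continuous),
    integral_torus_eq_zero hτ.mean_eq_zero]
  simp

lemma IsTangent.norm_fc_le_one {τ : ℝ → R3} (hτ : IsTangent τ) (i : Fin 3) (k : ℤ) :
    ‖fc (cpt τ i) k‖ ≤ 1 := by
  refine (norm_fc_cpt_le_mean (integrable_of_continuous hτ.continuous) i k).trans ?_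
  simp only [hτ.norm_eq_one]
  exact (mean_const (1 : ℝ)).le

/-- Parabolic smoothing gains two derivatives over the right hand side. -/
lemma IsDuhamel.decay {T M : ℝ} {τ G : ℝ → ℝ → R3} (hd : IsDuhamel T M τ G)
    (hτ : ∀ t ∈ Icc 0 T, IsTangent (τ t)) {ε N : ℝ} (hε : 0 < ε) {q : ℕ}
    (hG : ∀ s ∈ Icc (ε / 2) T, ∀ i, Decay q N (cpt (G s) i)) {t : ℝ} (ht : t ∈ Icc ε T)
    (i : Fin 3) :
    Decay (q + 4) (4 * (2 ^ (q + 4) * ((q + 4).factorial / (ε / 2) ^ (q + 4)) + N))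
      (cpt (τ t) i) := by
  have hN : 0 ≤ N := (hG t ⟨by linarith [ht.1], ht.2⟩ i).nonneg
  intro k
  rcases eq_or_ne k 0 with rfl | hk
  · rw [(hτ t ⟨hε.le.trans ht.1, ht.2⟩).fc_zero, norm_zero, mul_zero]; positivity
  have hk1 : (1 : ℝ) ≤ |(k : ℝ)| := by exact_mod_cast Int.one_le_abs hk
  have hrho := rho_pos k
  have hr0 : 0 ≤ t - ε / 2 := by linarith [ht.1]
  -- Restarting at `t - ε / 2` keeps all times `s` in `[ε / 2, T]`, where the decay of `G` is known,
  -- and leaves a time `ε / 2` for the heat factor to act.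
  have h1 := hd.norm_fc_le hr0 (by linarith) ht.2 i hk (N := N * (rho k ^ q)⁻¹)
    fun s hs => (hG s ⟨by linarith [hs.1, ht.1], hs.2.trans ht.2⟩ i).norm_le k
  rw [show t - (t - ε / 2) = ε / 2 by ring] at h1
  have h2 := (hτ (t - ε / 2) ⟨hr0, by linarith [ht.2]⟩).norm_fc_le_one i k
  have h3 : (k : ℝ) ^ 2 ≤ rho k ^ 4 := by
    rw [show 4 = 2 * 2 by norm_num, pow_mul, rho_sq, ← sq_abs]; gcongr; linarith
  -- The gain of `k²` is worth four powers of `rho`; the factor `4` is the price of replacing `k²`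
  -- by `(1 + |k|)²`.
  have h4 : rho k ^ 4 ≤ 4 * (k : ℝ) ^ 2 := by
    rw [show 4 = 2 * 2 by norm_num, pow_mul, rho_sq, ← sq_abs (k : ℝ)]
    nlinarith
  have h5 := rho_pow_mul_heatFactor_le (r := ε / 2) (by positivity) (q + 4) hk
  have hh := heatFactor_pos (ε / 2) k
  have h6 : (k : ℝ) ^ 2 * heatFactor (ε / 2) k * ‖fc (cpt (τ (t - ε / 2)) i) k‖
      ≤ rho k ^ 4 * heatFactor (ε / 2) k := by
    calc _ ≤ rho k ^ 4 * heatFactor (ε / 2) k * 1 := by gcongr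
      _ = _ := mul_one _
  calc rho k ^ (q + 4) * ‖fc (cpt (τ t) i) k‖
      = rho k ^ q * (rho k ^ 4 * ‖fc (cpt (τ t) i) k‖) := by rw [pow_add, mul_assoc]
    _ ≤ rho k ^ q * (4 * (k : ℝ) ^ 2 * ‖fc (cpt (τ t) i) k‖) := by gcongr
    _ = 4 * (rho k ^ q * ((k : ℝ) ^ 2 * ‖fc (cpt (τ t) i) k‖)) := by ring
    _ ≤ 4 * (rho k ^ q * (rho k ^ 4 * heatFactor (ε / 2) k + N * (rho k ^ q)⁻¹)) := by
        gcongr; linarith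
    _ = 4 * (rho k ^ (q + 4) * heatFactor (ε / 2) k + N) := by rw [pow_add]; field_simp
    _ ≤ _ := by gcongr

section Bootstrap

variable {K : ℝ → ℝ → ℝ} {C : ℕ → ℝ → ℝ → ℝ}

/-- Decay of the Fourier coefficients of solutions for positive times, to any order. -/
lemma exists_decay_bound (hK : IsC1Kernel K) (hC : ForceBound K C)
    (hCc : ∀ n, Continuous fun q : ℝ × ℝ => C n q.1 q.2) {p : ℕ} (hp : 4 ≤ p) :
    ∃ B : ℝ → ℝ → ℝ → ℝ → ℝ, ∀ (T : ℝ) (τ : ℝ → ℝ → R3), IsMildSolution K T τ →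
      ∀ A δ H : ℝ, (∀ t ∈ Icc 0 T, TangentBound A δ H (τ t)) →
        ∀ ε : ℝ, 0 < ε → ∀ t ∈ Icc ε T, ∀ i, Decay p (B ε A δ H) (cpt (τ t) i) := by
  have hduh : ∀ (T : ℝ) (τ : ℝ → ℝ → R3), IsMildSolution K T τ →
      ∀ A δ H : ℝ, (∀ t ∈ Icc 0 T, TangentBound A δ H (τ t)) →
      ∃ f : ℝ → ℝ → R3, (∀ t ∈ Icc 0 T, IsNonlocalForce K (knot (τ t)) (f t)) ∧
        IsDuhamel T (lowerBound C A δ H) τ fun s => lowerOrder (f s) (τ s) := by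
    intro T τ hτ A δ H hb
    obtain ⟨f, h1, h2⟩ := hτ.duhamel
    exact ⟨f, h1, hτ.continuous, fun t ht => (lowerOrder_mean_le hC hCc (hb t ht) (h1 t ht)).1,
      fun t ht => (lowerOrder_mean_le hC hCc (hb t ht) (h1 t ht)).2, h2⟩
  induction p, hp using Nat.le_induction with
  | base =>
    -- The `L¹` bound of the lower order terms is decay of order `0`, and smoothing raises it to
    -- `4`.
    refine ⟨fun ε A δ H => 4 * (2 ^ (0 + 4) * ((0 + 4).factorial / (ε / 2) ^ (0 + 4))
      + lowerBound C A δ H), fun T τ hτ A δ H hb ε hε t ht i => ?_⟩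
    obtain ⟨f, h1, h2⟩ := hduh T τ hτ A δ H hb
    refine h2.decay (q := 0) (fun t ht => (hb t ht).toIsTangent) hε (fun s hs j k => ?_) ht i
    have hs' : s ∈ Icc 0 T := ⟨by linarith [hs.1], hs.2⟩
    rw [pow_zero, one_mul]
    exact (norm_fc_cpt_le_mean (h2.integrable s hs') j k).trans (h2.mean_le s hs')
  | succ p hp ih =>
    obtain ⟨B, hB⟩ := ih
    -- Order `p` on `[ε / 2, T]` gives the lower order terms order `p - 3` there, and smoothing
    -- yields `p - 3 + 4 = p + 1` on `[ε, T]`.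
    refine ⟨fun ε A δ H => 4 * (2 ^ (p - 3 + 4) *
      ((p - 3 + 4).factorial / (ε / 2) ^ (p - 3 + 4)) + stepBound p (B (ε / 2) A δ H)
        (forceStep C p (B (ε / 2) A δ H) δ) (lamBound C A δ H)),
      fun T τ hτ A δ H hb ε hε t ht i => ?_⟩
    obtain ⟨f, h1, h2⟩ := hduh T τ hτ A δ H hb
    refine Decay.mono (h2.decay (q := p - 3) (fun t ht => (hb t ht).toIsTangent) hε
      (fun s hs j => ?_) ht i) (by omega) le_rfl
    · have hs' : s ∈ Icc 0 T := ⟨by linarith [hs.1], hs.2⟩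
      exact decay_lowerOrder hK hC hCc (hb s hs') (h1 s hs') hp
        (hB T τ hτ A δ H hb (ε / 2) (by positivity) s hs) j

end Bootstrap

/-! ### Smoothness -/

lemma iteratedDeriv_mul_expI (n : ℕ) (c : ℂ) (k : ℤ) :
    iteratedDeriv n (fun x => c * expI k x) = fun x => (Complex.I * k) ^ n * c * expI k x := by
  induction n generalizing c with
  | zero => simp
  | succ n ih =>
    have h : deriv (fun x => c * expI k x) = fun x => Complex.I * k * c * expI k x := by
      ext x; rw [((hasDerivAt_expI k x).const_mul c).deriv]; ring
    rw [iteratedDeriv_succ', h, ih]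
    ext x; ring

/-- Order `2m + 3` leaves the summable `(1 + |k|)^{-3/2}` after `m` termwise derivatives, so the
differentiated Fourier series converge uniformly. -/
lemma contDiff_of_decay {u : ℝ → ℂ} (hu : Continuous u) (hp : Function.Periodic u (2 * π))
    (h : ∀ m : ℕ, ∃ B, Decay (2 * m + 3) B u) : ContDiff ℝ (((⊤ : ℕ∞) : WithTop ℕ∞)) u := by
  have hs : ∀ m : ℕ, Summable fun k : ℤ => |(k : ℝ)| ^ m * ‖fc u k‖ := by
    intro m
    obtain ⟨B, hB⟩ := h m
    refine .of_nonneg_of_le (fun k => by positivity) (fun k => ?_) (summable_inv_rho_cube.mul_left B)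
    have hk := rho_pos k
    have h1 : |(k : ℝ)| ^ m ≤ rho k ^ (2 * m) := by
      rw [pow_mul, rho_sq]; gcongr; linarith
    calc |(k : ℝ)| ^ m * ‖fc u k‖ ≤ rho k ^ (2 * m) * (B * (rho k ^ (2 * m + 3))⁻¹) :=
          mul_le_mul h1 (hB.norm_le k) (norm_nonneg _) (by positivity)
      _ = B * (rho k)⁻¹ ^ 3 := by rw [pow_add]; field_simp
  have hs0 : Summable fun k => ‖fc u k‖ := by simpa using hs 0
  rw [show u = fun x => ∑' k, fc u k * expI k x from funext (eq_tsum_of_summable hu hp hs0)]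
  refine contDiff_tsum (v := fun m (k : ℤ) => |(k : ℝ)| ^ m * ‖fc u k‖) (fun k => ?_) (fun m _ => hs m)
    fun m k x _ => ?_
  · unfold expI
    exact contDiff_const.mul ((contDiff_const.mul Complex.ofRealCLM.contDiff).cexp)
  · rw [norm_iteratedFDeriv_eq_norm_iteratedDeriv, iteratedDeriv_mul_expI, norm_mul, norm_mul,
      norm_pow, norm_mul, Complex.norm_I, one_mul, Complex.norm_intCast, norm_expI, mul_one]

lemma contDiff_of_decay_cpt {u : ℝ → R3} (hu : Continuous u) (hp : Function.Periodic u (2 * π))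
    (h : ∀ m : ℕ, ∃ B, ∀ i, Decay (2 * m + 3) B (cpt u i)) :
    ContDiff ℝ (((⊤ : ℕ∞) : WithTop ℕ∞)) u := by
  rw [contDiff_euclidean]
  intro i
  have h1 := contDiff_of_decay (continuous_cpt hu i) (fun y => by simp only [cpt, hp y])
    fun m => (h m).imp fun B hB => hB i
  have h2 := Complex.reCLM.contDiff.comp h1
  exact h2

lemma pow_mul_norm_fourierVec_le_of_decay {s p : ℕ} {B : ℝ} {u : ℝ → R3}
    (h : ∀ i, Decay p B (cpt u i)) (hsp : 2 * s ≤ p) (k : ℤ) :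
    |(k : ℝ)| ^ s * ‖fourierVec u k‖ ≤ 3 * B := by
  have hk := rho_pos k
  have h1 : |(k : ℝ)| ^ s ≤ rho k ^ p := by
    refine le_trans ?_ (pow_le_pow_right₀ (one_le_rho k) hsp)
    rw [pow_mul, rho_sq]; gcongr; linarith
  have h2 : ‖fourierVec u k‖ ≤ ∑ i, ‖fc (cpt u i) k‖ := by
    refine (abs_le_of_sq_le_sq' ?_ (Finset.sum_nonneg fun i _ => norm_nonneg _)).2
    rw [norm_sq_fourierVec]
    exact Finset.sum_sq_le_sq_sum_of_nonneg fun i _ => norm_nonneg _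
  calc |(k : ℝ)| ^ s * ‖fourierVec u k‖ ≤ rho k ^ p * ∑ i, ‖fc (cpt u i) k‖ := by gcongr
    _ ≤ ∑ _i : Fin 3, B := by rw [Finset.mul_sum]; exact Finset.sum_le_sum fun i _ => h i k
    _ = 3 * B := by simp

lemma sobolevNorm_eq_of_mean_zero {s : ℕ} {τ : ℝ → R3} (hτ : IsTangent τ) :
    sobolevNorm s τ = homSobolevNorm s τ := by
  have h0 : ‖fourierVec τ 0‖ ^ 2 = 0 := by
    rw [norm_sq_fourierVec]; simp [hτ.fc_zero]
  rw [sobolevNorm, h0, zero_add, Real.sqrt_sq (homSobolevNorm_nonneg _ _)]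

end CurveFlow

end

/-! ### The corollary -/

theorem mainTheorem5
    (K : ℝ → ℝ → ℝ) (hK : CurveFlow.IsC1Kernel K)
    (C : ℕ → ℝ → ℝ → ℝ) (hC : ∀ n, Continuous fun q : ℝ × ℝ => C n q.1 q.2)
    (hf : ∀ (n : ℕ) (γ : ℝ → CurveFlow.R3),
      CurveFlow.IsUnitSpeedCurve (n + 2) γ → CurveFlow.IsBiLipschitz γ →
      ∀ f : ℝ → CurveFlow.R3, CurveFlow.IsNonlocalForce K γ f →
        ∃ g : ℝ → CurveFlow.R3,
          MeasureTheory.MemLp g 2 CurveFlow.torusMeasure ∧ CurveFlow.IsWeakDeriv n f g ∧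
          CurveFlow.l2Norm g ≤
            C n (CurveFlow.distortion γ).toReal (CurveFlow.homSobolevNorm (n + 2) γ)) :
    ∃ D : ℕ → ℝ → ℝ → ℝ → ℝ → ℝ,
      ∀ (T : ℝ) (τ : ℝ → ℝ → CurveFlow.R3), 0 < T →
        CurveFlow.IsMildSolution K T τ →
        (∀ t ∈ Set.Icc 0 T, CurveFlow.mean (τ t) = 0) →
        (∀ t ∈ Set.Icc 0 T, ∀ x, ‖τ t x‖ = 1) →
        (∀ t ∈ Set.Icc 0 T, CurveFlow.IsBiLipschitz (CurveFlow.knot (τ t))) →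
        (∀ t ∈ Set.Icc 0 T, IsUnit (CurveFlow.constraintMatrix (τ t))) ∧
        ∃ A δ H : ℝ,
          IsGreatest ((fun t => CurveFlow.invNorm (τ t)) '' Set.Icc 0 T) A ∧
          IsGreatest ((fun t => (CurveFlow.distortion (CurveFlow.knot (τ t))).toReal) ''
            Set.Icc 0 T) δ ∧
          IsGreatest ((fun t => CurveFlow.sobolevNorm 1 (τ t)) '' Set.Icc 0 T) H ∧
          (∀ t ∈ Set.Ioc 0 T, ContDiff ℝ (((⊤ : ℕ∞) : WithTop ℕ∞)) (τ t)) ∧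
          ∀ (n : ℕ) (ε : ℝ), 0 < ε → ∀ t ∈ Set.Icc ε T,
            CurveFlow.MemSobolev (n + 2) (τ t) ∧
            CurveFlow.sobolevNorm (n + 2) (τ t) ≤ D n ε A δ H ∧
            ∀ k : ℤ, |(k : ℝ)| ^ (n + 3) * ‖CurveFlow.fourierVec (τ t) k‖ ≤ D n ε A δ H := by
  have hC' : CurveFlow.ForceBound K C := hf
  -- Order `2n + 6` is what both conclusions need: `2s + 2` for the `H^s` bound with `s = n + 2`,
  -- and `2(n + 3)` for the weight `|k|^{n+3}`.
  choose B hB using fun n : ℕ => CurveFlow.exists_decay_bound hK hC' hC (p := 2 * n + 6) (by omega)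
  refine ⟨fun n ε A δ H => max √(3 * B n ε A δ H ^ 2 * CurveFlow.rhoSum) (3 * B n ε A δ H),
    fun T τ hT hτ h0 h1 hbl => ?_⟩
  have ht : ∀ t ∈ Set.Icc 0 T, CurveFlow.IsTangent (τ t) := fun t h =>
    ⟨hτ.continuous t h, hτ.periodic t h, hτ.memSobolev t h, h0 t h, h1 t h, hbl t h⟩
  refine ⟨fun t h => CurveFlow.isUnit_constraintMatrix (ht t h).continuous (h0 t h) (h1 t h), ?_⟩
  obtain ⟨⟨A, hA⟩, ⟨δ, hδ⟩, ⟨H, hH⟩⟩ := CurveFlow.exists_isGreatest hT hτ ht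
  have hb : ∀ t ∈ Set.Icc 0 T, CurveFlow.TangentBound A δ H (τ t) := fun t h =>
    ⟨ht t h, hA.2 ⟨t, h, rfl⟩, hδ.2 ⟨t, h, rfl⟩, hH.2 ⟨t, h, rfl⟩⟩
  refine ⟨A, δ, H, hA, hδ, hH, fun t h => ?_, fun n ε hε t h => ?_⟩
  · have hT' : t ∈ Set.Icc 0 T := ⟨h.1.le, h.2⟩
    exact CurveFlow.contDiff_of_decay_cpt (hτ.continuous t hT') (hτ.periodic t hT') fun m =>
      -- For smoothness at a single time `t > 0` one may take `ε = t`.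
      ⟨_, fun i => (hB m T τ hτ A δ H hb t h.1 t ⟨le_rfl, h.2⟩ i).mono (by omega) le_rfl⟩
  · have hT' : t ∈ Set.Icc 0 T := ⟨hε.le.trans h.1, h.2⟩
    have hd := hB n T τ hτ A δ H hb ε hε t h
    obtain ⟨m1, m2⟩ := CurveFlow.Decay.memSobolev (s := n + 2) (ht t hT').memSobolev.1 hd (by omega)
    refine ⟨m1, ?_, fun k => ?_⟩
    · rw [CurveFlow.sobolevNorm_eq_of_mean_zero (ht t hT')]
      exact m2.trans (le_max_left _ _)
    · exact (CurveFlow.pow_mul_norm_fourierVec_le_of_decay hd (by omega) k).trans (le_max_right _ _)
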